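/- **Setting.** Let $f(x)=\frac1n\sum_{i=1}^n f_i(x)$ on $\mathbb R^d$ with $n\ge1$. Assume that every $f_i$ is convex and $L$-smooth ($L>0$), i.e. differentiable with $L$-Lipschitz gradient, and that $f$ is $\mu$-quasi strongly convex with $\mu\ge 0$: $f$ has a minimizer $x^*$ and $f(x^*)\ge f(x)+\langle\nabla f(x),x^*-x\rangle+\frac\mu2\|x-x^*\|^2$ for all $x$. Let $C$ be a (possibly random, possibly biased) compressor with $\mathbf E\|C(x)-x\|^2\le(1-\delta)\|x\|^2$ for all $x$, where $\delta\in(0,1]$, and let $Q$ be a random unbiased quantizer with $\mathbf E\,Q(x)=x$ and $\mathbf E\|Q(x)-x\|^2\le\omega\|x\|^2$ for all $x$, where $\omega\ge0$. **EC-SGD-DIANA.** Given $\gamma,\alpha>0$ and deterministic $x^0,h_1^0,\dots,h_n^0\in\mathbb R^d$, put $e_i^0=0$ and for $k\ge0$ $$g_i^k=\hat g_i^k-h_i^k+h^k,\quad h^k=\tfrac1n\sum_i h_i^k,\quad v_i^k=C(e_i^k+\gamma g_i^k),\quad e_i^{k+1}=e_i^k+\gamma g_i^k-v_i^k,$$ $$h_i^{k+1}=h_i^k+\alpha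 Q(\hat g_i^k-h_i^k),\qquad x^{k+1}=x^k-\tfrac1n\sum_i v_i^k .$$ Let $\mathcal F_k$ be the $\sigma$-algebra generated by everything sampled in iterations $0,\dots,k-1$ and write $\mathbf E_k=\mathbf E[\,\cdot\mid\mathcal F_k]$. Given $\mathcal F_k$, the vectors $\hat g_1^k,\dots,\hat g_n^k$ are independent with $\mathbf E_k\hat g_i^k=\nabla f_i(x^k)$ and $\mathbf E_k\|\hat g_i^k-\nabla f_i(x^k)\|^2\le\widetilde D_{1,i}$; the randomness of $C$ and of $Q$ used by worker $i$ in iteration $k$ is independent of $\mathcal F_k$ and of $(\hat g_j^k)_j$. Put $g^k=\frac1n\sum_i g_i^k$, $e^k=\frac1n\sum_i e_i^k$, $\bar g_i^k=\mathbf E_k g_i^k$, $\widetilde D_1=\frac1n\sum_i\widetilde D_{1,i}$ and $\sigma_k^2=\frac1n\sum_i\|h_i^k-\nabla f_i(x^*)\|^2$. **Theorem.** Let $$0<\gamma\le\min\Big\{\frac1{4L},\frac{\delta\sqrt{1-\alpha}}{8L\sqrt{6(3-\alpha)}}\Big\},\qquad 0<\alpha\le\frac1{\omega+1},$$ and put $\eta=\min\{\frac{\gamma\mu}2,\frac\alpha4\}$,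 $w_k=(1-\eta)^{-(k+1)}$, $W_K=\sum_{k=0}^K w_k$, $\bar x^K=\frac1{W_K}\sum_{k=0}^K w_kx^k$. 1. EC-SGD-DIANA satisfies the parametric assumption: the constants are nonnegative, $\rho_1,\rho_2\in[0,1]$, $\mathbf E_k g^k=\nabla f(x^k)$, and for all $k\ge0$, almost surely, $$\begin{aligned} \tfrac1n\textstyle\sum_i\|\bar g_i^k\|^2&\le 2A(f(x^k)-f(x^*))+B_1\sigma_{1,k}^2+B_2\sigma_{2,k}^2+D_1,\\ \tfrac1n\textstyle\sum_i\mathbf E_k\|g_i^k-\bar g_i^k\|^2&\le 2\widetilde A(f(x^k)-f(x^*))+\widetilde B_1\sigma_{1,k}^2+\widetilde B_2\sigma_{2,k}^2+\widetilde D_1,\\ \mathbf E_k\|g^k\|^2&\le 2A'(f(x^k)-f(x^*))+B_1'\sigma_{1,k}^2+B_2'\sigma_{2,k}^2+D_1',\\ \mathbf E_k\sigma_{1,k+1}^2&\le(1-\rho_1)\sigma_{1,k}^2+2C_1(f(x^k)-f(x^*))+G\rho_1\sigma_{2,k}^2+D_2,\\ \mathbf E_k\sigma_{2,k+1}^2&\le(1-\rho_2)\sigma_{2,k}^2+2C_2(f(x^k)-f(x^*)),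 \end{aligned}$$ and for all $K\ge0$ $$3L\sum_{k=0}^K w_k\mathbf E\|e^k\|^2\le\frac14\sum_{k=0}^K w_k\mathbf E[f(x^k)-f(x^*)]+F_1\sigma_{1,0}^2+F_2\sigma_{2,0}^2+\gamma D_3W_K,$$ with $\sigma_{1,k}^2=\sigma_k^2$, $\sigma_{2,k}^2\equiv0$, $A=2L$, $\widetilde A=0$, $A'=L$, $B_1=2$, $B_2=\widetilde B_1=\widetilde B_2=B_1'=B_2'=0$, $\rho_1=\alpha$, $\rho_2=1$, $C_1=L\alpha$, $C_2=0$, $G=0$, $D_1=0$, $D_1'=\frac{\widetilde D_1}n$, $D_2=\alpha^2(\omega+1)\widetilde D_1$, and $$F_1=\frac{96L\gamma^2}{\delta^2\alpha(1-\eta)},\quad F_2=0,\quad D_3=\frac{6L\gamma}\delta\Big(\frac{4\alpha(\omega+1)}\delta+1\Big)\widetilde D_1 ;$$ moreover $M_1=\frac{4B_1'}{3\rho_1}=0$, $M_2=\frac{4(B_2'+\frac43G)}{3\rho_2}=0$ and $\min\{\frac{\gamma\mu}2,\frac{\rho_1}4,\frac{\rho_2}4\}=\eta$. 2. If $\mu>0$,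 then for all $K\ge0$ $$\mathbf E[f(\bar x^K)-f(x^*)]\le(1-\eta)^K\,\frac{4(\|x^0-x^*\|^2+\gamma F_1\sigma_0^2)}\gamma+4\gamma(D_1'+D_3).$$ 3. If $\mu=0$, then for all $K\ge1$ $$\mathbf E[f(\bar x^K)-f(x^*)]\le\frac{4(\|x^0-x^*\|^2+\gamma F_1\sigma_0^2)}{\gamma K}+4\gamma(D_1'+D_3).$$ 4. (EC-GD-DIANA.) If $\widetilde D_1=0$, then $\hat g_i^k=\nabla f_i(x^k)$ almost surely and $D_1'=D_3=0$. If moreover $\mu>0$, $\alpha=\min\{\frac1{\omega+1},\frac12\}$ and $\gamma=\min\{\frac1{4L},\frac{\delta\sqrt{1-\alpha}}{8L\sqrt{6(3-\alpha)}}\}$, then with $\kappa=L/\mu$ and $\Delta_0=\frac4\gamma(\|x^0-x^*\|^2+\gamma F_1\sigma_0^2)$, for every $\varepsilon>0$ the bound $\mathbf E[f(\bar x^K)-f(x^*)]\le\varepsilon$ holds for all $K\ge100\left(\omega+\frac\kappa\delta\right)\ln\frac{\Delta_0}\varepsilon$ (with no condition on $K$ if $\Delta_0=0$), and for all sufficiently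 small $\varepsilon>0$ it holds for all $K\ge200\left(\omega+\frac\kappa\delta\right)\ln\frac1\varepsilon$; that is, the number of iterations is $\mathcal O\left((\omega+\frac\kappa\delta)\ln\frac1\varepsilon\right)$ with an absolute constant. -/

import Mathlib

open MeasureTheory ProbabilityTheory

namespace ECDiana

/-- The space `ℝ^d` with its Euclidean norm. -/
abbrev E (d : ℕ) : Type := EuclideanSpace ℝ (Fin d)

/-- The arithmetic mean `(1/n) ∑ᵢ vᵢ`. -/
noncomputable def avg {n : ℕ} {V : Type*} [AddCommGroup V] [Module ℝ V] (v : Fin n → V) : V :=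
  (n : ℝ)⁻¹ • ∑ i, v i

/-- `f` is `L`-smooth: differentiable with `L`-Lipschitz gradient. -/
def IsLSmooth {d : ℕ} (f : E d → ℝ) (L : ℝ) : Prop :=
  Differentiable ℝ f ∧ ∀ x y, ‖gradient f x - gradient f y‖ ≤ L * ‖x - y‖

/-- `f` is `μ`-quasi strongly convex with respect to its minimizer `xs`. -/
def IsQuasiStronglyConvex {d : ℕ} (f : E d → ℝ) (xs : E d) (μ : ℝ) : Prop :=
  (∀ x, f xs ≤ f x) ∧
    ∀ x, f x + inner ℝ (gradient f x) (xs - x) + μ / 2 * ‖x - xs‖ ^ 2 ≤ f xs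

/-- A random operator `C s x` (with random seed `s ∼ ν`) which is a, possibly biased, compressor:
`𝔼‖C(x) - x‖² ≤ (1 - δ)‖x‖²` for every `x`. Deterministic operators are the case of a one-point
seed space. -/
structure IsCompressor {d : ℕ} {S : Type*} [MeasurableSpace S] (ν : Measure S)
    (C : S → E d → E d) (δ : ℝ) : Prop where
  measurable : Measurable (Function.uncurry C)
  delta_pos : 0 < δ
  delta_le_one : δ ≤ 1
  memLp : ∀ x, MemLp (fun s => C s x - x) 2 ν
  contraction : ∀ x, ∫ s, ‖C s x - x‖ ^ 2 ∂ν ≤ (1 - δ) * ‖x‖ ^ 2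

/-- A random operator `Q s x` (with random seed `s ∼ ν`) which is an unbiased quantizer:
`𝔼 Q(x) = x` and `𝔼‖Q(x) - x‖² ≤ ω‖x‖²` for every `x`. -/
structure IsQuantizer {d : ℕ} {S : Type*} [MeasurableSpace S] (ν : Measure S)
    (Q : S → E d → E d) (ω : ℝ) : Prop where
  measurable : Measurable (Function.uncurry Q)
  omega_nonneg : 0 ≤ ω
  memLp : ∀ x, MemLp (fun s => Q s x - x) 2 ν
  unbiased : ∀ x, ∫ s, Q s x ∂ν = x
  variance : ∀ x, ∫ s, ‖Q s x - x‖ ^ 2 ∂ν ≤ ω * ‖x‖ ^ 2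

/-- The vectors kept by the method at the beginning of an iteration: the iterate `x`, and the
error `e i` and the shift `h i` of each worker `i`. -/
structure State (n d : ℕ) where
  x : E d
  e : Fin n → E d
  h : Fin n → E d

/-- The input of the method: stepsizes, starting vectors, the two random operators, and, for each
iteration `k` and worker `i`, the stochastic gradient `ghat k i` and the random seeds `ξ k i`,
`ζ k i` used by the compressor and by the quantizer. -/
structure Input (n d : ℕ) (Ω SC SQ : Type*) where
  γ : ℝ
  α : ℝ
  x0 : E d
  h0 : Fin n → E d
  C : SC → E d → E d
  Q : SQ → E d → E d
  ghat : ℕ → Fin n → Ω → E d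
  ξ : ℕ → Fin n → Ω → SC
  ζ : ℕ → Fin n → Ω → SQ

namespace Input

variable {n d : ℕ} {Ω SC SQ : Type*}

/-- The EC-SGD-DIANA recursion. -/
noncomputable def state (I : Input n d Ω SC SQ) (ω : Ω) : ℕ → State n d
  | 0 => ⟨I.x0, fun _ => 0, I.h0⟩
  | k + 1 =>
    let s := state I ω k
    let g : Fin n → E d := fun i => I.ghat k i ω - s.h i + avg s.h
    let v : Fin n → E d := fun i => I.C (I.ξ k i ω) (s.e i + I.γ • g i)
    { x := s.x - avg v
      e := fun i => s.e i + I.γ • g i - v i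
      h := fun i => s.h i + I.α • I.Q (I.ζ k i ω) (I.ghat k i ω - s.h i) }

/-- The iterate `x^k`. -/
noncomputable def x (I : Input n d Ω SC SQ) (k : ℕ) (ω : Ω) : E d := (I.state ω k).x

/-- The error `e_i^k`. -/
noncomputable def e (I : Input n d Ω SC SQ) (k : ℕ) (i : Fin n) (ω : Ω) : E d :=
  (I.state ω k).e i

/-- The shift `h_i^k`. -/
noncomputable def h (I : Input n d Ω SC SQ) (k : ℕ) (i : Fin n) (ω : Ω) : E d :=
  (I.state ω k).h i

/-- The gradient estimator `g_i^k = ĝ_i^k - h_i^k + h^k`. -/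
noncomputable def g (I : Input n d Ω SC SQ) (k : ℕ) (i : Fin n) (ω : Ω) : E d :=
  I.ghat k i ω - I.h k i ω + avg (fun j => I.h k j ω)

/-- `σ_k² = (1/n) ∑ᵢ ‖h_i^k - ∇f_i(x^*)‖²`. -/
noncomputable def sigmaSq (I : Input n d Ω SC SQ) (f : Fin n → E d → ℝ) (xs : E d)
    (k : ℕ) (ω : Ω) : ℝ :=
  avg (fun i => ‖I.h k i ω - gradient (f i) xs‖ ^ 2)

/-- The history before iteration `k`: the σ-algebra generated by everything sampled in the
iterations `0, …, k - 1`. -/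
@[reducible] def history [MeasurableSpace SC] [MeasurableSpace SQ] (I : Input n d Ω SC SQ) (k : ℕ) :
    MeasurableSpace Ω :=
  ⨆ (j : ℕ) (_ : j < k) (i : Fin n),
    (MeasurableSpace.comap (I.ghat j i) inferInstance ⊔
      MeasurableSpace.comap (I.ξ j i) inferInstance ⊔
      MeasurableSpace.comap (I.ζ j i) inferInstance)

/-- The history before iteration `k` together with the stochastic gradients of iteration `k`. -/
@[reducible] def historyGrad [MeasurableSpace SC] [MeasurableSpace SQ] (I : Input n d Ω SC SQ) (k : ℕ) :
    MeasurableSpace Ω :=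
  I.history k ⊔ ⨆ i : Fin n, MeasurableSpace.comap (I.ghat k i) inferInstance

end Input

/-- Conditional (mutual) independence of `X₁, …, X_n` given the σ-algebra `m`:
`ℙ(X_i ∈ A_i for all i | m) = ∏ᵢ ℙ(X_i ∈ A_i | m)` almost surely, for all measurable `A_i`. -/
def CondIndependent {n d : ℕ} {Ω : Type*} [MeasurableSpace Ω] (P : Measure Ω)
    (m : MeasurableSpace Ω) (X : Fin n → Ω → E d) : Prop :=
  ∀ A : Fin n → Set (E d), (∀ i, MeasurableSet (A i)) →
    P[(⋂ i, X i ⁻¹' A i).indicator (fun _ => (1 : ℝ)) | m]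
      =ᵐ[P] fun ω => ∏ i, (P[(X i ⁻¹' A i).indicator (fun _ => (1 : ℝ)) | m]) ω

/-- The sampling rules of the method. Given the history, `ghat k i` is an unbiased estimator of
`∇f_i(x^k)` with variance at most `Dt i`, sampled independently by the different workers; the
seeds of the compressor and of the quantizer are drawn from `νC` and `νQ`, each independently of
the history and of the stochastic gradients of the current iteration. -/
structure Sampling {n d : ℕ} {Ω SC SQ : Type*} [MeasurableSpace Ω] [MeasurableSpace SC]
    [MeasurableSpace SQ] (P : Measure Ω) (νC : Measure SC) (νQ : Measure SQ)
    (f : Fin n → E d → ℝ) (Dt : Fin n → ℝ) (I : Input n d Ω SC SQ) : Prop where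
  measurable_ghat : ∀ k i, Measurable (I.ghat k i)
  measurable_xi : ∀ k i, Measurable (I.ξ k i)
  measurable_zeta : ∀ k i, Measurable (I.ζ k i)
  memLp : ∀ k i, MemLp (fun ω => I.ghat k i ω - gradient (f i) (I.x k ω)) 2 P
  unbiased : ∀ k i,
    P[I.ghat k i | I.history k] =ᵐ[P] fun ω => gradient (f i) (I.x k ω)
  variance : ∀ k i,
    P[fun ω => ‖I.ghat k i ω - gradient (f i) (I.x k ω)‖ ^ 2 | I.history k]
      ≤ᵐ[P] fun _ => Dt i
  condIndep : ∀ k, CondIndependent P (I.history k) (I.ghat k)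
  law_xi : ∀ k i, P.map (I.ξ k i) = νC
  law_zeta : ∀ k i, P.map (I.ζ k i) = νQ
  indep_xi : ∀ k i,
    Indep (MeasurableSpace.comap (I.ξ k i) inferInstance) (I.historyGrad k) P
  indep_zeta : ∀ k i,
    Indep (MeasurableSpace.comap (I.ζ k i) inferInstance) (I.historyGrad k) P

/-- The constants of the parametric assumption; a final `t` stands for a tilde and a final `p` for
a prime. -/
structure Params where
  A : ℝ
  At : ℝ
  Ap : ℝ
  B1 : ℝ
  B2 : ℝ
  B1t : ℝ
  B2t : ℝ
  B1p : ℝ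
  B2p : ℝ
  C1 : ℝ
  C2 : ℝ
  G : ℝ
  D1 : ℝ
  D1t : ℝ
  D1p : ℝ
  D2 : ℝ
  ρ1 : ℝ
  ρ2 : ℝ

namespace Params

/-- `M₁ = 4B₁'/(3ρ₁)`. -/
noncomputable def M1 (p : Params) : ℝ := 4 * p.B1p / (3 * p.ρ1)

/-- `M₂ = 4(B₂' + (4/3)G)/(3ρ₂)`. -/
noncomputable def M2 (p : Params) : ℝ := 4 * (p.B2p + 4 / 3 * p.G) / (3 * p.ρ2)

/-- `η = min{γμ/2, ρ₁/4, ρ₂/4}`. -/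
noncomputable def eta (p : Params) (γ μ : ℝ) : ℝ :=
  min (γ * μ / 2) (min (p.ρ1 / 4) (p.ρ2 / 4))

end Params

/-- The key parametric assumption, for a method with iterates `x k` and gradient estimators
`g k i`, where `ℱ k` is the information available at the beginning of iteration `k`, and
`s1 k`, `s2 k` are the squared variance-reduction quantities `σ²_{1,k}`, `σ²_{2,k}`. The
integrability fields make every expectation below a genuine one. -/
structure KeyAssumption {n d : ℕ} {Ω : Type*} [m0 : MeasurableSpace Ω] (P : Measure Ω)
    (ℱ : ℕ → MeasurableSpace Ω) (f : E d → ℝ) (xs : E d) (x : ℕ → Ω → E d)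
    (g : ℕ → Fin n → Ω → E d) (s1 s2 : ℕ → Ω → ℝ) (p : Params) : Prop where
  const_nonneg : 0 ≤ p.A ∧ 0 ≤ p.At ∧ 0 ≤ p.Ap ∧ 0 ≤ p.B1 ∧ 0 ≤ p.B2 ∧ 0 ≤ p.B1t ∧ 0 ≤ p.B2t ∧
    0 ≤ p.B1p ∧ 0 ≤ p.B2p ∧ 0 ≤ p.C1 ∧ 0 ≤ p.C2 ∧ 0 ≤ p.G ∧ 0 ≤ p.D1 ∧ 0 ≤ p.D1t ∧
    0 ≤ p.D1p ∧ 0 ≤ p.D2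
  rho1_mem : p.ρ1 ∈ Set.Icc (0 : ℝ) 1
  rho2_mem : p.ρ2 ∈ Set.Icc (0 : ℝ) 1
  mono : Monotone ℱ
  le : ∀ k, ℱ k ≤ m0
  measurable_x : ∀ k, Measurable[ℱ k] (x k)
  measurable_s1 : ∀ k, Measurable[ℱ k] (s1 k)
  measurable_s2 : ∀ k, Measurable[ℱ k] (s2 k)
  s1_nonneg : ∀ k ω, 0 ≤ s1 k ω
  s2_nonneg : ∀ k ω, 0 ≤ s2 k ω
  memLp_g : ∀ k i, MemLp (g k i) 2 P
  integrable_s1 : ∀ k, Integrable (s1 k) P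
  integrable_s2 : ∀ k, Integrable (s2 k) P
  unbiased : ∀ k, P[fun ω => avg (fun i => g k i ω) | ℱ k] =ᵐ[P] fun ω => gradient f (x k ω)
  second_moment_mean : ∀ k, ∀ᵐ ω ∂P,
    avg (fun i => ‖(P[g k i | ℱ k]) ω‖ ^ 2)
      ≤ 2 * p.A * (f (x k ω) - f xs) + p.B1 * s1 k ω + p.B2 * s2 k ω + p.D1
  variance : ∀ k, ∀ᵐ ω ∂P,
    avg (fun i => (P[fun ω' => ‖g k i ω' - (P[g k i | ℱ k]) ω'‖ ^ 2 | ℱ k]) ω)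
      ≤ 2 * p.At * (f (x k ω) - f xs) + p.B1t * s1 k ω + p.B2t * s2 k ω + p.D1t
  second_moment : ∀ k, ∀ᵐ ω ∂P,
    (P[fun ω' => ‖avg (fun i => g k i ω')‖ ^ 2 | ℱ k]) ω
      ≤ 2 * p.Ap * (f (x k ω) - f xs) + p.B1p * s1 k ω + p.B2p * s2 k ω + p.D1p
  s1_recursion : ∀ k, ∀ᵐ ω ∂P,
    (P[s1 (k + 1) | ℱ k]) ω
      ≤ (1 - p.ρ1) * s1 k ω + 2 * p.C1 * (f (x k ω) - f xs) + p.G * p.ρ1 * s2 k ω + p.D2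
  s2_recursion : ∀ k, ∀ᵐ ω ∂P,
    (P[s2 (k + 1) | ℱ k]) ω ≤ (1 - p.ρ2) * s2 k ω + 2 * p.C2 * (f (x k ω) - f xs)

/-- The weights `w_k = (1 - η)^{-(k+1)}`. -/
noncomputable def weight (η : ℝ) (k : ℕ) : ℝ := ((1 - η) ^ (k + 1))⁻¹

/-- `W_K = ∑_{k=0}^K w_k`. -/
noncomputable def weightSum (η : ℝ) (K : ℕ) : ℝ := ∑ k ∈ Finset.range (K + 1), weight η k

/-- The weighted average `x̄^K = (1/W_K) ∑_{k=0}^K w_k x^k`. -/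
noncomputable def wavg {d : ℕ} {Ω : Type*} (η : ℝ) (x : ℕ → Ω → E d) (K : ℕ) (ω : Ω) : E d :=
  (weightSum η K)⁻¹ • ∑ k ∈ Finset.range (K + 1), weight η k • x k ω

/-- The bound on the accumulated errors `e^k = (1/n) ∑ᵢ e_i^k` in the parametric assumption, with
constants `F1`, `F2`, `D3`. -/
structure ErrorBound {n d : ℕ} {Ω : Type*} [MeasurableSpace Ω] (P : Measure Ω)
    (f : E d → ℝ) (xs : E d) (x : ℕ → Ω → E d) (e : ℕ → Fin n → Ω → E d) (s1 s2 : ℕ → Ω → ℝ)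
    (L γ η F1 F2 D3 : ℝ) : Prop where
  const_nonneg : 0 ≤ F1 ∧ 0 ≤ F2 ∧ 0 ≤ D3
  memLp_e : ∀ k i, MemLp (e k i) 2 P
  integrable_f : ∀ k, Integrable (fun ω => f (x k ω) - f xs) P
  bound : ∀ K : ℕ,
    3 * L * ∑ k ∈ Finset.range (K + 1), weight η k * ∫ ω, ‖avg (fun i => e k i ω)‖ ^ 2 ∂P
      ≤ 1 / 4 * ∑ k ∈ Finset.range (K + 1), weight η k * ∫ ω, (f (x k ω) - f xs) ∂P
        + F1 * ∫ ω, s1 0 ω ∂P + F2 * ∫ ω, s2 0 ω ∂P + γ * D3 * weightSum η K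

/-- The constants of the parametric assumption for EC-SGD-DIANA with `n` workers, where
`D = (1/n) ∑ᵢ D̃_{1,i}`. -/
noncomputable def dianaParams (n : ℕ) (L α ω D : ℝ) : Params where
  A := 2 * L
  At := 0
  Ap := L
  B1 := 2
  B2 := 0
  B1t := 0
  B2t := 0
  B1p := 0
  B2p := 0
  C1 := L * α
  C2 := 0
  G := 0
  D1 := 0
  D1t := D
  D1p := D / n
  D2 := α ^ 2 * (ω + 1) * D
  ρ1 := α
  ρ2 := 1

/-- The largest stepsize `min{1/(4L), δ√(1-α)/(8L√(6(3-α)))}`. -/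
noncomputable def maxStep (L δ α : ℝ) : ℝ :=
  min (1 / (4 * L)) (δ * √(1 - α) / (8 * L * √(6 * (3 - α))))

end ECDiana

/-! The mechanism is error feedback seen through the perturbed iterate `x^k - e^k`. What the
compressor drops is stored in `e_i`, so the perturbed iterate moves by exactly `-γ g^k`
(`Input.perturbed_succ`), and in the mean `g^k` the shifts cancel, leaving the average of the
stochastic gradients. Thus the perturbed iterate performs unbiased SGD, except that the gradient is
evaluated at `x^k` instead of `x^k - e^k`. Convexity, smoothness and quasi strong convexity turn
this mismatch into a penalty `3Lγ‖e^k‖²` against a gain `γ/2 (f(x^k) - f(x^*))`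
(`perturbed_step_le`). The noise contributes `γ² D̃₁/n`, since conditionally independent workers are
conditionally uncorrelated (`CondIndependent.condExp_inner_sub_eq_zero`).

The errors remain to be controlled. The compressor contracts, so `E‖e_i‖²` obeys a recursion with
factor `1 - δ/2` driven by the conditional means `∇f_i(x^k) - h_i^k + h^k` of the estimators
(`Sampling.integral_sq_norm_e_succ_le`). Their mean square is at most `4L(f(x^k) - f(x^*)) + 2σ_k²`,
and the quantized shift update makes `σ_k²` contract with factor `1 - α`, driven by the same gap
(`Sampling.condExp_sigmaSq_succ_le`). Both recursions are unrolled with the weights `w_k` by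
`exists_majorant`. This costs little because `η ≤ α/4` and `η ≤ δ/64`, the latter because `μ ≤ L`.
The stepsize bound makes the accumulated penalty at most a quarter of the weighted gaps, plus
initial and noise terms (`Sampling.error_sum_le`).

Telescoping the one-step inequality and applying Jensen's inequality to the weighted average gives
`Sampling.integral_gap_wavg_le`. The rates follow from lower bounds on `W_K`, and the complexity
from `1 - η ≤ exp(-η)` together with `1 ≤ 100 η (ω + κ/δ)`.

On the probabilistic side, fresh seeds are integrated out with their arguments frozen. This yields
integrability and bounds on conditional expectations at once, so the square integrability of all
vectors is proved along the recursion. -/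

open scoped ENNReal

namespace ECDiana

/-! ### Smooth convex functions. -/

section Smooth

variable {d : ℕ} {f : E d → ℝ} {L : ℝ}

theorem hasDerivAt_along_line (hf : Differentiable ℝ f) (x u : E d) (t : ℝ) :
    HasDerivAt (fun t : ℝ => f (x + t • u)) (inner ℝ (gradient f (x + t • u)) u) t := by
  have h1 : HasDerivAt (fun t : ℝ => x + t • u) u t := by
    simpa using ((hasDerivAt_id t).smul_const u).const_add x
  have h2 := (hf (x + t • u)).hasFDerivAt.comp_hasDerivAt t h1
  rwa [← inner_gradient_left] at h2

theorem inner_gradient_le_sub (hf : Differentiable ℝ f) (hc : ConvexOn ℝ Set.univ f) (x y : E d) :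
    f x + inner ℝ (gradient f x) (y - x) ≤ f y := by
  have hconv : ConvexOn ℝ Set.univ (fun t : ℝ => f (x + t • (y - x))) := by
    have := hc.comp_affineMap (AffineMap.lineMap x y : ℝ →ᵃ[ℝ] E d)
    refine (this.congr ?_)
    intro t _
    simp [AffineMap.lineMap_apply, add_comm]
  have hd := hasDerivAt_along_line hf x (y - x) 0
  have := hconv.le_slope_of_hasDerivAt (Set.mem_univ 0) (Set.mem_univ 1) zero_lt_one hd
  simp only [slope_def_field, one_smul, zero_smul, add_zero, add_sub_cancel, sub_zero,
    div_one] at this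
  linarith

/-- Along the segment, the difference of the two sides has nonpositive derivative because the
gradient is Lipschitz; monotonicity replaces integration of the gradient. -/
theorem IsLSmooth.le_quadratic (hf : IsLSmooth f L) (x y : E d) :
    f y ≤ f x + inner ℝ (gradient f x) (y - x) + L / 2 * ‖y - x‖ ^ 2 := by
  set u := y - x with hu
  let ψ : ℝ → ℝ := fun t =>
    f (x + t • u) - t * inner ℝ (gradient f x) u - t ^ 2 * (L / 2 * ‖u‖ ^ 2)
  have hd : ∀ t : ℝ, HasDerivAt ψ (inner ℝ (gradient f (x + t • u)) u
      - inner ℝ (gradient f x) u - 2 * t * (L / 2 * ‖u‖ ^ 2)) t := by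
    intro t
    have h1 := hasDerivAt_along_line hf.1 x u t
    have h2 : HasDerivAt (fun t : ℝ => t * inner ℝ (gradient f x) u)
        (inner ℝ (gradient f x) u) t := by
      simpa using (hasDerivAt_id t).mul_const (inner ℝ (gradient f x) u)
    have h3 : HasDerivAt (fun t : ℝ => t ^ 2 * (L / 2 * ‖u‖ ^ 2))
        (2 * t * (L / 2 * ‖u‖ ^ 2)) t := by
      simpa using (hasDerivAt_pow 2 t).mul_const (L / 2 * ‖u‖ ^ 2)
    exact (h1.sub h2).sub h3
  have hanti : AntitoneOn ψ (Set.Ici 0) := by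
    refine antitoneOn_of_deriv_nonpos (convex_Ici 0)
      (fun t _ => (hd t).continuousAt.continuousWithinAt)
      (fun t _ => (hd t).differentiableAt.differentiableWithinAt) ?_
    intro t ht
    rw [interior_Ici] at ht
    have ht : (0 : ℝ) < t := ht
    rw [(hd t).deriv, ← inner_sub_left]
    have h1 := real_inner_le_norm (gradient f (x + t • u) - gradient f x) u
    have h2 := hf.2 (x + t • u) x
    rw [add_sub_cancel_left, norm_smul, Real.norm_of_nonneg ht.le] at h2
    nlinarith [mul_le_mul_of_nonneg_right h2 (norm_nonneg u)]
  have := hanti (Set.mem_Ici.2 le_rfl) (Set.mem_Ici.2 zero_le_one) zero_le_one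
  simp only [ψ, one_smul, zero_smul, hu, add_sub_cancel, add_zero] at this
  rw [hu]
  linarith

/-- At the point `x - D/L`, with `D` the gradient difference, the quadratic upper bound from `x`
must lie above the tangent plane at `y`. This test point minimizes the upper bound minus the tangent
plane. -/
theorem IsLSmooth.sq_norm_gradient_sub_le (hL : 0 < L) (hf : IsLSmooth f L)
    (hc : ConvexOn ℝ Set.univ f) (x y : E d) :
    ‖gradient f x - gradient f y‖ ^ 2
      ≤ 2 * L * (f x - f y - inner ℝ (gradient f y) (x - y)) := by
  set D := gradient f x - gradient f y with hD
  have h1 := hf.le_quadratic x (x - L⁻¹ • D)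
  have h2 := inner_gradient_le_sub hf.1 hc y (x - L⁻¹ • D)
  have e1 : x - L⁻¹ • D - x = -(L⁻¹ • D) := by abel
  have e2 : x - L⁻¹ • D - y = (x - y) - L⁻¹ • D := by abel
  rw [e1, inner_neg_right, inner_smul_right, norm_neg, norm_smul,
    Real.norm_of_nonneg (inv_pos.2 hL).le] at h1
  rw [e2, inner_sub_right, inner_smul_right] at h2
  have e3 : inner ℝ (gradient f x) D - inner ℝ (gradient f y) D = ‖D‖ ^ 2 := by
    rw [← inner_sub_left, ← hD, real_inner_self_eq_norm_sq]
  have e4 : L / 2 * (L⁻¹ * ‖D‖) ^ 2 = L⁻¹ / 2 * ‖D‖ ^ 2 := by field_simp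
  rw [e4] at h1
  have h3 : L⁻¹ / 2 * ‖D‖ ^ 2 ≤ f x - f y - inner ℝ (gradient f y) (x - y) := by
    have : L⁻¹ * (inner ℝ (gradient f x) D - inner ℝ (gradient f y) D) = L⁻¹ * ‖D‖ ^ 2 := by
      rw [e3]
    linarith
  have h4 := mul_le_mul_of_nonneg_left h3 (by positivity : 0 ≤ 2 * L)
  have e5 : 2 * L * (L⁻¹ / 2 * ‖D‖ ^ 2) = ‖D‖ ^ 2 := by field_simp
  linarith

theorem IsLSmooth.continuous_gradient (hf : IsLSmooth f L) : Continuous (gradient f) :=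
  (LipschitzWith.of_dist_le_mul (K := L.toNNReal) fun x y => by
    rw [dist_eq_norm, dist_eq_norm]
    exact (hf.2 x y).trans (mul_le_mul_of_nonneg_right (Real.le_coe_toNNReal L)
      (norm_nonneg _))).continuous

end Smooth

/-! ### Arithmetic means. -/

section Avg

variable {n : ℕ}

theorem avg_def_real (v : Fin n → ℝ) : avg v = (n : ℝ)⁻¹ * ∑ i, v i := rfl

theorem avg_le_avg {v w : Fin n → ℝ} (h : ∀ i, v i ≤ w i) : avg v ≤ avg w :=
  mul_le_mul_of_nonneg_left (Finset.sum_le_sum fun i _ => h i) (by positivity)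

theorem avg_nonneg {v : Fin n → ℝ} (h : ∀ i, 0 ≤ v i) : 0 ≤ avg v :=
  mul_nonneg (by positivity) (Finset.sum_nonneg fun i _ => h i)

section Module

variable {V : Type*} [AddCommGroup V] [Module ℝ V]

theorem avg_add (v w : Fin n → V) : avg (fun i => v i + w i) = avg v + avg w := by
  simp [avg, Finset.sum_add_distrib]

theorem avg_sub (v w : Fin n → V) : avg (fun i => v i - w i) = avg v - avg w := by
  simp [avg, Finset.sum_sub_distrib, smul_sub]

theorem avg_smul (c : ℝ) (v : Fin n → V) : avg (fun i => c • v i) = c • avg v := by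
  simp [avg, ← Finset.smul_sum, smul_comm c]

theorem avg_const_mul (c : ℝ) (v : Fin n → ℝ) : avg (fun i => c * v i) = c * avg v :=
  avg_smul c v

theorem avg_const (hn : 0 < n) (c : V) : avg (fun _ : Fin n => c) = c := by
  have : (n : ℝ) ≠ 0 := by positivity
  simp [avg, ← Nat.cast_smul_eq_nsmul ℝ, smul_smul, this]

end Module

theorem inner_avg_left {V : Type*} [NormedAddCommGroup V] [InnerProductSpace ℝ V]
    (v : Fin n → V) (u : V) : inner ℝ (avg v) u = avg (fun i => inner ℝ (v i) u) := by
  simp [avg, inner_smul_left, sum_inner]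

/-- The variance identity: the mean of `‖v_i - avg v‖²` is the mean of `‖v_i‖²` minus `‖avg v‖²`.
Dropping either nonnegative term gives this bound and the next one. -/
theorem sq_norm_avg_le {V : Type*} [NormedAddCommGroup V] [InnerProductSpace ℝ V]
    (hn : 0 < n) (v : Fin n → V) : ‖avg v‖ ^ 2 ≤ avg (fun i => ‖v i‖ ^ 2) := by
  have h : 0 ≤ avg (fun i => ‖v i - avg v‖ ^ 2) := avg_nonneg fun i => by positivity
  have e : (fun i => ‖v i - avg v‖ ^ 2)
      = fun i => (‖v i‖ ^ 2 - 2 * inner ℝ (v i) (avg v)) + ‖avg v‖ ^ 2 := by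
    funext i; rw [norm_sub_sq_real]
  rw [e, avg_add, avg_sub, avg_const_mul, ← inner_avg_left, avg_const hn,
    real_inner_self_eq_norm_sq] at h
  linarith

theorem avg_sq_norm_sub_avg_le {V : Type*} [NormedAddCommGroup V] [InnerProductSpace ℝ V]
    (hn : 0 < n) (v : Fin n → V) :
    avg (fun i => ‖v i - avg v‖ ^ 2) ≤ avg (fun i => ‖v i‖ ^ 2) := by
  have e : (fun i => ‖v i - avg v‖ ^ 2)
      = fun i => (‖v i‖ ^ 2 - 2 * inner ℝ (v i) (avg v)) + ‖avg v‖ ^ 2 := by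
    funext i; rw [norm_sub_sq_real]
  rw [e, avg_add, avg_sub, avg_const_mul, ← inner_avg_left, avg_const hn,
    real_inner_self_eq_norm_sq]
  nlinarith [sq_nonneg ‖avg v‖]

theorem sq_norm_add_le_two {V : Type*} [NormedAddCommGroup V] [InnerProductSpace ℝ V]
    (u v : V) : ‖u + v‖ ^ 2 ≤ 2 * ‖u‖ ^ 2 + 2 * ‖v‖ ^ 2 := by
  have := parallelogram_law_with_norm ℝ u v
  nlinarith [norm_nonneg (u - v), mul_self_nonneg ‖u - v‖]

end Avg

/-! ### The objective as a mean of smooth convex functions. -/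

section FiniteSum

variable {n d : ℕ} {fi : Fin n → E d → ℝ} {f : E d → ℝ} {xs : E d} {L μ : ℝ}

theorem hasGradientAt_avg (hd : ∀ i, Differentiable ℝ (fi i)) (x : E d) :
    HasGradientAt (fun x => avg (fun i => fi i x)) (avg fun i => gradient (fi i) x) x := by
  rw [hasGradientAt_iff_hasFDerivAt]
  have h := (HasFDerivAt.fun_sum (u := Finset.univ)
    fun i _ => (hd i x).hasGradientAt.hasFDerivAt).const_smul ((n : ℝ)⁻¹)
  refine h.congr_fderiv ?_
  simp [avg]

theorem gradient_avg (hd : ∀ i, Differentiable ℝ (fi i)) (x : E d) :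
    gradient (fun x => avg (fun i => fi i x)) x = avg fun i => gradient (fi i) x :=
  (hasGradientAt_avg hd x).gradient

theorem convexOn_avg (hc : ∀ i, ConvexOn ℝ Set.univ (fi i)) :
    ConvexOn ℝ Set.univ (fun x => avg (fun i => fi i x)) := by
  refine ⟨convex_univ, fun x _ y _ a b ha hb hab => ?_⟩
  have := avg_le_avg fun i => (hc i).2 (Set.mem_univ x) (Set.mem_univ y) ha hb hab
  simp only [smul_eq_mul] at this ⊢
  rwa [avg_add, avg_const_mul, avg_const_mul] at this

theorem IsLSmooth.avg (hn : 0 < n) (hs : ∀ i, IsLSmooth (fi i) L) :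
    IsLSmooth (fun x => avg (fun i => fi i x)) L := by
  have hd := fun i => (hs i).1
  refine ⟨fun x => (hasGradientAt_avg hd x).differentiableAt, fun x y => ?_⟩
  rw [gradient_avg hd, gradient_avg hd, ← avg_sub]
  have hn' : (0 : ℝ) < n := by positivity
  calc ‖ECDiana.avg fun i => gradient (fi i) x - gradient (fi i) y‖
      ≤ (n : ℝ)⁻¹ * ∑ _i : Fin n, L * ‖x - y‖ := by
        rw [ECDiana.avg, norm_smul, Real.norm_of_nonneg (by positivity)]
        exact mul_le_mul_of_nonneg_left
          (norm_sum_le_of_le _ fun i _ => (hs i).2 x y) (by positivity)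
    _ = L * ‖x - y‖ := by simp; field_simp

theorem IsQuasiStronglyConvex.gradient_eq_zero (h : IsQuasiStronglyConvex f xs μ) :
    gradient f xs = 0 := by
  have : IsLocalMin f xs := Filter.Eventually.of_forall h.1
  rw [gradient, this.fderiv_eq_zero, map_zero]

theorem sq_norm_gradient_le (hL : 0 < L) (hs : IsLSmooth f L) (hc : ConvexOn ℝ Set.univ f)
    (hq : IsQuasiStronglyConvex f xs μ) (x : E d) :
    ‖gradient f x‖ ^ 2 ≤ 2 * L * (f x - f xs) := by
  simpa [hq.gradient_eq_zero] using hs.sq_norm_gradient_sub_le hL hc x xs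

/-- The gap is at most `L‖x - x*‖²`. -/
theorem gap_le (hL : 0 < L) (hs : IsLSmooth f L)
    (hq : IsQuasiStronglyConvex f xs μ) (x : E d) : f x - f xs ≤ L * ‖x - xs‖ ^ 2 := by
  have h1 := hs.le_quadratic xs x
  rw [hq.gradient_eq_zero, inner_zero_left] at h1
  nlinarith [sq_nonneg ‖x - xs‖]

/-- The quasi strong convexity constant is at most the smoothness constant, unless `d = 0`. -/
theorem mul_sq_norm_le (hL : 0 < L) (hs : IsLSmooth f L)
    (hc : ConvexOn ℝ Set.univ f) (hq : IsQuasiStronglyConvex f xs μ) (v : E d) :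
    μ * ‖v‖ ^ 2 ≤ L * ‖v‖ ^ 2 := by
  have h1 := hq.2 (xs + v)
  have h2 := sq_norm_gradient_le hL hs hc hq (xs + v)
  have e1 : xs - (xs + v) = -v := by abel
  rw [e1, inner_neg_right, add_sub_cancel_left] at h1
  have h3 := real_inner_le_norm (gradient f (xs + v)) v
  set G := ‖gradient f (xs + v)‖
  -- Quasi strong convexity bounds the gap plus `μ/2‖v‖²` by `G‖v‖`, while the gap is at least
  -- `G²/(2L)`; completing the square in `G` then finishes.
  have h4 : L * μ * ‖v‖ ^ 2 ≤ 2 * L * (G * ‖v‖) - G ^ 2 := by nlinarith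
  have h5 : L * (μ * ‖v‖ ^ 2) ≤ L * (L * ‖v‖ ^ 2) := by nlinarith [sq_nonneg (G - L * ‖v‖)]
  exact le_of_mul_le_mul_left h5 hL

theorem le_smoothness [Nonempty (Fin d)] (hL : 0 < L) (hs : IsLSmooth f L)
    (hc : ConvexOn ℝ Set.univ f) (hq : IsQuasiStronglyConvex f xs μ) : μ ≤ L := by
  have := mul_sq_norm_le hL hs hc hq (EuclideanSpace.single (Classical.arbitrary (Fin d)) 1)
  simpa using this

/-- The inner products with `∇f_i(x^*)` cancel on averaging because their mean `∇f(x^*)` vanishes.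
-/
theorem avg_sq_norm_gradient_sub_le (hL : 0 < L) (hf : f = fun x => avg (fun i => fi i x))
    (hs : ∀ i, IsLSmooth (fi i) L) (hc : ∀ i, ConvexOn ℝ Set.univ (fi i))
    (hq : IsQuasiStronglyConvex f xs μ) (x : E d) :
    avg (fun i => ‖gradient (fi i) x - gradient (fi i) xs‖ ^ 2) ≤ 2 * L * (f x - f xs) := by
  have h := avg_le_avg fun i => (hs i).sq_norm_gradient_sub_le hL (hc i) x xs
  refine h.trans (le_of_eq ?_)
  have h0 := hq.gradient_eq_zero
  rw [hf, gradient_avg fun i => (hs i).1] at h0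
  rw [avg_const_mul, avg_sub, avg_sub, ← inner_avg_left, h0, inner_zero_left, sub_zero, hf]

/-- The mean of `‖∇f_i(x) - h_i + h‖²`, where `h` is the mean of the shifts `h_i`. -/
theorem avg_sq_norm_shifted_gradient_le (hn : 0 < n) (hL : 0 < L)
    (hf : f = fun x => avg (fun i => fi i x))
    (hs : ∀ i, IsLSmooth (fi i) L) (hc : ∀ i, ConvexOn ℝ Set.univ (fi i))
    (hq : IsQuasiStronglyConvex f xs μ) (x : E d) (h : Fin n → E d) :
    avg (fun i => ‖gradient (fi i) x - h i + avg h‖ ^ 2)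
      ≤ 4 * L * (f x - f xs) + 2 * avg (fun i => ‖h i - gradient (fi i) xs‖ ^ 2) := by
  have h0 := hq.gradient_eq_zero
  rw [hf, gradient_avg fun i => (hs i).1] at h0
  -- As `∇f(x^*) = 0`, adding `avg h` centres the deviations `h_i - ∇f_i(x^*)`, and centring does
  -- not increase the mean square.
  have hm : avg (fun i => h i - gradient (fi i) xs) = avg h := by rw [avg_sub, h0, sub_zero]
  have key : avg (fun i => ‖gradient (fi i) x - h i + avg h‖ ^ 2)
      ≤ avg (fun i => 2 * ‖gradient (fi i) x - gradient (fi i) xs‖ ^ 2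
        + 2 * ‖(h i - gradient (fi i) xs) - avg (fun i => h i - gradient (fi i) xs)‖ ^ 2) := by
    refine avg_le_avg fun i => ?_
    rw [hm]
    have e : gradient (fi i) x - h i + avg h = (gradient (fi i) x - gradient (fi i) xs)
        + -((h i - gradient (fi i) xs) - avg h) := by abel
    rw [e]
    refine (sq_norm_add_le_two _ _).trans (le_of_eq ?_)
    rw [norm_neg]
  rw [avg_add, avg_const_mul, avg_const_mul] at key
  have h1 := avg_sq_norm_gradient_sub_le hL hf hs hc hq x
  have h2 := avg_sq_norm_sub_avg_le hn fun i => h i - gradient (fi i) xs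
  linarith

end FiniteSum

/-! ### Geometric weights and weighted unrolling of recursions. -/

section Weights

variable {η : ℝ}

theorem weight_pos (hη : η < 1) (k : ℕ) : 0 < weight η k :=
  inv_pos.2 (pow_pos (by linarith) _)

theorem weight_zero_mul (hη : η < 1) : weight η 0 * (1 - η) = 1 := by
  have : 1 - η ≠ 0 := by linarith
  simp [weight, this]

theorem weight_succ_mul (hη : η < 1) (k : ℕ) : weight η (k + 1) * (1 - η) = weight η k := by
  have : 1 - η ≠ 0 := by linarith
  rw [weight, weight, pow_succ _ (k + 1)]
  field_simp

theorem weightSum_pos (hη : η < 1) (K : ℕ) : 0 < weightSum η K :=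
  Finset.sum_pos (fun k _ => weight_pos hη k) (by simp)

/-- Unrolling `s_{k+1} ≤ q s_k + b_k + (1 - q) c` under geometric weights. The constant term is
split off, since it does not suffer from the weights. -/
theorem exists_majorant {q c : ℝ} (hη : η < 1) (hq : 0 ≤ q) (hc : 0 ≤ c) {s b : ℕ → ℝ}
    (hb : ∀ k, 0 ≤ b k) (hs : 0 ≤ s 0) (hrec : ∀ k, s (k + 1) ≤ q * s k + b k + (1 - q) * c) :
    ∃ a : ℕ → ℝ, (∀ k, 0 ≤ a k) ∧ (∀ k, s k ≤ a k + c) ∧ ∀ K,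
      (1 - η - q) * ∑ k ∈ Finset.range (K + 1), weight η k * a k
        ≤ s 0 + ∑ k ∈ Finset.range (K + 1), weight η k * b k := by
  -- The majorant solves the recursion with equality and without its constant; `c` is restored at
  -- the end, being the fixed point of `t ↦ q t + (1 - q) c`.
  let a : ℕ → ℝ := fun k => Nat.rec (s 0) (fun k r => q * r + b k) k
  have a0 : a 0 = s 0 := rfl
  have asucc : ∀ k, a (k + 1) = q * a k + b k := fun k => rfl
  have hnonneg : ∀ k, 0 ≤ a k := by
    intro k
    induction k with
    | zero => exact hs
    | succ k ih => rw [asucc]; nlinarith [hb k, mul_nonneg hq ih]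
  refine ⟨a, hnonneg, ?_, ?_⟩
  · intro k
    induction k with
    | zero => rw [a0]; linarith
    | succ k ih => rw [asucc]; nlinarith [hrec k, mul_le_mul_of_nonneg_left ih hq]
  · intro K
    -- An exact identity: the extra term is `w_K a_{K+1}`, which is nonnegative and is dropped
    -- afterwards.
    have key : (1 - η - q) * ∑ k ∈ Finset.range (K + 1), weight η k * a k
        + weight η K * (q * a K + b K)
        = s 0 + ∑ k ∈ Finset.range (K + 1), weight η k * b k := by
      induction K with
      | zero =>
        have := weight_zero_mul hη
        simp only [zero_add, Finset.sum_range_one, a0]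
        linear_combination s 0 * this
      | succ K ih =>
        rw [Finset.sum_range_succ, Finset.sum_range_succ _ (K + 1)]
        have := weight_succ_mul hη K
        rw [← asucc] at ih
        linear_combination ih + a (K + 1) * this
    have := mul_nonneg (weight_pos hη K).le
      (add_nonneg (mul_nonneg hq (hnonneg K)) (hb K))
    linarith

end Weights

/-! ### Integrating out an independent seed. -/

section Freezing

variable {Ω Z S : Type*} {m m0 : MeasurableSpace Ω} [MeasurableSpace Z] [MeasurableSpace S]
  {P : Measure Ω} [IsProbabilityMeasure P] {ν : Measure S} [IsProbabilityMeasure ν]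

/-- Freezing: a variable `ζ` independent of `m` may be integrated out in front of an
`m`-measurable variable. -/
theorem setLIntegral_freeze (hm : m ≤ m0) {Y : Ω → Z} (hY : Measurable[m] Y) {ζ : Ω → S}
    (hζ : Measurable ζ) (hlaw : P.map ζ = ν)
    (hind : Indep (MeasurableSpace.comap ζ inferInstance) m P)
    {φ : Z × S → ℝ≥0∞} (hφ : Measurable φ) {s : Set Ω} (hs : MeasurableSet[m] s) :
    ∫⁻ w in s, φ (Y w, ζ w) ∂P = ∫⁻ w in s, ∫⁻ z, φ (Y w, z) ∂ν ∂P := by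
  -- The indicator of `s` is carried as an extra `m`-measurable coordinate, so that independence of
  -- `U` and `ζ` handles the integral over `s` by a single product law.
  let U : Ω → ℝ≥0∞ × Z := fun w => (s.indicator (fun _ => 1) w, Y w)
  have hU : Measurable[m] U :=
    Measurable.prodMk (measurable_const.indicator hs) hY
  have hU0 : Measurable U := hU.mono hm le_rfl
  have hI : IndepFun U ζ P := by
    refine (indep_of_indep_of_le_right hind ?_).symm
    exact hU.comap_le
  let ψ : (ℝ≥0∞ × Z) × S → ℝ≥0∞ := fun p => p.1.1 * φ (p.1.2, p.2)
  have hψ : Measurable ψ := by fun_prop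
  have h1 : ∫⁻ w, ψ (U w, ζ w) ∂P = ∫⁻ w, ∫⁻ z, ψ (U w, z) ∂ν ∂P := by
    have := hI.map_prod_eq_prod_map_map hU0.aemeasurable hζ.aemeasurable
    rw [← lintegral_map hψ (hU0.prodMk hζ), this, hlaw, lintegral_prod _ hψ.aemeasurable,
      lintegral_map (Measurable.lintegral_prod_right' hψ) hU0]
  rw [← lintegral_indicator (hm s hs), ← lintegral_indicator (hm s hs)]
  have e1 : ∀ w, s.indicator (fun w => φ (Y w, ζ w)) w = ψ (U w, ζ w) := by
    intro w; by_cases hw : w ∈ s <;> simp [ψ, U, hw]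
  have e2 : ∀ w, s.indicator (fun w => ∫⁻ z, φ (Y w, z) ∂ν) w = ∫⁻ z, ψ (U w, z) ∂ν := by
    intro w; by_cases hw : w ∈ s <;> simp [ψ, U, hw]
  simp_rw [e1, e2, h1]

theorem setLIntegral_freeze_le (hm : m ≤ m0) {Y : Ω → Z} (hY : Measurable[m] Y) {ζ : Ω → S}
    (hζ : Measurable ζ) (hlaw : P.map ζ = ν)
    (hind : Indep (MeasurableSpace.comap ζ inferInstance) m P)
    {φ : Z × S → ℝ≥0∞} (hφ : Measurable φ) {b : Z → ℝ≥0∞} (hb : ∀ y, ∫⁻ z, φ (y, z) ∂ν ≤ b y)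
    {s : Set Ω} (hs : MeasurableSet[m] s) :
    ∫⁻ w in s, φ (Y w, ζ w) ∂P ≤ ∫⁻ w in s, b (Y w) ∂P := by
  rw [setLIntegral_freeze hm hY hζ hlaw hind hφ hs]
  exact lintegral_mono fun w => hb _

/-- A real-valued form of freezing: integrability and a bound on the conditional expectation. -/
theorem integrable_and_condExp_le_of_freeze (hm : m ≤ m0) {Y : Ω → Z} (hY : Measurable[m] Y)
    {ζ : Ω → S} (hζ : Measurable ζ) (hlaw : P.map ζ = ν)
    (hind : Indep (MeasurableSpace.comap ζ inferInstance) m P)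
    {φ : Z × S → ℝ} (hφ : Measurable φ) (hφ0 : ∀ p, 0 ≤ φ p) {b : Z → ℝ}
    (hφi : ∀ y, Integrable (fun z => φ (y, z)) ν) (hb : ∀ y, ∫ z, φ (y, z) ∂ν ≤ b y)
    (hbi : Integrable (fun w => b (Y w)) P) :
    Integrable (fun w => φ (Y w, ζ w)) P ∧
      ∀ m' : MeasurableSpace Ω, m' ≤ m →
        P[fun w => φ (Y w, ζ w) | m'] ≤ᵐ[P] P[fun w => b (Y w) | m'] := by
  have hb0 : ∀ y, 0 ≤ b y := fun y => (integral_nonneg fun z => hφ0 _).trans (hb y)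
  have key : ∀ s, MeasurableSet[m] s → ∫⁻ w in s, ENNReal.ofReal (φ (Y w, ζ w)) ∂P
      ≤ ∫⁻ w in s, ENNReal.ofReal (b (Y w)) ∂P := fun s hs =>
    setLIntegral_freeze_le (φ := fun p => ENNReal.ofReal (φ p))
      (b := fun y => ENNReal.ofReal (b y)) hm hY hζ hlaw hind hφ.ennreal_ofReal
      (fun y => by
        rw [← ofReal_integral_eq_lintegral_ofReal (hφi y) (ae_of_all _ fun z => hφ0 _)]
        exact ENNReal.ofReal_le_ofReal (hb y)) hs
  have hmeas : Measurable fun w => φ (Y w, ζ w) :=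
    hφ.comp ((hY.mono hm le_rfl).prodMk hζ)
  -- Nonnegative Lebesgue integrals are compared first, so integrability is a conclusion drawn from
  -- that of the bound.
  have hint : Integrable (fun w => φ (Y w, ζ w)) P := by
    refine ⟨hmeas.aestronglyMeasurable, ?_⟩
    rw [hasFiniteIntegral_iff_ofReal (ae_of_all _ fun w => hφ0 _)]
    have h1 := key Set.univ MeasurableSet.univ
    simp only [Measure.restrict_univ] at h1
    exact h1.trans_lt ((hasFiniteIntegral_iff_ofReal (ae_of_all _ fun w => hb0 _)).1 hbi.2)
  refine ⟨hint, fun m' hm' => ?_⟩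
  have hm'0 := hm'.trans hm
  have hle : ∀ s, MeasurableSet[m'] s →
      ∫ w in s, φ (Y w, ζ w) ∂P ≤ ∫ w in s, b (Y w) ∂P := by
    intro s hs
    rw [integral_eq_lintegral_of_nonneg_ae (ae_of_all _ fun w => hφ0 _)
        hmeas.aestronglyMeasurable,
      integral_eq_lintegral_of_nonneg_ae (ae_of_all _ fun w => hb0 _) hbi.1.restrict]
    refine ENNReal.toReal_mono ?_ (key s (hm' s hs))
    exact ((hasFiniteIntegral_iff_ofReal (ae_of_all _ fun w => hb0 _)).1
      hbi.integrableOn.2).ne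
  -- Both conditional expectations are `m'`-measurable, so on the trimmed measure it suffices to
  -- compare their integrals over `m'`-measurable sets.
  refine ae_le_of_ae_le_trim (hm := hm'0) ?_
  refine ae_le_of_forall_setIntegral_le (integrable_condExp.trim hm'0 stronglyMeasurable_condExp)
    (integrable_condExp.trim hm'0 stronglyMeasurable_condExp) fun s hs _ => ?_
  rw [restrict_trim hm'0 _ hs, ← integral_trim hm'0 stronglyMeasurable_condExp,
    ← integral_trim hm'0 stronglyMeasurable_condExp, setIntegral_condExp hm'0 hint hs,
    setIntegral_condExp hm'0 hbi hs]
  exact hle s hs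

end Freezing

/-! ### Square integrable vectors and conditional expectation. -/

section L2

variable {Ω V : Type*} {m0 : MeasurableSpace Ω} {P : Measure Ω} [NormedAddCommGroup V]

theorem integrable_sq_norm {u : Ω → V} (hu : MemLp u 2 P) :
    Integrable (fun w => ‖u w‖ ^ 2) P :=
  hu.integrable_norm_pow two_ne_zero

theorem integrable_inner [InnerProductSpace ℝ V] {u v : Ω → V} (hu : MemLp u 2 P) (hv : MemLp v 2 P) :
    Integrable (fun w => inner ℝ (u w) (v w)) P := by
  have h1 := hu.integrable_norm_pow two_ne_zero
  have h2 := hv.integrable_norm_pow two_ne_zero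
  refine (h1.add h2).mono' (hu.1.inner hv.1) (ae_of_all _ fun w => ?_)
  have := abs_real_inner_le_norm (u w) (v w)
  simp only [Real.norm_eq_abs, Pi.add_apply]
  nlinarith [sq_nonneg (‖u w‖ - ‖v w‖), sq_nonneg ‖u w‖, sq_nonneg ‖v w‖]

end L2

section CondExp

variable {Ω V : Type*} {m m0 : MeasurableSpace Ω} {P : Measure Ω}
  [NormedAddCommGroup V] [InnerProductSpace ℝ V] [CompleteSpace V]

theorem condExp_inner_left [IsFiniteMeasure P] {u v : Ω → V}
    (hum : StronglyMeasurable[m] u) (hu : MemLp u 2 P) (hv : MemLp v 2 P) :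
    P[fun w => inner ℝ (u w) (v w) | m] =ᵐ[P] fun w => inner ℝ (u w) (P[v | m] w) :=
  condExp_bilin_of_stronglyMeasurable_left (innerSL ℝ) hum (integrable_inner hu hv)
    (hv.integrable one_le_two)

/-- Finite measures, and not only probabilities, are allowed because this is later applied to `P`
restricted to an event. -/
theorem integral_inner_eq_zero [IsFiniteMeasure P] (hm : m ≤ m0) {u v : Ω → V}
    (hum : StronglyMeasurable[m] u) (hu : MemLp u 2 P) (hv : MemLp v 2 P)
    (h0 : P[v | m] =ᵐ[P] 0) : ∫ w, inner ℝ (u w) (v w) ∂P = 0 := by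
  rw [← integral_condExp hm, integral_congr_ae (condExp_inner_left hum hu hv)]
  refine integral_eq_zero_of_ae ?_
  filter_upwards [h0] with w hw
  simp [hw]

/-- The conditional expectation of a quadratic polynomial in a conditionally centred vector. -/
theorem condExp_quadratic [IsFiniteMeasure P] (hm : m ≤ m0) {B : Ω → ℝ} {c v : Ω → V} {κ : ℝ}
    (hBm : StronglyMeasurable[m] B) (hB : Integrable B P)
    (hcm : StronglyMeasurable[m] c) (hc : MemLp c 2 P) (hv : MemLp v 2 P)
    (h0 : P[v | m] =ᵐ[P] 0) :
    P[fun w => B w + 2 * inner ℝ (c w) (v w) + κ * ‖v w‖ ^ 2 | m]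
      =ᵐ[P] fun w => B w + κ * P[fun w => ‖v w‖ ^ 2 | m] w := by
  have i2 := (integrable_inner hc hv).smul (2 : ℝ)
  have i3 := (integrable_sq_norm hv).smul κ
  have e : (fun w => B w + 2 * inner ℝ (c w) (v w) + κ * ‖v w‖ ^ 2)
      = (B + (2 : ℝ) • fun w => inner ℝ (c w) (v w)) + κ • fun w => ‖v w‖ ^ 2 := rfl
  rw [e]
  have c1 : P[B | m] = B := condExp_of_stronglyMeasurable hm hBm hB
  filter_upwards [condExp_add (hB.add i2) i3 m, condExp_add hB i2 m,
    condExp_smul (2 : ℝ) (fun w => inner ℝ (c w) (v w)) m (μ := P),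
    condExp_smul κ (fun w => ‖v w‖ ^ 2) m (μ := P),
    condExp_inner_left hcm hc hv, h0] with w h1 h2 h3 h3' h4 h5
  rw [h1, Pi.add_apply, h2, Pi.add_apply, h3, h3', Pi.smul_apply, Pi.smul_apply, h4, h5, c1]
  simp

/-- Conditional bias-variance decomposition. -/
theorem condExp_sq_norm_add [IsFiniteMeasure P] (hm : m ≤ m0) {u v : Ω → V}
    (hum : StronglyMeasurable[m] u) (hu : MemLp u 2 P) (hv : MemLp v 2 P)
    (h0 : P[v | m] =ᵐ[P] 0) :
    P[fun w => ‖u w + v w‖ ^ 2 | m]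
      =ᵐ[P] fun w => ‖u w‖ ^ 2 + P[fun w => ‖v w‖ ^ 2 | m] w := by
  have e : (fun w => ‖u w + v w‖ ^ 2)
      = fun w => ‖u w‖ ^ 2 + 2 * inner ℝ (u w) (v w) + 1 * ‖v w‖ ^ 2 := by
    funext w
    rw [norm_add_sq_real, one_mul]
  rw [e]
  filter_upwards [condExp_quadratic (B := fun w => ‖u w‖ ^ 2) (κ := 1) hm (hum.norm.pow 2)
    (integrable_sq_norm hu) hum hu hv h0] with w hw
  rw [hw, one_mul]

theorem integral_sq_norm_add [IsFiniteMeasure P] (hm : m ≤ m0) {u v : Ω → V}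
    (hum : StronglyMeasurable[m] u) (hu : MemLp u 2 P) (hv : MemLp v 2 P)
    (h0 : P[v | m] =ᵐ[P] 0) :
    ∫ w, ‖u w + v w‖ ^ 2 ∂P = ∫ w, ‖u w‖ ^ 2 ∂P + ∫ w, ‖v w‖ ^ 2 ∂P := by
  rw [← integral_condExp hm, integral_congr_ae (condExp_sq_norm_add hm hum hu hv h0),
    integral_add (integrable_sq_norm hu) integrable_condExp, integral_condExp hm]

theorem integral_le_of_condExp_le [IsProbabilityMeasure P] (hm : m ≤ m0) {u b : Ω → ℝ}
    (hb : Integrable b P) (h : P[u | m] ≤ᵐ[P] b) : ∫ w, u w ∂P ≤ ∫ w, b w ∂P := by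
  rw [← integral_condExp hm]
  exact integral_mono_ae integrable_condExp hb h

end CondExp

/-! ### From conditional independence to conditional uncorrelatedness. -/

section CondIndep

variable {n d : ℕ} {Ω : Type*} {m m0 : MeasurableSpace Ω} {P : Measure Ω}
  [IsProbabilityMeasure P] {X : Fin n → Ω → E d}

theorem CondIndependent.condExp_inter (h : CondIndependent P m X) (hm : m ≤ m0)
    {i j : Fin n} (hij : i ≠ j)
    {A B : Set (E d)} (hA : MeasurableSet A) (hB : MeasurableSet B) :
    P[(X i ⁻¹' A ∩ X j ⁻¹' B).indicator (fun _ => (1 : ℝ)) | m] =ᵐ[P] fun w =>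
      P[(X i ⁻¹' A).indicator (fun _ => (1 : ℝ)) | m] w *
        P[(X j ⁻¹' B).indicator (fun _ => (1 : ℝ)) | m] w := by
  classical
  -- The whole space for the other indices contributes factors `1` to the product.
  let T : Fin n → Set (E d) := fun l => if l = i then A else if l = j then B else Set.univ
  have hTi : T i = A := by simp [T]
  have hTj : T j = B := by simp [T, hij.symm]
  have hTo : ∀ l, l ≠ i → l ≠ j → T l = Set.univ := by intro l h1 h2; simp [T, h1, h2]
  have hT : ∀ l, MeasurableSet (T l) := by
    intro l
    by_cases h1 : l = i
    · rw [h1, hTi]; exact hA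
    by_cases h2 : l = j
    · rw [h2, hTj]; exact hB
    rw [hTo l h1 h2]; exact MeasurableSet.univ
  have hinter : (⋂ l, X l ⁻¹' T l) = X i ⁻¹' A ∩ X j ⁻¹' B := by
    ext w
    simp only [Set.mem_iInter, Set.mem_inter_iff, Set.mem_preimage]
    constructor
    · intro hw; exact ⟨hTi ▸ hw i, hTj ▸ hw j⟩
    · rintro ⟨h1, h2⟩ l
      by_cases hl : l = i
      · rw [hl, hTi]; exact h1
      by_cases hl2 : l = j
      · rw [hl2, hTj]; exact h2
      rw [hTo l hl hl2]; trivial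
  have key := h T hT
  rw [hinter] at key
  filter_upwards [key] with w hw
  rw [hw, ← Finset.mul_prod_erase _ _ (Finset.mem_univ i),
    ← Finset.mul_prod_erase _ _ (Finset.mem_erase.2 ⟨hij.symm, Finset.mem_univ j⟩), hTi, hTj]
  rw [Finset.prod_eq_one, mul_one]
  intro l hl
  simp only [Finset.mem_erase, Finset.mem_univ, and_true] at hl
  rw [hTo l hl.2 hl.1, Set.preimage_univ, Set.indicator_univ, condExp_const hm]

end CondIndep

section CondIndepPair

variable {n d : ℕ} {Ω : Type*} {m m0 : MeasurableSpace Ω} {P : Measure Ω}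
  [IsProbabilityMeasure P] {X : Fin n → Ω → E d}

theorem integrable_indicator_one {s : Set Ω} (hs : MeasurableSet s) :
    Integrable (s.indicator fun _ => (1 : ℝ)) P :=
  (integrable_const 1).indicator hs

theorem condExp_indicator_mem_Icc (s : Set Ω) (hs : MeasurableSet s) (hm : m ≤ m0) :
    ∀ᵐ w ∂P, P[s.indicator fun _ => (1 : ℝ) | m] w ∈ Set.Icc (0 : ℝ) 1 := by
  have h0 : 0 ≤ᵐ[P] P[s.indicator fun _ => (1 : ℝ) | m] :=
    condExp_nonneg (ae_of_all _ fun w => Set.indicator_nonneg (fun _ _ => zero_le_one) w)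
  have h1 : P[s.indicator fun _ => (1 : ℝ) | m] ≤ᵐ[P] P[fun _ => (1 : ℝ) | m] :=
    condExp_mono (integrable_indicator_one hs) (integrable_const 1)
      (ae_of_all _ fun w => Set.indicator_le_self' (fun _ _ => zero_le_one) w)
  rw [condExp_const hm] at h1
  filter_upwards [h0, h1] with w a b using ⟨a, b⟩

/-- On `H`, the event `X_i ∈ A` can be replaced by its conditional probability when only `X_j` is
observed: on a set `B` both sides equal the integral over `H` of the product of the two conditional
probabilities. This passes from events to integrals of `X_j` without regular conditional laws. -/
theorem CondIndependent.map_restrict_eq (h : CondIndependent P m X) (hm : m ≤ m0)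
    (hX : ∀ i, Measurable (X i)) {i j : Fin n} (hij : i ≠ j) {A : Set (E d)}
    (hA : MeasurableSet A) {H : Set Ω} (hH : MeasurableSet[m] H) :
    (P.restrict (H ∩ X i ⁻¹' A)).map (X j) = ((P.restrict H).withDensity fun w =>
      ENNReal.ofReal (P[(X i ⁻¹' A).indicator (fun _ => (1 : ℝ)) | m] w)).map (X j) := by
  set p := P[(X i ⁻¹' A).indicator (fun _ => (1 : ℝ)) | m] with hp
  have hp01 : ∀ᵐ w ∂P, p w ∈ Set.Icc (0 : ℝ) 1 := condExp_indicator_mem_Icc _ (hX i hA) hm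
  ext B hB
  have hBj := hX j hB
  rw [Measure.map_apply (hX j) hB, Measure.map_apply (hX j) hB, Measure.restrict_apply hBj,
    withDensity_apply _ hBj, Measure.restrict_restrict hBj]
  have hint : Integrable p P := integrable_condExp
  rw [← ofReal_integral_eq_lintegral_ofReal hint.integrableOn
    (ae_restrict_of_ae (hp01.mono fun w hw => hw.1))]
  have hset : X j ⁻¹' B ∩ (H ∩ X i ⁻¹' A) = H ∩ (X i ⁻¹' A ∩ X j ⁻¹' B) := by
    ext w; simp only [Set.mem_inter_iff]; tauto
  have hAB : MeasurableSet (X i ⁻¹' A ∩ X j ⁻¹' B) := (hX i hA).inter hBj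
  have key : ∫ w in X j ⁻¹' B ∩ H, p w ∂P
      = ∫ w in H, (X i ⁻¹' A ∩ X j ⁻¹' B).indicator (fun _ => (1 : ℝ)) w ∂P := by
    rw [← setIntegral_condExp hm (integrable_indicator_one hAB) hH,
      setIntegral_congr_ae (hm H hH) ((h.condExp_inter hm hij hA hB).mono fun w hw _ => hw)]
    have hmul : p * (X j ⁻¹' B).indicator (fun _ => (1 : ℝ)) = (X j ⁻¹' B).indicator p := by
      funext w; by_cases hw : w ∈ X j ⁻¹' B <;> simp [hw]
    have hpull := condExp_mul_of_stronglyMeasurable_left (m := m) (μ := P) (f := p)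
      (g := (X j ⁻¹' B).indicator fun _ => (1 : ℝ)) stronglyMeasurable_condExp
      (hmul ▸ hint.indicator hBj) (integrable_indicator_one hBj)
    refine Eq.trans ?_ (setIntegral_congr_ae (hm H hH) (hpull.mono fun w hw _ => hw))
    rw [setIntegral_condExp hm (hmul ▸ hint.indicator hBj) hH, hmul, setIntegral_indicator hBj,
      Set.inter_comm]
  rw [key, setIntegral_indicator hAB, hset]
  simp [Measure.real]

/-- Given `m`, knowing `X_i` does not change the conditional mean of `X_j`. With `p` the conditional
probability of `X_i ∈ A`, both sides equal the integral over `H` of `p` times the conditional mean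
of `X_j`. -/
theorem CondIndependent.setIntegral_inter_preimage (h : CondIndependent P m X) (hm : m ≤ m0)
    (hX : ∀ i, Measurable (X i)) {i j : Fin n} (hij : i ≠ j) (hXj : Integrable (X j) P)
    {A : Set (E d)} (hA : MeasurableSet A) {H : Set Ω} (hH : MeasurableSet[m] H) :
    ∫ w in H ∩ X i ⁻¹' A, X j w ∂P = ∫ w in H ∩ X i ⁻¹' A, P[X j | m] w ∂P := by
  set p := P[(X i ⁻¹' A).indicator (fun _ => (1 : ℝ)) | m] with hp
  have hp01 : ∀ᵐ w ∂P, p w ∈ Set.Icc (0 : ℝ) 1 := condExp_indicator_mem_Icc _ (hX i hA) hm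
  have hAi := hX i hA
  have hpm : StronglyMeasurable[m] p := stronglyMeasurable_condExp
  have hpX : Integrable (p • X j) P :=
    hXj.bdd_smul 1 (hpm.mono hm).aestronglyMeasurable
      (hp01.mono fun w hw => by rw [Real.norm_of_nonneg hw.1]; exact hw.2)
  have e1 : ∫ w in H ∩ X i ⁻¹' A, X j w ∂P = ∫ w in H, p w • X j w ∂P := by
    have h1 : ∫ w in H ∩ X i ⁻¹' A, X j w ∂P
        = ∫ y, y ∂((P.restrict (H ∩ X i ⁻¹' A)).map (X j)) :=
      (integral_map (hX j).aemeasurable aestronglyMeasurable_id).symm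
    rw [h1, h.map_restrict_eq hm hX hij hA hH, integral_map (f := fun y => y)
      (hX j).aemeasurable aestronglyMeasurable_id, integral_withDensity_eq_integral_toReal_smul
      (hpm.mono hm).measurable.ennreal_ofReal (ae_of_all _ fun w => ENNReal.ofReal_lt_top)]
    refine integral_congr_ae (ae_restrict_of_ae (hp01.mono fun w hw => ?_))
    simp only [ENNReal.toReal_ofReal hw.1]
  have hind : (X i ⁻¹' A).indicator (fun _ => (1 : ℝ)) • P[X j | m]
      = (X i ⁻¹' A).indicator (P[X j | m]) := by
    funext w; by_cases hw : w ∈ X i ⁻¹' A <;> simp [hw]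
  have hindi : Integrable ((X i ⁻¹' A).indicator (fun _ => (1 : ℝ)) • P[X j | m]) P :=
    hind ▸ integrable_condExp.indicator hAi
  have h2 : P[p • X j | m] =ᵐ[P] p • P[X j | m] :=
    condExp_smul_of_aestronglyMeasurable_left hpm.aestronglyMeasurable hpX hXj
  have h3 : P[(X i ⁻¹' A).indicator (fun _ => (1 : ℝ)) • P[X j | m] | m]
      =ᵐ[P] p • P[X j | m] :=
    condExp_smul_of_aestronglyMeasurable_right (integrable_indicator_one hAi) hindi
      stronglyMeasurable_condExp.aestronglyMeasurable
  calc ∫ w in H ∩ X i ⁻¹' A, X j w ∂P = ∫ w in H, (p • X j) w ∂P := e1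
    _ = ∫ w in H, P[p • X j | m] w ∂P := (setIntegral_condExp hm hpX hH).symm
    _ = ∫ w in H, P[(X i ⁻¹' A).indicator (fun _ => (1 : ℝ)) • P[X j | m] | m] w ∂P :=
        setIntegral_congr_ae (hm H hH) ((h2.trans h3.symm).mono fun w hw _ => hw)
    _ = ∫ w in H, (X i ⁻¹' A).indicator (P[X j | m]) w ∂P := by
        rw [setIntegral_condExp hm hindi hH, hind]
    _ = _ := setIntegral_indicator hAi

/-- Conditionally independent square integrable vectors are conditionally uncorrelated. -/
theorem CondIndependent.condExp_inner_sub_eq_zero (h : CondIndependent P m X) (hm : m ≤ m0)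
    (hX : ∀ i, Measurable (X i)) (hX2 : ∀ i, MemLp (X i) 2 P) {i j : Fin n} (hij : i ≠ j)
    {M : Fin n → Ω → E d} (hMm : ∀ i, Measurable[m] (M i)) (hM2 : ∀ i, MemLp (M i) 2 P)
    (hXM : ∀ i, P[X i | m] =ᵐ[P] M i) :
    P[fun w => inner ℝ (X i w - M i w) (X j w - M j w) | m] =ᵐ[P] 0 := by
  have hε : ∀ i, MemLp (fun w => X i w - M i w) 2 P := fun i => (hX2 i).sub (hM2 i)
  have hint := integrable_inner (hε i) (hε j)
  symm
  refine ae_eq_condExp_of_forall_setIntegral_eq hm hint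
    (fun s _ _ => (integrable_zero Ω ℝ P).integrableOn) (fun H hH _ => ?_)
    stronglyMeasurable_zero.aestronglyMeasurable
  have hε0 : P[fun w => X j w - M j w | m] =ᵐ[P] 0 := by
    have h1 := condExp_sub ((hX2 j).integrable one_le_two) ((hM2 j).integrable one_le_two) m
    have h2 : P[M j | m] = M j :=
      condExp_of_stronglyMeasurable hm (hMm j).stronglyMeasurable ((hM2 j).integrable one_le_two)
    filter_upwards [h1, hXM j] with w a b
    have : P[fun w => X j w - M j w | m] w = P[X j - M j | m] w := rfl
    rw [this, a, Pi.sub_apply, b, h2, sub_self, Pi.zero_apply]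
  -- the part with `M i` is handled by conditioning on `m`
  have hMpart : ∫ w in H, inner ℝ (M i w) (X j w - M j w) ∂P = 0 := by
    rw [← setIntegral_condExp hm (integrable_inner (hM2 i) (hε j)) hH]
    refine integral_eq_zero_of_ae (ae_restrict_of_ae ?_)
    filter_upwards [condExp_inner_left (hMm i).stronglyMeasurable (hM2 i) (hε j), hε0] with w a b
    rw [a, b]; simp
  -- the part with `X i` is handled by conditioning on `X i`, under the measure restricted to `H`
  have hXpart : ∫ w in H, inner ℝ (X i w) (X j w - M j w) ∂P = 0 := by
    have hXi : MeasurableSpace.comap (X i) inferInstance ≤ m0 := (hX i).comap_le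
    refine integral_inner_eq_zero hXi (comap_measurable (X i)).stronglyMeasurable
      ((hX2 i).restrict H) ((hε j).restrict H) ?_
    symm
    refine ae_eq_condExp_of_forall_setIntegral_eq hXi ((hε j).restrict H |>.integrable one_le_two)
      (fun s _ _ => (integrable_zero Ω (E d) _).integrableOn) ?_
      stronglyMeasurable_zero.aestronglyMeasurable
    rintro _ ⟨A, hA, rfl⟩ _
    have hAi := hX i hA
    rw [Measure.restrict_restrict hAi, Set.inter_comm,
      integral_sub ((hX2 j).integrable one_le_two).integrableOn
        ((hM2 j).integrable one_le_two).integrableOn,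
      h.setIntegral_inter_preimage hm hX hij ((hX2 j).integrable one_le_two) hA hH,
      setIntegral_congr_ae ((hm H hH).inter hAi) ((hXM j).mono fun w hw _ => hw)]
    simp
  have e : (fun w => inner ℝ (X i w - M i w) (X j w - M j w)) = fun w =>
      inner ℝ (X i w) (X j w - M j w) - inner ℝ (M i w) (X j w - M j w) := by
    funext w; rw [inner_sub_left]
  rw [e, integral_sub (integrable_inner (hX2 i) (hε j)).integrableOn
    (integrable_inner (hM2 i) (hε j)).integrableOn, hMpart, hXpart]
  simp

end CondIndepPair

/-! ### Means of random vectors. -/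

section AvgMeasure

variable {n d : ℕ} {Ω : Type*} {m0 : MeasurableSpace Ω} {P : Measure Ω}

theorem measurable_avg {v : Fin n → Ω → E d} (h : ∀ i, Measurable (v i)) :
    Measurable fun w => avg (fun i => v i w) := by
  unfold avg
  fun_prop

theorem measurable_avg_real {v : Fin n → Ω → ℝ} (h : ∀ i, Measurable (v i)) :
    Measurable fun w => avg (fun i => v i w) := by
  unfold avg
  fun_prop

theorem memLp_avg {v : Fin n → Ω → E d} (h : ∀ i, MemLp (v i) 2 P) :
    MemLp (fun w => avg (fun i => v i w)) 2 P :=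
  (memLp_finsetSum Finset.univ fun i _ => h i).const_smul ((n : ℝ)⁻¹)

theorem integrable_avg {v : Fin n → Ω → ℝ} (h : ∀ i, Integrable (v i) P) :
    Integrable (fun w => avg (fun i => v i w)) P :=
  (integrable_finsetSum Finset.univ fun i _ => h i).const_mul ((n : ℝ)⁻¹)

theorem integral_avg {v : Fin n → Ω → ℝ} (h : ∀ i, Integrable (v i) P) :
    ∫ w, avg (fun i => v i w) ∂P = avg fun i => ∫ w, v i w ∂P := by
  simp only [avg, integral_smul]
  rw [integral_finsetSum _ fun i _ => h i]

theorem condExp_avg {m : MeasurableSpace Ω} {v : Fin n → Ω → ℝ} (h : ∀ i, Integrable (v i) P) :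
    P[fun w => avg (fun i => v i w) | m] =ᵐ[P] fun w => avg fun i => P[v i | m] w := by
  have e : (fun w => avg (fun i => v i w)) = (n : ℝ)⁻¹ • ∑ i, v i := by
    funext w; simp [avg]
  rw [e]
  filter_upwards [condExp_smul ((n : ℝ)⁻¹) (∑ i, v i) m (μ := P),
    condExp_finsetSum (s := Finset.univ) (fun i _ => h i) m] with w h1 h2
  rw [h1, Pi.smul_apply, h2]
  simp [avg]

/-- The conditional second moment of a mean of conditionally uncorrelated vectors. -/
theorem condExp_sq_norm_avg_le {m : MeasurableSpace Ω} {v : Fin n → Ω → E d} {D : Fin n → ℝ}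
    (h : ∀ i, MemLp (v i) 2 P)
    (hD : ∀ i, P[fun w => ‖v i w‖ ^ 2 | m] ≤ᵐ[P] fun _ => D i)
    (h0 : ∀ i j, i ≠ j → P[fun w => inner ℝ (v i w) (v j w) | m] =ᵐ[P] 0) :
    P[fun w => ‖avg (fun i => v i w)‖ ^ 2 | m] ≤ᵐ[P] fun _ => avg D / n := by
  have e : (fun w => ‖avg (fun i => v i w)‖ ^ 2)
      = fun w => avg fun i => avg fun j => inner ℝ (v i w) (v j w) := by
    funext w
    rw [← real_inner_self_eq_norm_sq, inner_avg_left]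
    congr 1; funext i
    rw [real_inner_comm, inner_avg_left]
    congr 1; funext j
    rw [real_inner_comm]
  have hi : ∀ i j, Integrable (fun w => inner ℝ (v i w) (v j w)) P :=
    fun i j => integrable_inner (h i) (h j)
  rw [e]
  have h1 := condExp_avg (m := m) fun i => integrable_avg fun j => hi i j
  have h2 : ∀ᵐ w ∂P, ∀ i, P[fun w => avg fun j => inner ℝ (v i w) (v j w) | m] w
      = avg fun j => P[fun w => inner ℝ (v i w) (v j w) | m] w :=
    ae_all_iff.2 fun i => condExp_avg fun j => hi i j
  have h3 : ∀ᵐ w ∂P, ∀ i j, i ≠ j → P[fun w => inner ℝ (v i w) (v j w) | m] w = 0 := by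
    refine ae_all_iff.2 fun i => ae_all_iff.2 fun j => ?_
    by_cases hij : i = j
    · simp [hij]
    · filter_upwards [h0 i j hij] with w hw _ using hw
  have h4 : ∀ᵐ w ∂P, ∀ i, P[fun w => ‖v i w‖ ^ 2 | m] w ≤ D i := ae_all_iff.2 hD
  filter_upwards [h1, h2, h3, h4] with w a1 a2 a3 a4
  rw [a1]
  -- Only the diagonal of the double mean survives, which leaves an additional factor `1/n`.
  have : (fun i => P[fun w => avg fun j => inner ℝ (v i w) (v j w) | m] w)
      = fun i => (n : ℝ)⁻¹ * P[fun w => ‖v i w‖ ^ 2 | m] w := by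
    funext i
    rw [a2 i, avg_def_real, Finset.sum_eq_single i (fun j _ hj => a3 i j hj.symm) (by simp)]
    simp only [real_inner_self_eq_norm_sq]
  rw [this, avg_const_mul, div_eq_inv_mul]
  exact mul_le_mul_of_nonneg_left (avg_le_avg a4) (by positivity)

end AvgMeasure

/-! ### Compressor and quantizer at random arguments. -/

section Operators

variable {d : ℕ} {Ω S : Type*} {m m0 : MeasurableSpace Ω} [MeasurableSpace S]
  {P : Measure Ω} [IsProbabilityMeasure P] {ν : Measure S} [IsProbabilityMeasure ν]
  {ζ : Ω → S} {C Q : S → E d → E d} {δ ω : ℝ} {y : Ω → E d}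

theorem IsCompressor.freeze (hC : IsCompressor ν C δ) (hm : m ≤ m0) (hζ : Measurable ζ)
    (hlaw : P.map ζ = ν) (hind : Indep (MeasurableSpace.comap ζ inferInstance) m P)
    (hy : Measurable[m] y) (hy2 : MemLp y 2 P) :
    MemLp (fun w => y w - C (ζ w) (y w)) 2 P ∧
      ∫ w, ‖y w - C (ζ w) (y w)‖ ^ 2 ∂P ≤ (1 - δ) * ∫ w, ‖y w‖ ^ 2 ∂P := by
  have hCm := hC.measurable
  have hφ : Measurable fun p : E d × S => ‖p.1 - C p.2 p.1‖ ^ 2 := by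
    have : Measurable fun p : E d × S => C p.2 p.1 := hCm.comp measurable_swap
    fun_prop
  have hi : ∀ u, Integrable (fun z => ‖u - C z u‖ ^ 2) ν := fun u => by
    simpa only [norm_sub_rev] using integrable_sq_norm (hC.memLp u)
  obtain ⟨h1, h2⟩ := integrable_and_condExp_le_of_freeze hm hy hζ hlaw hind hφ
    (fun p => by positivity) (b := fun u => (1 - δ) * ‖u‖ ^ 2) hi
    (fun u => by simpa only [norm_sub_rev] using hC.contraction u)
    ((integrable_sq_norm hy2).const_mul _)
  have hy0 : Measurable y := hy.mono hm le_rfl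
  have hmeas : Measurable fun w => y w - C (ζ w) (y w) := hy0.sub (hCm.comp (hζ.prodMk hy0))
  refine ⟨(memLp_two_iff_integrable_sq_norm hmeas.aestronglyMeasurable).2 h1, ?_⟩
  rw [← integral_const_mul, ← integral_condExp hm,
    ← integral_condExp hm (f := fun w => (1 - δ) * ‖y w‖ ^ 2)]
  exact integral_mono_ae integrable_condExp integrable_condExp (h2 m le_rfl)

/-- Bias-variance decomposition around `p + αu`: the cross term vanishes because `Q` is unbiased. -/
theorem IsQuantizer.integral_sq_norm_add_smul_le (hQ : IsQuantizer ν Q ω) (α : ℝ) (p u : E d) :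
    Integrable (fun z => ‖p + α • Q z u‖ ^ 2) ν ∧
      ∫ z, ‖p + α • Q z u‖ ^ 2 ∂ν ≤ ‖p + α • u‖ ^ 2 + α ^ 2 * (ω * ‖u‖ ^ 2) := by
  have e : (fun z => ‖p + α • Q z u‖ ^ 2) = fun z =>
      ‖p + α • u‖ ^ 2 + (2 * α * inner ℝ (p + α • u) (Q z u - u) + α ^ 2 * ‖Q z u - u‖ ^ 2) := by
    funext z
    have : p + α • Q z u = (p + α • u) + α • (Q z u - u) := by rw [smul_sub]; abel
    rw [this, norm_add_sq_real, inner_smul_right, norm_smul, mul_pow, Real.norm_eq_abs, sq_abs]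
    ring
  have i1 : Integrable (fun z => Q z u - u) ν := (hQ.memLp u).integrable one_le_two
  have i2 : Integrable (fun z => 2 * α * inner ℝ (p + α • u) (Q z u - u)) ν :=
    (i1.const_inner _).const_mul _
  have i3 : Integrable (fun z => α ^ 2 * ‖Q z u - u‖ ^ 2) ν :=
    (integrable_sq_norm (hQ.memLp u)).const_mul _
  rw [e]
  have i4 : Integrable (fun z => 2 * α * inner ℝ (p + α • u) (Q z u - u)
      + α ^ 2 * ‖Q z u - u‖ ^ 2) ν := i2.add i3
  refine ⟨(integrable_const _).add i4, ?_⟩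
  have iQ : Integrable (fun z => Q z u) ν := by
    refine (i1.add (integrable_const u)).congr (ae_of_all _ fun z => ?_)
    simp
  have h0 : ∫ z, (Q z u - u) ∂ν = 0 := by
    rw [integral_sub iQ (integrable_const u), hQ.unbiased u]
    simp
  rw [integral_add (integrable_const _) i4, integral_add i2 i3, integral_const_mul,
    integral_const_mul, integral_inner i1, h0]
  have := mul_le_mul_of_nonneg_left (hQ.variance u) (sq_nonneg α)
  simpa using this

theorem IsQuantizer.freeze (hQ : IsQuantizer ν Q ω) (hm : m ≤ m0) (hζ : Measurable ζ)
    (hlaw : P.map ζ = ν) (hind : Indep (MeasurableSpace.comap ζ inferInstance) m P)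
    {p : Ω → E d} (hp : Measurable[m] p) (hp2 : MemLp p 2 P)
    (hy : Measurable[m] y) (hy2 : MemLp y 2 P) (α : ℝ) :
    MemLp (fun w => p w + α • Q (ζ w) (y w)) 2 P ∧
      ∀ m' : MeasurableSpace Ω, m' ≤ m →
        P[fun w => ‖p w + α • Q (ζ w) (y w)‖ ^ 2 | m']
          ≤ᵐ[P] P[fun w => ‖p w + α • y w‖ ^ 2 + α ^ 2 * (ω * ‖y w‖ ^ 2) | m'] := by
  have hQm := hQ.measurable
  have hφ : Measurable fun q : (E d × E d) × S => ‖q.1.1 + α • Q q.2 q.1.2‖ ^ 2 := by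
    have : Measurable fun q : (E d × E d) × S => Q q.2 q.1.2 :=
      hQm.comp (measurable_snd.prodMk (measurable_snd.comp measurable_fst))
    fun_prop
  obtain ⟨h1, h2⟩ := integrable_and_condExp_le_of_freeze hm (Measurable.prodMk hp hy) hζ hlaw
    hind hφ (fun q => by positivity)
    (b := fun q => ‖q.1 + α • q.2‖ ^ 2 + α ^ 2 * (ω * ‖q.2‖ ^ 2))
    (fun q => (hQ.integral_sq_norm_add_smul_le α q.1 q.2).1)
    (fun q => (hQ.integral_sq_norm_add_smul_le α q.1 q.2).2)
    ((integrable_sq_norm (hp2.add (hy2.const_smul α))).add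
      (((integrable_sq_norm hy2).const_mul ω).const_mul (α ^ 2)))
  have hy0 : Measurable y := hy.mono hm le_rfl
  have hmeas : Measurable fun w => p w + α • Q (ζ w) (y w) :=
    (hp.mono hm le_rfl).add ((hQm.comp (hζ.prodMk hy0)).const_smul α)
  exact ⟨(memLp_two_iff_integrable_sq_norm hmeas.aestronglyMeasurable).2 h1, h2⟩

end Operators

/-! ### Algebra and measurability of the recursion. -/

namespace Input

variable {n d : ℕ} {Ω SC SQ : Type*} (I : Input n d Ω SC SQ)

theorem x_succ (k : ℕ) (w : Ω) : I.x (k + 1) w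
    = I.x k w - avg (fun i => I.C (I.ξ k i w) (I.e k i w + I.γ • I.g k i w)) := rfl

theorem e_succ (k : ℕ) (i : Fin n) (w : Ω) : I.e (k + 1) i w
    = (I.e k i w + I.γ • I.g k i w) - I.C (I.ξ k i w) (I.e k i w + I.γ • I.g k i w) := rfl

theorem h_succ (k : ℕ) (i : Fin n) (w : Ω) : I.h (k + 1) i w
    = I.h k i w + I.α • I.Q (I.ζ k i w) (I.ghat k i w - I.h k i w) := rfl

/-- With the compressed vectors eliminated in favour of the new errors, square integrability of
`x^{k+1}` follows from that of `e_i^{k+1}`, and the perturbed step becomes visible. -/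
theorem x_succ_eq_add (k : ℕ) (w : Ω) : I.x (k + 1) w
    = I.x k w + avg (fun i => I.e (k + 1) i w) - avg (fun i => I.e k i w + I.γ • I.g k i w) := by
  simp only [x_succ, e_succ, avg_sub]
  abel

/-- The perturbed iterate `x^k - e^k` makes plain gradient steps. -/
theorem perturbed_succ (k : ℕ) (w : Ω) :
    I.x (k + 1) w - avg (fun i => I.e (k + 1) i w)
      = I.x k w - avg (fun i => I.e k i w) - I.γ • avg (fun i => I.g k i w) := by
  rw [x_succ_eq_add, avg_add, avg_smul]
  abel

theorem avg_g (hn : 0 < n) (k : ℕ) (w : Ω) :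
    avg (fun i => I.g k i w) = avg (fun i => I.ghat k i w) := by
  simp only [g, avg_add, avg_sub, avg_const hn]
  exact sub_add_cancel _ _

theorem e_zero (i : Fin n) (w : Ω) : I.e 0 i w = 0 := rfl

theorem x_zero (w : Ω) : I.x 0 w = I.x0 := rfl

theorem h_zero (i : Fin n) (w : Ω) : I.h 0 i w = I.h0 i := rfl

theorem sigmaSq_nonneg (f : Fin n → E d → ℝ) (xs : E d) (k : ℕ) (w : Ω) :
    0 ≤ I.sigmaSq f xs k w :=
  avg_nonneg fun i => by positivity

variable [MeasurableSpace SC] [MeasurableSpace SQ]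

theorem sample_le_history {j k : ℕ} (hjk : j < k) (i : Fin n) :
    MeasurableSpace.comap (I.ghat j i) inferInstance ⊔
      MeasurableSpace.comap (I.ξ j i) inferInstance ⊔
      MeasurableSpace.comap (I.ζ j i) inferInstance ≤ I.history k :=
  le_trans (le_iSup (fun i => MeasurableSpace.comap (I.ghat j i) inferInstance ⊔
      MeasurableSpace.comap (I.ξ j i) inferInstance ⊔
      MeasurableSpace.comap (I.ζ j i) inferInstance) i)
    (le_iSup₂_of_le j hjk le_rfl)

theorem measurable_ghat_history (k : ℕ) (i : Fin n) :
    Measurable[I.history (k + 1)] (I.ghat k i) :=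
  measurable_iff_comap_le.2
    ((le_sup_left.trans le_sup_left).trans (I.sample_le_history k.lt_succ_self i))

theorem measurable_xi_history (k : ℕ) (i : Fin n) :
    Measurable[I.history (k + 1)] (I.ξ k i) :=
  measurable_iff_comap_le.2
    ((le_sup_right.trans le_sup_left).trans (I.sample_le_history k.lt_succ_self i))

theorem measurable_zeta_history (k : ℕ) (i : Fin n) :
    Measurable[I.history (k + 1)] (I.ζ k i) :=
  measurable_iff_comap_le.2 (le_sup_right.trans (I.sample_le_history k.lt_succ_self i))

theorem history_mono : Monotone I.history := fun _ _ hkl =>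
  iSup₂_le fun _ hj => iSup_le fun i => I.sample_le_history (hj.trans_le hkl) i

theorem history_le_historyGrad (k : ℕ) : I.history k ≤ I.historyGrad k := le_sup_left

theorem measurable_ghat_historyGrad (k : ℕ) (i : Fin n) :
    Measurable[I.historyGrad k] (I.ghat k i) :=
  measurable_iff_comap_le.2 (le_sup_of_le_right
    (le_iSup (fun i => MeasurableSpace.comap (I.ghat k i) inferInstance) i))

theorem measurable_state (hC : Measurable (Function.uncurry I.C))
    (hQ : Measurable (Function.uncurry I.Q)) (k : ℕ) :
    Measurable[I.history k] (I.x k) ∧ (∀ i, Measurable[I.history k] (I.e k i)) ∧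
      ∀ i, Measurable[I.history k] (I.h k i) := by
  induction k with
  | zero =>
    refine ⟨?_, fun i => ?_, fun i => ?_⟩
    · exact measurable_const
    · exact measurable_const
    · exact measurable_const
  | succ k ih =>
    have hle := I.history_mono k.le_succ
    have hx := ih.1.mono hle le_rfl
    have he := fun i => (ih.2.1 i).mono hle le_rfl
    have hh := fun i => (ih.2.2 i).mono hle le_rfl
    have hg : ∀ i, Measurable[I.history (k + 1)] (I.g k i) := fun i =>
      ((I.measurable_ghat_history k i).sub (hh i)).add (measurable_avg hh)
    have hu : ∀ i, Measurable[I.history (k + 1)] (fun w => I.e k i w + I.γ • I.g k i w) :=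
      fun i => (he i).add ((hg i).const_smul I.γ)
    have hv : ∀ i, Measurable[I.history (k + 1)]
        (fun w => I.C (I.ξ k i w) (I.e k i w + I.γ • I.g k i w)) := fun i =>
      hC.comp ((I.measurable_xi_history k i).prodMk (hu i))
    refine ⟨hx.sub (measurable_avg hv), fun i => (hu i).sub (hv i), fun i => ?_⟩
    exact (hh i).add ((hQ.comp ((I.measurable_zeta_history k i).prodMk
      ((I.measurable_ghat_history k i).sub (hh i)))).const_smul I.α)

end Input

/-! ### Integrability of the iterates and properties of the noise. -/

section Sampling

variable {n d : ℕ} {Ω SC SQ : Type*} [m0 : MeasurableSpace Ω] [MeasurableSpace SC]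
  [MeasurableSpace SQ] {P : Measure Ω} {νC : Measure SC} {νQ : Measure SQ}
  {fi : Fin n → E d → ℝ} {L : ℝ} {I : Input n d Ω SC SQ} {Dti : Fin n → ℝ}

theorem Sampling.history_le (hI : Sampling P νC νQ fi Dti I) (k : ℕ) : I.history k ≤ m0 :=
  iSup₂_le fun j _ => iSup_le fun i => sup_le (sup_le (hI.measurable_ghat j i).comap_le
    (hI.measurable_xi j i).comap_le) (hI.measurable_zeta j i).comap_le

theorem Sampling.historyGrad_le (hI : Sampling P νC νQ fi Dti I) (k : ℕ) :
    I.historyGrad k ≤ m0 :=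
  sup_le (hI.history_le k) (iSup_le fun i => (hI.measurable_ghat k i).comap_le)

variable [IsProbabilityMeasure P]

theorem memLp_gradient_comp {f : E d → ℝ} (hf : IsLSmooth f L) {x : Ω → E d}
    (hx : MemLp x 2 P) : MemLp (fun w => gradient f (x w)) 2 P := by
  have h : MemLp (fun w => gradient f (x w) - gradient f 0) 2 P := by
    refine hx.of_le_mul (c := L) ?_ (ae_of_all _ fun w => ?_)
    · exact (hf.continuous_gradient.comp_aestronglyMeasurable hx.1).sub
        aestronglyMeasurable_const
    · simpa using hf.2 (x w) 0
  refine (h.add (memLp_const (gradient f 0))).ae_eq (ae_of_all _ fun w => ?_)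
  simp

theorem Sampling.memLp_ghat (hI : Sampling P νC νQ fi Dti I) (hs : ∀ i, IsLSmooth (fi i) L)
    {k : ℕ} (hx : MemLp (I.x k) 2 P) (i : Fin n) : MemLp (I.ghat k i) 2 P := by
  refine ((hI.memLp k i).add (memLp_gradient_comp (hs i) hx)).ae_eq (ae_of_all _ fun w => ?_)
  simp

theorem Sampling.variance_nonneg (hI : Sampling P νC νQ fi Dti I) (i : Fin n) : 0 ≤ Dti i := by
  have h1 : 0 ≤ᵐ[P] P[fun w => ‖I.ghat 0 i w - gradient (fi i) (I.x 0 w)‖ ^ 2 | I.history 0] :=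
    condExp_nonneg (ae_of_all _ fun w => sq_nonneg _)
  obtain ⟨w, a, b⟩ := (h1.and (hI.variance 0 i)).exists
  exact a.trans b

theorem Sampling.integral_sq_noise_le (hI : Sampling P νC νQ fi Dti I) (k : ℕ) (i : Fin n) :
    ∫ w, ‖I.ghat k i w - gradient (fi i) (I.x k w)‖ ^ 2 ∂P ≤ Dti i := by
  have := integral_le_of_condExp_le (hI.history_le k) (integrable_const (Dti i)) (hI.variance k i)
  simpa using this

theorem Sampling.ghat_eq_of_variance_eq_zero (hI : Sampling P νC νQ fi Dti I) {i : Fin n}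
    (h0 : Dti i = 0) (k : ℕ) : I.ghat k i =ᵐ[P] fun w => gradient (fi i) (I.x k w) := by
  have h1 := hI.integral_sq_noise_le k i
  rw [h0] at h1
  have h2 := (integral_eq_zero_iff_of_nonneg (fun w => sq_nonneg _)
    (integrable_sq_norm (hI.memLp k i))).1 (le_antisymm h1 (integral_nonneg fun w => sq_nonneg _))
  filter_upwards [h2] with w hw
  simpa [sub_eq_zero] using hw

end Sampling

section Method

variable {n d : ℕ} {Ω SC SQ : Type*} [m0 : MeasurableSpace Ω] [MeasurableSpace SC]
  [MeasurableSpace SQ] {P : Measure Ω} [IsProbabilityMeasure P]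
  {νC : Measure SC} [IsProbabilityMeasure νC] {νQ : Measure SQ} [IsProbabilityMeasure νQ]
  {fi : Fin n → E d → ℝ} {L δ ω : ℝ} {I : Input n d Ω SC SQ} {Dti : Fin n → ℝ}

/-- Only the noise is assumed square integrable. The Lipschitz gradients transfer this from `x^k` to
the stochastic gradients, and freezing transfers it through the two operators. -/
theorem Sampling.memLp_state (hI : Sampling P νC νQ fi Dti I) (hs : ∀ i, IsLSmooth (fi i) L)
    (hC : IsCompressor νC I.C δ) (hQ : IsQuantizer νQ I.Q ω) (k : ℕ) :
    MemLp (I.x k) 2 P ∧ (∀ i, MemLp (I.e k i) 2 P) ∧ ∀ i, MemLp (I.h k i) 2 P := by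
  induction k with
  | zero => exact ⟨memLp_const I.x0, fun i => memLp_const 0, fun i => memLp_const (I.h0 i)⟩
  | succ k ih =>
    obtain ⟨hx, he, hh⟩ := ih
    obtain ⟨mx, me, mh⟩ := I.measurable_state hC.measurable hQ.measurable k
    have hle := I.history_le_historyGrad k
    have hg := hI.memLp_ghat hs hx
    have mg := I.measurable_ghat_historyGrad k
    have hy : ∀ i, MemLp (fun w => I.ghat k i w - I.h k i w) 2 P := fun i => (hg i).sub (hh i)
    have my : ∀ i, Measurable[I.historyGrad k] (fun w => I.ghat k i w - I.h k i w) :=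
      fun i => (mg i).sub ((mh i).mono hle le_rfl)
    have hu : ∀ i, MemLp (fun w => I.e k i w + I.γ • I.g k i w) 2 P := fun i =>
      (he i).add (((hy i).add (memLp_avg hh)).const_smul I.γ)
    have mu : ∀ i, Measurable[I.historyGrad k] (fun w => I.e k i w + I.γ • I.g k i w) := fun i =>
      ((me i).mono hle le_rfl).add
        (((my i).add ((measurable_avg mh).mono hle le_rfl)).const_smul I.γ)
    have he' : ∀ i, MemLp (I.e (k + 1) i) 2 P := fun i =>
      (hC.freeze (hI.historyGrad_le k) (hI.measurable_xi k i) (hI.law_xi k i)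
        (hI.indep_xi k i) (mu i) (hu i)).1
    refine ⟨?_, he', fun i => ?_⟩
    · have : I.x (k + 1) = fun w => I.x k w + avg (fun i => I.e (k + 1) i w)
          - avg (fun i => I.e k i w + I.γ • I.g k i w) := funext (I.x_succ_eq_add k)
      rw [this]
      exact (hx.add (memLp_avg he')).sub (memLp_avg hu)
    · exact (hQ.freeze (hI.historyGrad_le k) (hI.measurable_zeta k i) (hI.law_zeta k i)
        (hI.indep_zeta k i) ((mh i).mono hle le_rfl) (hh i) (my i) (hy i) I.α).1

/-- The noise of the stochastic gradient is conditionally centred. -/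
theorem Sampling.condExp_noise (hI : Sampling P νC νQ fi Dti I) (hs : ∀ i, IsLSmooth (fi i) L)
    (hC : IsCompressor νC I.C δ) (hQ : IsQuantizer νQ I.Q ω) (k : ℕ) (i : Fin n) :
    P[fun w => I.ghat k i w - gradient (fi i) (I.x k w) | I.history k] =ᵐ[P] 0 := by
  have hx := (hI.memLp_state hs hC hQ k).1
  have i1 := (hI.memLp_ghat hs hx i).integrable one_le_two
  have i2 := (memLp_gradient_comp (hs i) hx).integrable one_le_two
  have m2 : StronglyMeasurable[I.history k] fun w => gradient (fi i) (I.x k w) :=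
    ((hs i).continuous_gradient.measurable.comp
      (I.measurable_state hC.measurable hQ.measurable k).1).stronglyMeasurable
  filter_upwards [condExp_sub i1 i2 (I.history k), hI.unbiased k i] with w h1 h2
  have e : P[fun w => I.ghat k i w - gradient (fi i) (I.x k w) | I.history k] w
      = P[I.ghat k i - fun w => gradient (fi i) (I.x k w) | I.history k] w := rfl
  rw [e, h1, Pi.sub_apply, h2, condExp_of_stronglyMeasurable (hI.history_le k) m2 i2, sub_self,
    Pi.zero_apply]

end Method

theorem measurable_sq_norm {d : ℕ} : Measurable fun u : E d => ‖u‖ ^ 2 := by fun_prop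

/-! ### The shift update under quantization. -/

section Algebra

variable {V : Type*} [NormedAddCommGroup V] [InnerProductSpace ℝ V]

theorem shifted_quadratic_expand (p a v : V) (α ω : ℝ) :
    ‖p + α • (a + v)‖ ^ 2 + α ^ 2 * (ω * ‖a + v‖ ^ 2)
      = (‖p + α • a‖ ^ 2 + α ^ 2 * (ω * ‖a‖ ^ 2))
        + 2 * inner ℝ (α • (p + α • a) + (α ^ 2 * ω) • a) v + α ^ 2 * (ω + 1) * ‖v‖ ^ 2 := by
  have h2 := norm_add_sq_real (p + α • a) (α • v)
  have h3 := norm_add_sq_real a v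
  rw [norm_smul, inner_smul_right, Real.norm_eq_abs, mul_pow, sq_abs] at h2
  rw [smul_add, ← add_assoc, h2, h3, inner_add_left (α • (p + α • a)), real_inner_smul_left,
    real_inner_smul_left]
  ring

/-- The terms in `‖p‖²` and `⟨p, a⟩` agree on both sides, so only `α²(ω + 1) ≤ α` is needed, for the
coefficient of `‖a‖²`. -/
theorem shifted_quadratic_le (p a : V) {α ω : ℝ} (hα0 : 0 ≤ α) (hα : α * (ω + 1) ≤ 1) :
    ‖p + α • a‖ ^ 2 + α ^ 2 * (ω * ‖a‖ ^ 2) ≤ (1 - α) * ‖p‖ ^ 2 + α * ‖p + a‖ ^ 2 := by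
  rw [norm_add_sq_real, norm_add_sq_real, norm_smul, inner_smul_right, Real.norm_eq_abs, mul_pow,
    sq_abs]
  have h3 : α * (α * (ω + 1)) * ‖a‖ ^ 2 ≤ α * 1 * ‖a‖ ^ 2 :=
    mul_le_mul_of_nonneg_right (mul_le_mul_of_nonneg_left hα hα0) (sq_nonneg _)
  linarith

end Algebra

section Quantizer

variable {d : ℕ} {Ω S : Type*} {m mG m0 : MeasurableSpace Ω} [MeasurableSpace S]
  {P : Measure Ω} [IsProbabilityMeasure P] {ν : Measure S} [IsProbabilityMeasure ν]
  {ζ : Ω → S} {Q : S → E d → E d} {ω : ℝ}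

/-- A shift `p` is moved by `α Q(a + v)`, where `v` is centred given `m`. -/
theorem IsQuantizer.condExp_sq_norm_shift_le (hQ : IsQuantizer ν Q ω) (hmG : mG ≤ m0)
    (hle : m ≤ mG) (hζ : Measurable ζ) (hlaw : P.map ζ = ν)
    (hind : Indep (MeasurableSpace.comap ζ inferInstance) mG P)
    {p a v : Ω → E d} (mp : Measurable[m] p) (p2 : MemLp p 2 P) (ma : Measurable[m] a)
    (a2 : MemLp a 2 P) (mv : Measurable[mG] v) (v2 : MemLp v 2 P) (hv : P[v | m] =ᵐ[P] 0)
    {D : ℝ} (hD : P[fun w => ‖v w‖ ^ 2 | m] ≤ᵐ[P] fun _ => D)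
    {α : ℝ} (hα0 : 0 ≤ α) (hα : α * (ω + 1) ≤ 1) :
    P[fun w => ‖p w + α • Q (ζ w) (a w + v w)‖ ^ 2 | m] ≤ᵐ[P] fun w =>
      (1 - α) * ‖p w‖ ^ 2 + α * ‖p w + a w‖ ^ 2 + α ^ 2 * (ω + 1) * D := by
  -- The seed is integrated out given the larger `mG`, where `v` is known. Conditioning the
  -- resulting quadratic in `v` on `m` kills its linear term and leaves `α²(ω + 1)‖v‖²`.
  have hfr := (hQ.freeze hmG hζ hlaw hind (mp.mono hle le_rfl) p2
    (Measurable.add (ma.mono hle le_rfl) mv) (a2.add v2) α).2 m hle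
  refine hfr.trans ?_
  have ms : Measurable[m] fun w => p w + α • a w := mp.add (ma.const_smul α)
  have s2 : MemLp (fun w => p w + α • a w) 2 P := p2.add (a2.const_smul α)
  have mB : Measurable[m] fun w => ‖p w + α • a w‖ ^ 2 + α ^ 2 * (ω * ‖a w‖ ^ 2) :=
    (measurable_sq_norm.comp ms).add
      (((measurable_sq_norm.comp ma).const_mul ω).const_mul (α ^ 2))
  have mc : Measurable[m] fun w => α • (p w + α • a w) + (α ^ 2 * ω) • a w :=
    (ms.const_smul α).add (ma.const_smul (α ^ 2 * ω))
  have hB : Integrable (fun w => ‖p w + α • a w‖ ^ 2 + α ^ 2 * (ω * ‖a w‖ ^ 2)) P :=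
    (integrable_sq_norm s2).add (((integrable_sq_norm a2).const_mul ω).const_mul (α ^ 2))
  have hc : MemLp (fun w => α • (p w + α • a w) + (α ^ 2 * ω) • a w) 2 P :=
    (s2.const_smul α).add (a2.const_smul (α ^ 2 * ω))
  have e : (fun w => ‖p w + α • (a + v) w‖ ^ 2 + α ^ 2 * (ω * ‖(a + v) w‖ ^ 2)) = fun w =>
      (‖p w + α • a w‖ ^ 2 + α ^ 2 * (ω * ‖a w‖ ^ 2))
        + 2 * inner ℝ (α • (p w + α • a w) + (α ^ 2 * ω) • a w) (v w)
        + α ^ 2 * (ω + 1) * ‖v w‖ ^ 2 :=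
    funext fun w => shifted_quadratic_expand _ _ _ _ _
  rw [e]
  have hω := hQ.omega_nonneg
  filter_upwards [condExp_quadratic (κ := α ^ 2 * (ω + 1)) (hle.trans hmG)
    mB.stronglyMeasurable hB mc.stronglyMeasurable hc v2 hv, hD] with w h1 h2
  rw [h1]
  exact add_le_add (shifted_quadratic_le _ _ hα0 hα)
    (mul_le_mul_of_nonneg_left h2 (by positivity))

end Quantizer

/-! ### Splitting the estimator into conditional mean and noise. -/

section Estimator

variable {n d : ℕ} {Ω SC SQ : Type*} {fi : Fin n → E d → ℝ} {f : E d → ℝ} {L : ℝ}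
  {I : Input n d Ω SC SQ} {Dti : Fin n → ℝ}

/-- The conditional mean `∇f_i(x^k) - h_i^k + h^k` of `g_i^k`. -/
noncomputable def Input.gbar (I : Input n d Ω SC SQ) (fi : Fin n → E d → ℝ) (k : ℕ) (i : Fin n)
    (w : Ω) : E d :=
  gradient (fi i) (I.x k w) - I.h k i w + avg (fun j => I.h k j w)

/-- The noise `ĝ_i^k - ∇f_i(x^k)`. -/
noncomputable def Input.noise (I : Input n d Ω SC SQ) (fi : Fin n → E d → ℝ) (k : ℕ) (i : Fin n)
    (w : Ω) : E d :=
  I.ghat k i w - gradient (fi i) (I.x k w)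

theorem Input.g_eq_gbar_add_noise (I : Input n d Ω SC SQ) (fi : Fin n → E d → ℝ) (k : ℕ)
    (i : Fin n) (w : Ω) : I.g k i w = I.gbar fi k i w + I.noise fi k i w := by
  simp only [Input.g, Input.gbar, Input.noise]
  abel

theorem Input.avg_g_eq (I : Input n d Ω SC SQ) (hn : 0 < n) (hf : f = fun x => avg (fun i => fi i x))
    (hs : ∀ i, IsLSmooth (fi i) L) (k : ℕ) (w : Ω) :
    avg (fun i => I.g k i w)
      = gradient f (I.x k w) + avg (fun i => I.noise fi k i w) := by
  rw [I.avg_g hn, hf, gradient_avg fun i => (hs i).1]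
  simp only [Input.noise, avg_sub]
  abel

variable [MeasurableSpace SC] [MeasurableSpace SQ]

theorem Input.measurable_gbar (hs : ∀ i, IsLSmooth (fi i) L)
    (hC : Measurable (Function.uncurry I.C)) (hQ : Measurable (Function.uncurry I.Q)) (k : ℕ)
    (i : Fin n) : Measurable[I.history k] (I.gbar fi k i) := by
  obtain ⟨mx, me, mh⟩ := I.measurable_state hC hQ k
  exact (((hs i).continuous_gradient.measurable.comp mx).sub (mh i)).add (measurable_avg mh)

variable [MeasurableSpace Ω] {P : Measure Ω} {νC : Measure SC} {νQ : Measure SQ}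

theorem Sampling.memLp_noise (hI : Sampling P νC νQ fi Dti I) (k : ℕ) (i : Fin n) :
    MemLp (I.noise fi k i) 2 P :=
  hI.memLp k i

theorem Sampling.memLp_avg_noise (hI : Sampling P νC νQ fi Dti I) (k : ℕ) :
    MemLp (fun w => avg (fun i => I.noise fi k i w)) 2 P :=
  memLp_avg fun i => hI.memLp_noise k i

end Estimator

/-! ### The conditional inequalities of the parametric assumption. -/

section OneStep

variable {n d : ℕ} {Ω SC SQ : Type*} [m0 : MeasurableSpace Ω] [MeasurableSpace SC]
  [MeasurableSpace SQ] {P : Measure Ω} [IsProbabilityMeasure P]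
  {νC : Measure SC} [IsProbabilityMeasure νC] {νQ : Measure SQ} [IsProbabilityMeasure νQ]
  {fi : Fin n → E d → ℝ} {f : E d → ℝ} {xs : E d} {L μ δ ω : ℝ} {I : Input n d Ω SC SQ}
  {Dti : Fin n → ℝ}

theorem Sampling.memLp_gbar (hI : Sampling P νC νQ fi Dti I) (hs : ∀ i, IsLSmooth (fi i) L)
    (hC : IsCompressor νC I.C δ) (hQ : IsQuantizer νQ I.Q ω) (k : ℕ) (i : Fin n) :
    MemLp (I.gbar fi k i) 2 P := by
  obtain ⟨hx, he, hh⟩ := hI.memLp_state hs hC hQ k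
  exact ((memLp_gradient_comp (hs i) hx).sub (hh i)).add (memLp_avg hh)

theorem Sampling.memLp_g (hI : Sampling P νC νQ fi Dti I) (hs : ∀ i, IsLSmooth (fi i) L)
    (hC : IsCompressor νC I.C δ) (hQ : IsQuantizer νQ I.Q ω) (k : ℕ) (i : Fin n) :
    MemLp (I.g k i) 2 P :=
  ((hI.memLp_gbar hs hC hQ k i).add (hI.memLp k i)).ae_eq
    (ae_of_all _ fun w => (I.g_eq_gbar_add_noise fi k i w).symm)

theorem Sampling.condExp_g (hI : Sampling P νC νQ fi Dti I) (hs : ∀ i, IsLSmooth (fi i) L)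
    (hC : IsCompressor νC I.C δ) (hQ : IsQuantizer νQ I.Q ω) (k : ℕ) (i : Fin n) :
    P[I.g k i | I.history k] =ᵐ[P] I.gbar fi k i := by
  have i1 := (hI.memLp_gbar hs hC hQ k i).integrable one_le_two
  have i2 := (hI.memLp k i).integrable one_le_two
  have e : I.g k i = I.gbar fi k i + I.noise fi k i := funext (I.g_eq_gbar_add_noise fi k i)
  have m1 := (I.measurable_gbar hs hC.measurable hQ.measurable k i).stronglyMeasurable
  rw [e]
  filter_upwards [condExp_add i1 i2 (I.history k), hI.condExp_noise hs hC hQ k i] with w h1 h2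
  refine h1.trans ?_
  rw [Pi.add_apply, h2, condExp_of_stronglyMeasurable (hI.history_le k) m1 i1, Pi.zero_apply,
    add_zero]

theorem Sampling.variance_g (hI : Sampling P νC νQ fi Dti I) (hs : ∀ i, IsLSmooth (fi i) L)
    (hC : IsCompressor νC I.C δ) (hQ : IsQuantizer νQ I.Q ω) (k : ℕ) (i : Fin n) :
    P[fun w => ‖I.g k i w - P[I.g k i | I.history k] w‖ ^ 2 | I.history k]
      ≤ᵐ[P] fun _ => Dti i := by
  refine (condExp_congr_ae ?_).trans_le (hI.variance k i)
  filter_upwards [hI.condExp_g hs hC hQ k i] with w hw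
  rw [hw, I.g_eq_gbar_add_noise fi k i w, add_sub_cancel_left, Input.noise]

theorem Sampling.condExp_avg_noise (hI : Sampling P νC νQ fi Dti I)
    (hs : ∀ i, IsLSmooth (fi i) L)
    (hC : IsCompressor νC I.C δ) (hQ : IsQuantizer νQ I.Q ω) (k : ℕ) :
    P[fun w => avg (fun i => I.noise fi k i w) | I.history k] =ᵐ[P] 0 := by
  have e : (fun w => avg (fun i => I.noise fi k i w)) = (n : ℝ)⁻¹ • ∑ i, I.noise fi k i := by
    funext w; simp [avg]
  rw [e]
  have h0 : ∀ᵐ w ∂P, ∀ i, P[I.noise fi k i | I.history k] w = 0 :=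
    ae_all_iff.2 fun i => hI.condExp_noise hs hC hQ k i
  filter_upwards [condExp_smul ((n : ℝ)⁻¹) (∑ i, I.noise fi k i) (I.history k) (μ := P),
    condExp_finsetSum (s := Finset.univ)
      (fun i _ => (hI.memLp_noise k i).integrable one_le_two) (I.history k), h0] with w h1 h2 h3
  rw [h1, Pi.smul_apply, h2, Finset.sum_apply, Finset.sum_eq_zero fun i _ => h3 i, smul_zero, Pi.zero_apply]

/-- Conditional independence of the workers enters here, producing the factor `1/n` in `D₁'`. -/
theorem Sampling.condExp_sq_norm_avg_noise_le (hI : Sampling P νC νQ fi Dti I)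
    (hs : ∀ i, IsLSmooth (fi i) L)
    (hC : IsCompressor νC I.C δ) (hQ : IsQuantizer νQ I.Q ω) (k : ℕ) :
    P[fun w => ‖avg (fun i => I.noise fi k i w)‖ ^ 2 | I.history k]
      ≤ᵐ[P] fun _ => avg Dti / n := by
  have hx := (hI.memLp_state hs hC hQ k).1
  refine condExp_sq_norm_avg_le (fun i => hI.memLp k i) (hI.variance k) fun i j hij => ?_
  exact (hI.condIndep k).condExp_inner_sub_eq_zero (hI.history_le k) (hI.measurable_ghat k)
    (hI.memLp_ghat hs hx) hij (M := fun i w => gradient (fi i) (I.x k w))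
    (fun i => (hs i).continuous_gradient.measurable.comp
      (I.measurable_state hC.measurable hQ.measurable k).1)
    (fun i => memLp_gradient_comp (hs i) hx) (hI.unbiased k)

theorem Sampling.condExp_sq_norm_avg_g_le (hn : 0 < n) (hL : 0 < L)
    (hf : f = fun x => avg (fun i => fi i x)) (hcv : ∀ i, ConvexOn ℝ Set.univ (fi i))
    (hq : IsQuasiStronglyConvex f xs μ)
    (hI : Sampling P νC νQ fi Dti I) (hs : ∀ i, IsLSmooth (fi i) L)
    (hC : IsCompressor νC I.C δ) (hQ : IsQuantizer νQ I.Q ω) (k : ℕ) :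
    P[fun w => ‖avg (fun i => I.g k i w)‖ ^ 2 | I.history k]
      ≤ᵐ[P] fun w => 2 * L * (f (I.x k w) - f xs) + avg Dti / n := by
  have hfs : IsLSmooth f L := hf ▸ IsLSmooth.avg hn hs
  have hfc : ConvexOn ℝ Set.univ f := hf ▸ convexOn_avg hcv
  have hx := (hI.memLp_state hs hC hQ k).1
  have mx := (I.measurable_state hC.measurable hQ.measurable k).1
  have e : (fun w => ‖avg (fun i => I.g k i w)‖ ^ 2)
      = fun w => ‖gradient f (I.x k w) + avg (fun i => I.noise fi k i w)‖ ^ 2 := by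
    funext w; rw [I.avg_g_eq hn hf hs]
  rw [e]
  filter_upwards [condExp_sq_norm_add (hI.history_le k)
    (hfs.continuous_gradient.measurable.comp mx).stronglyMeasurable
    (memLp_gradient_comp hfs hx) (hI.memLp_avg_noise k) (hI.condExp_avg_noise hs hC hQ k),
    hI.condExp_sq_norm_avg_noise_le hs hC hQ k] with w h1 h2
  refine h1.trans_le (add_le_add ?_ h2)
  exact sq_norm_gradient_le hL hfs hfc hq _

theorem Sampling.condExp_sq_norm_h_succ_le (hI : Sampling P νC νQ fi Dti I)
    (hs : ∀ i, IsLSmooth (fi i) L)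
    (hC : IsCompressor νC I.C δ) (hQ : IsQuantizer νQ I.Q ω) (hα0 : 0 < I.α)
    (hα : I.α * (ω + 1) ≤ 1) (k : ℕ) (i : Fin n) (z : E d) :
    P[fun w => ‖I.h (k + 1) i w - z‖ ^ 2 | I.history k] ≤ᵐ[P] fun w =>
      (1 - I.α) * ‖I.h k i w - z‖ ^ 2 + I.α * ‖gradient (fi i) (I.x k w) - z‖ ^ 2
        + I.α ^ 2 * (ω + 1) * Dti i := by
  obtain ⟨hx, he, hh⟩ := hI.memLp_state hs hC hQ k
  obtain ⟨mx, me, mh⟩ := I.measurable_state hC.measurable hQ.measurable k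
  have hle := I.history_le_historyGrad k
  have mgr : Measurable[I.history k] fun w => gradient (fi i) (I.x k w) :=
    (hs i).continuous_gradient.measurable.comp mx
  -- With `p = h_i - z` and `a = ∇f_i(x) - h_i`, the sum `p + a` no longer involves the shift.
  have key := hQ.condExp_sq_norm_shift_le (hI.historyGrad_le k) hle (hI.measurable_zeta k i)
    (hI.law_zeta k i) (hI.indep_zeta k i) (p := fun w => I.h k i w - z)
    (a := fun w => gradient (fi i) (I.x k w) - I.h k i w) (v := I.noise fi k i)
    ((mh i).sub measurable_const) ((hh i).sub (memLp_const z)) (mgr.sub (mh i))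
    ((memLp_gradient_comp (hs i) hx).sub (hh i))
    ((I.measurable_ghat_historyGrad k i).sub (mgr.mono hle le_rfl)) (hI.memLp_noise k i)
    (hI.condExp_noise hs hC hQ k i) (hI.variance k i) hα0.le hα
  have e1 : (fun w => ‖I.h (k + 1) i w - z‖ ^ 2) = fun w => ‖(I.h k i w - z)
      + I.α • I.Q (I.ζ k i w) ((gradient (fi i) (I.x k w) - I.h k i w) + I.noise fi k i w)‖ ^ 2 := by
    funext w
    have h1 : (gradient (fi i) (I.x k w) - I.h k i w) + I.noise fi k i w
        = I.ghat k i w - I.h k i w := by rw [Input.noise]; abel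
    rw [I.h_succ, h1, add_sub_right_comm]
  rw [e1]
  filter_upwards [key] with w hw
  have h1 : (I.h k i w - z) + (gradient (fi i) (I.x k w) - I.h k i w)
      = gradient (fi i) (I.x k w) - z := by abel
  rwa [h1] at hw

theorem Sampling.condExp_sigmaSq_succ_le (hL : 0 < L)
    (hf : f = fun x => avg (fun i => fi i x)) (hcv : ∀ i, ConvexOn ℝ Set.univ (fi i))
    (hq : IsQuasiStronglyConvex f xs μ) (hI : Sampling P νC νQ fi Dti I)
    (hs : ∀ i, IsLSmooth (fi i) L)
    (hC : IsCompressor νC I.C δ) (hQ : IsQuantizer νQ I.Q ω) (hα0 : 0 < I.α)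
    (hα : I.α * (ω + 1) ≤ 1) (k : ℕ) :
    P[I.sigmaSq fi xs (k + 1) | I.history k] ≤ᵐ[P] fun w =>
      (1 - I.α) * I.sigmaSq fi xs k w + 2 * (L * I.α) * (f (I.x k w) - f xs)
        + I.α ^ 2 * (ω + 1) * avg Dti := by
  have hi : ∀ i, Integrable (fun w => ‖I.h (k + 1) i w - gradient (fi i) xs‖ ^ 2) P := fun i =>
    integrable_sq_norm (((hI.memLp_state hs hC hQ (k + 1)).2.2 i).sub (memLp_const _))
  have h1 : ∀ᵐ w ∂P, ∀ i,
      P[fun w => ‖I.h (k + 1) i w - gradient (fi i) xs‖ ^ 2 | I.history k] w ≤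
      (1 - I.α) * ‖I.h k i w - gradient (fi i) xs‖ ^ 2
        + I.α * ‖gradient (fi i) (I.x k w) - gradient (fi i) xs‖ ^ 2
        + I.α ^ 2 * (ω + 1) * Dti i :=
    ae_all_iff.2 fun i => hI.condExp_sq_norm_h_succ_le hs hC hQ hα0 hα k i _
  filter_upwards [condExp_avg (m := I.history k) hi, h1] with w a b
  refine (a.trans_le (avg_le_avg b)).trans ?_
  rw [avg_add, avg_add, avg_const_mul, avg_const_mul, avg_const_mul]
  have h2 := mul_le_mul_of_nonneg_left
    (avg_sq_norm_gradient_sub_le hL hf hs hcv hq (I.x k w)) hα0.le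
  simp only [Input.sigmaSq]
  linarith

theorem Sampling.integrable_sigmaSq (hI : Sampling P νC νQ fi Dti I)
    (hs : ∀ i, IsLSmooth (fi i) L)
    (hC : IsCompressor νC I.C δ) (hQ : IsQuantizer νQ I.Q ω) (xs : E d) (k : ℕ) :
    Integrable (I.sigmaSq fi xs k) P :=
  integrable_avg fun i =>
    integrable_sq_norm (((hI.memLp_state hs hC hQ k).2.2 i).sub (memLp_const _))

theorem Sampling.keyAssumption (hn : 0 < n) (hL : 0 < L)
    (hf : f = fun x => avg (fun i => fi i x)) (hcv : ∀ i, ConvexOn ℝ Set.univ (fi i))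
    (hq : IsQuasiStronglyConvex f xs μ) (hI : Sampling P νC νQ fi Dti I)
    (hs : ∀ i, IsLSmooth (fi i) L)
    (hC : IsCompressor νC I.C δ) (hQ : IsQuantizer νQ I.Q ω) (hα0 : 0 < I.α)
    (hα : I.α * (ω + 1) ≤ 1) :
    KeyAssumption P I.history f xs I.x I.g (I.sigmaSq fi xs) (fun _ _ => 0)
      (dianaParams n L I.α ω (avg Dti)) := by
  have hω := hQ.omega_nonneg
  have hD : 0 ≤ avg Dti := avg_nonneg hI.variance_nonneg
  have hα1 : I.α ≤ 1 := by nlinarith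
  have hfs : IsLSmooth f L := hf ▸ IsLSmooth.avg hn hs
  have hst := fun k => hI.memLp_state hs hC hQ k
  have hms := fun k => I.measurable_state hC.measurable hQ.measurable k
  constructor
  case const_nonneg =>
    simp only [dianaParams]
    refine ⟨?_, ?_, ?_, ?_, ?_, ?_, ?_, ?_, ?_, ?_, ?_, ?_, ?_, ?_, ?_, ?_⟩ <;> positivity
  case rho1_mem => exact ⟨hα0.le, hα1⟩
  case rho2_mem => exact ⟨zero_le_one, le_rfl⟩
  case mono => exact I.history_mono
  case le => exact hI.history_le
  case measurable_x => exact fun k => (hms k).1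
  case measurable_s1 =>
    exact fun k => measurable_avg_real fun i =>
      measurable_sq_norm.comp (((hms k).2.2 i).sub measurable_const)
  case measurable_s2 => exact fun k => measurable_const
  case s1_nonneg => exact I.sigmaSq_nonneg fi xs
  case s2_nonneg => exact fun _ _ => le_rfl
  case memLp_g => exact hI.memLp_g hs hC hQ
  case integrable_s1 => exact hI.integrable_sigmaSq hs hC hQ xs
  case integrable_s2 => exact fun k => integrable_zero _ _ _
  case unbiased =>
    intro k
    have e : (fun w => avg (fun i => I.g k i w))
        = (fun w => gradient f (I.x k w)) + fun w => avg (fun i => I.noise fi k i w) :=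
      funext (I.avg_g_eq hn hf hs k)
    have i1 := (memLp_gradient_comp hfs (hst k).1).integrable one_le_two
    rw [e]
    filter_upwards [condExp_add i1 ((hI.memLp_avg_noise k).integrable one_le_two) (I.history k),
      hI.condExp_avg_noise hs hC hQ k] with w h1 h2
    have h3 : P[fun w => gradient f (I.x k w) | I.history k] = fun w => gradient f (I.x k w) :=
      condExp_of_stronglyMeasurable (hI.history_le k)
        (hfs.continuous_gradient.measurable.comp (hms k).1).stronglyMeasurable i1
    rw [h1, Pi.add_apply, h2, h3]
    simp
  case second_moment_mean =>
    intro k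
    have h1 : ∀ᵐ w ∂P, ∀ i, P[I.g k i | I.history k] w = I.gbar fi k i w :=
      ae_all_iff.2 fun i => hI.condExp_g hs hC hQ k i
    filter_upwards [h1] with w hw
    simp only [hw]
    have := avg_sq_norm_shifted_gradient_le hn hL hf hs hcv hq (I.x k w) fun i => I.h k i w
    simp only [dianaParams, Input.gbar, Input.sigmaSq]
    linarith
  case variance =>
    intro k
    have h1 : ∀ᵐ w ∂P, ∀ i,
        P[fun w => ‖I.g k i w - P[I.g k i | I.history k] w‖ ^ 2 | I.history k] w ≤ Dti i :=
      ae_all_iff.2 fun i => hI.variance_g hs hC hQ k i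
    filter_upwards [h1] with w hw
    have := avg_le_avg hw
    simp only [dianaParams]
    linarith
  case second_moment =>
    intro k
    filter_upwards [hI.condExp_sq_norm_avg_g_le hn hL hf hcv hq hs hC hQ k] with w hw
    simp only [dianaParams]
    linarith
  case s1_recursion =>
    intro k
    filter_upwards [hI.condExp_sigmaSq_succ_le hL hf hcv hq hs hC hQ hα0 hα k] with w hw
    simp only [dianaParams]
    linarith
  case s2_recursion =>
    intro k
    have : P[fun _ : Ω => (0 : ℝ) | I.history k] = 0 := condExp_zero
    rw [this]
    exact ae_of_all _ fun w => by simp [dianaParams]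

end OneStep

/-! ### Numerical consequences of the stepsize bound. -/

section Stepsize

variable {L μ δ α γ η : ℝ}

theorem mul_le_of_le_maxStep (hL : 0 < L) (hγ : γ ≤ maxStep L δ α) : 4 * L * γ ≤ 1 := by
  have h := hγ.trans (min_le_left _ _)
  rw [le_div_iff₀ (by positivity)] at h
  linarith

theorem sq_le_of_le_maxStep (hL : 0 < L) (hα0 : 0 < α) (hα1 : α ≤ 1) (hγ0 : 0 < γ)
    (hγ : γ ≤ maxStep L δ α) : 1152 * (L * γ) ^ 2 ≤ δ ^ 2 := by
  have h := hγ.trans (min_le_right _ _)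
  have h3 : 0 < 6 * (3 - α) := by linarith
  have hs : 0 < √(6 * (3 - α)) := Real.sqrt_pos.2 h3
  rw [le_div_iff₀ (by positivity)] at h
  have h2 := pow_le_pow_left₀ (by positivity) h 2
  rw [mul_pow, mul_pow, mul_pow, Real.sq_sqrt h3.le, mul_pow, Real.sq_sqrt (by linarith)] at h2
  -- The squared stepsize condition is `384 (3 - α)(Lγ)² ≤ δ²(1 - α)`. Tripling it and using `3(1 -
  -- α) ≤ 3 - α` allows cancellation of `3 - α`, with `1152 = 3 · 384`.
  have h4 : δ ^ 2 * (3 * (1 - α)) ≤ δ ^ 2 * (3 - α) :=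
    mul_le_mul_of_nonneg_left (by linarith) (sq_nonneg _)
  have h5 : (3 - α) * (1152 * (L * γ) ^ 2) ≤ (3 - α) * δ ^ 2 := by nlinarith
  exact le_of_mul_le_mul_left h5 (by linarith)

theorem rate_le (hδ : 0 < δ) (hγ0 : 0 < γ) (hμL : μ ≤ L)
    (hγ : 1152 * (L * γ) ^ 2 ≤ δ ^ 2) (hη : η ≤ γ * μ / 2) : η ≤ δ / 64 := by
  -- Since `32² = 1024 ≤ 1152`; then `γμ/2 ≤ γL/2 ≤ δ/64`.
  have h1 : 32 * (L * γ) ≤ δ := by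
    refine abs_le_of_sq_le_sq' ?_ hδ.le |>.2
    nlinarith [sq_nonneg (L * γ)]
  have h2 : γ * μ ≤ γ * L := mul_le_mul_of_nonneg_left hμL hγ0.le
  linarith

/-- The numerical part of the bound on the accumulated errors. -/
theorem error_sum_arith (hL : 0 < L) (hδ : 0 < δ) (hα0 : 0 < α) (hγ0 : 0 < γ)
    (hγ : 1152 * (L * γ) ^ 2 ≤ δ ^ 2) (hη0 : 0 ≤ η) (hη : η < 1) {T A X s : ℝ}
    (hX : 0 ≤ X) (hs : 0 ≤ s)
    (hT : 31 / 64 * δ * T ≤ 2 * γ ^ 2 / δ * (4 * L * X + 2 * A))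
    (hA : 3 / 4 * α * A ≤ s + 2 * L * α * X) :
    3 * L * T ≤ 1 / 4 * X + 96 * L * γ ^ 2 / (δ ^ 2 * α * (1 - η)) * s := by
  have hA' : A ≤ 4 / (3 * α) * s + 8 / 3 * L * X := by
    have h1 : (3 / 4 * α) * A ≤ (3 / 4 * α) * (4 / (3 * α) * s + 8 / 3 * L * X) := by
      refine hA.trans (le_of_eq ?_); field_simp; ring
    exact le_of_mul_le_mul_left h1 (by positivity)
  have hT' : T ≤ 128 / 31 * γ ^ 2 / δ ^ 2 * (4 * L * X + 2 * A) := by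
    have h1 : (31 / 64 * δ) * T
        ≤ (31 / 64 * δ) * (128 / 31 * γ ^ 2 / δ ^ 2 * (4 * L * X + 2 * A)) := by
      refine hT.trans (le_of_eq ?_); field_simp; ring
    exact le_of_mul_le_mul_left h1 (by positivity)
  have hF : 96 * L * γ ^ 2 / (δ ^ 2 * α) ≤ 96 * L * γ ^ 2 / (δ ^ 2 * α * (1 - η)) := by
    refine div_le_div_of_nonneg_left (by positivity) ?_ ?_
    · have : 0 < 1 - η := by linarith
      positivity
    · have : 0 < δ ^ 2 * α := by positivity
      nlinarith
  have hF' := mul_le_mul_of_nonneg_right hF hs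
  have h2 : 4 * L * X + 2 * A ≤ 28 / 3 * L * X + 8 / (3 * α) * s := by
    have : 8 / (3 * α) * s = 2 * (4 / (3 * α) * s) := by ring
    linarith
  have h3 : 3 * L * T ≤ 3 * L * (128 / 31 * γ ^ 2 / δ ^ 2
      * (28 / 3 * L * X + 8 / (3 * α) * s)) := by
    refine mul_le_mul_of_nonneg_left (hT'.trans ?_) (by positivity)
    exact mul_le_mul_of_nonneg_left h2 (by positivity)
  -- There is slack in both constants: `3584/(31 · 1152) ≈ 0.10` is below `1/4`, and `1024/31 ≈ 33`
  -- is below `96`.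
  have e : 3 * L * (128 / 31 * γ ^ 2 / δ ^ 2 * (28 / 3 * L * X + 8 / (3 * α) * s))
      = 3584 / 31 * ((L * γ) ^ 2 / δ ^ 2) * X
        + 1024 / 31 * (L * γ ^ 2 / (δ ^ 2 * α)) * s := by
    field_simp; ring
  have h4 : (L * γ) ^ 2 / δ ^ 2 ≤ 1 / 1152 := by
    rw [div_le_div_iff₀ (by positivity) (by norm_num)]; linarith
  have h5 := mul_le_mul_of_nonneg_right h4 hX
  have h6 : 0 ≤ L * γ ^ 2 / (δ ^ 2 * α) * s := by positivity
  have e2 : 96 * L * γ ^ 2 / (δ ^ 2 * α) * s = 96 * (L * γ ^ 2 / (δ ^ 2 * α) * s) := by ring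
  nlinarith

end Stepsize

section Algebra

variable {V : Type*} [NormedAddCommGroup V] [InnerProductSpace ℝ V]

/-- Young's inequality with parameter `δ/2` spends half of the contraction: `(1 - δ)(1 + δ/2) ≤ 1 -
δ/2` and `(1 - δ)(1 + 2/δ) ≤ 2/δ`. -/
theorem contraction_young {δ : ℝ} (hδ : 0 < δ) (hδ1 : δ ≤ 1) (u v : V) :
    (1 - δ) * ‖u + v‖ ^ 2 ≤ (1 - δ / 2) * ‖u‖ ^ 2 + 2 / δ * ‖v‖ ^ 2 := by
  have h1 : ‖u + v‖ ^ 2 ≤ (1 + δ / 2) * ‖u‖ ^ 2 + (1 + 2 / δ) * ‖v‖ ^ 2 := by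
    have h2 : 0 ≤ ‖(δ / 2) • u - v‖ ^ 2 := sq_nonneg _
    rw [norm_sub_sq_real, norm_smul, real_inner_smul_left, Real.norm_of_nonneg (by positivity)]
      at h2
    rw [norm_add_sq_real]
    have h3 : 2 / δ * (2 * (δ / 2 * inner ℝ u v))
        ≤ 2 / δ * ((δ / 2 * ‖u‖) ^ 2 + ‖v‖ ^ 2) :=
      mul_le_mul_of_nonneg_left (by linarith) (by positivity)
    have e1 : 2 / δ * (2 * (δ / 2 * inner ℝ u v)) = 2 * inner ℝ u v := by field_simp
    have e2 : 2 / δ * ((δ / 2 * ‖u‖) ^ 2 + ‖v‖ ^ 2) = δ / 2 * ‖u‖ ^ 2 + 2 / δ * ‖v‖ ^ 2 := by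
      field_simp
    linarith
  have h4 := mul_le_mul_of_nonneg_left h1 (by linarith : 0 ≤ 1 - δ)
  have e : (1 - δ) * ((1 + δ / 2) * ‖u‖ ^ 2 + (1 + 2 / δ) * ‖v‖ ^ 2)
      = (1 - δ / 2 - δ ^ 2 / 2) * ‖u‖ ^ 2 + (2 / δ - 1 - δ) * ‖v‖ ^ 2 := by field_simp; ring
  nlinarith [sq_nonneg ‖u‖, sq_nonneg ‖v‖, mul_nonneg (sq_nonneg δ) (sq_nonneg ‖u‖),
    mul_nonneg hδ.le (sq_nonneg ‖v‖)]

end Algebra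

/-! ### Recursions in expectation for shifts and errors. -/

section ErrorBound

variable {n d : ℕ} {Ω SC SQ : Type*} [m0 : MeasurableSpace Ω] [MeasurableSpace SC]
  [MeasurableSpace SQ] {P : Measure Ω} [IsProbabilityMeasure P]
  {νC : Measure SC} [IsProbabilityMeasure νC] {νQ : Measure SQ} [IsProbabilityMeasure νQ]
  {fi : Fin n → E d → ℝ} {f : E d → ℝ} {xs : E d} {L μ δ ω : ℝ} {I : Input n d Ω SC SQ}
  {Dti : Fin n → ℝ}

theorem integrable_gap (hL : 0 < L) (hs : IsLSmooth f L) (hq : IsQuasiStronglyConvex f xs μ)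
    {x : Ω → E d} (hx : MemLp x 2 P) : Integrable (fun w => f (x w) - f xs) P := by
  refine ((integrable_sq_norm (hx.sub (memLp_const xs))).const_mul L).mono'
    ((hs.1.continuous.comp_aestronglyMeasurable hx.1).sub aestronglyMeasurable_const)
    (ae_of_all _ fun w => ?_)
  rw [Real.norm_of_nonneg (sub_nonneg.2 (hq.1 _))]
  exact gap_le hL hs hq (x w)

theorem Sampling.integral_sigmaSq_succ_le (hn : 0 < n) (hL : 0 < L)
    (hf : f = fun x => avg (fun i => fi i x)) (hcv : ∀ i, ConvexOn ℝ Set.univ (fi i))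
    (hq : IsQuasiStronglyConvex f xs μ) (hI : Sampling P νC νQ fi Dti I)
    (hs : ∀ i, IsLSmooth (fi i) L)
    (hC : IsCompressor νC I.C δ) (hQ : IsQuantizer νQ I.Q ω) (hα0 : 0 < I.α)
    (hα : I.α * (ω + 1) ≤ 1) (k : ℕ) :
    ∫ w, I.sigmaSq fi xs (k + 1) w ∂P ≤ (1 - I.α) * ∫ w, I.sigmaSq fi xs k w ∂P
      + 2 * (L * I.α) * ∫ w, (f (I.x k w) - f xs) ∂P + I.α ^ 2 * (ω + 1) * avg Dti := by
  have hfs : IsLSmooth f L := hf ▸ IsLSmooth.avg hn hs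
  have i1 := (hI.integrable_sigmaSq hs hC hQ xs k).const_mul (1 - I.α)
  have i2 := (integrable_gap hL hfs hq (hI.memLp_state hs hC hQ k).1).const_mul (2 * (L * I.α))
  have i12 : Integrable (fun w => (1 - I.α) * I.sigmaSq fi xs k w
      + 2 * (L * I.α) * (f (I.x k w) - f xs)) P := i1.add i2
  have h := integral_le_of_condExp_le (hI.history_le k) (i12.add (integrable_const _))
    (hI.condExp_sigmaSq_succ_le hL hf hcv hq hs hC hQ hα0 hα k)
  rw [integral_add' i12 (integrable_const _), integral_add i1 i2, integral_const_mul,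
    integral_const_mul] at h
  simpa using h

/-- The centred noise is split off orthogonally before Young's inequality is applied, so it enters
with coefficient `γ²` and avoids the factor `2/δ` paid by the conditional mean. -/
theorem Sampling.integral_sq_norm_e_succ_le (hI : Sampling P νC νQ fi Dti I)
    (hs : ∀ i, IsLSmooth (fi i) L)
    (hC : IsCompressor νC I.C δ) (hQ : IsQuantizer νQ I.Q ω) (k : ℕ) (i : Fin n) :
    ∫ w, ‖I.e (k + 1) i w‖ ^ 2 ∂P ≤ (1 - δ / 2) * ∫ w, ‖I.e k i w‖ ^ 2 ∂P
      + 2 / δ * I.γ ^ 2 * ∫ w, ‖I.gbar fi k i w‖ ^ 2 ∂P + I.γ ^ 2 * Dti i := by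
  obtain ⟨hx, he, hh⟩ := hI.memLp_state hs hC hQ k
  obtain ⟨mx, me, mh⟩ := I.measurable_state hC.measurable hQ.measurable k
  have hδ0 := hC.delta_pos
  have hδ1 := hC.delta_le_one
  have hle := I.history_le_historyGrad k
  have hb := hI.memLp_gbar hs hC hQ k i
  have mb := I.measurable_gbar (fi := fi) hs hC.measurable hQ.measurable k i
  have mg : Measurable[I.historyGrad k] (I.g k i) :=
    ((I.measurable_ghat_historyGrad k i).sub ((mh i).mono hle le_rfl)).add
      ((measurable_avg mh).mono hle le_rfl)
  have hg := hI.memLp_g hs hC hQ k i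
  have h1 := (hC.freeze (hI.historyGrad_le k) (hI.measurable_xi k i) (hI.law_xi k i)
    (hI.indep_xi k i) (y := fun w => I.e k i w + I.γ • I.g k i w)
    (Measurable.add ((me i).mono hle le_rfl) (mg.const_smul I.γ))
    ((he i).add (hg.const_smul I.γ))).2
  have e1 : (fun w => ‖I.e k i w + I.γ • I.g k i w‖ ^ 2) = fun w =>
      ‖(I.e k i w + I.γ • I.gbar fi k i w) + (I.γ • I.noise fi k i) w‖ ^ 2 := by
    funext w
    rw [I.g_eq_gbar_add_noise fi, smul_add, ← add_assoc, Pi.smul_apply]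
  have h0 : P[I.γ • I.noise fi k i | I.history k] =ᵐ[P] 0 := by
    filter_upwards [condExp_smul I.γ (I.noise fi k i) (I.history k) (μ := P),
      hI.condExp_noise hs hC hQ k i] with w a b
    rw [a, Pi.smul_apply]
    exact (congrArg (I.γ • ·) b).trans (smul_zero _)
  have u2 : MemLp (fun w => I.e k i w + I.γ • I.gbar fi k i w) 2 P :=
    (he i).add (hb.const_smul I.γ)
  have h2 := integral_sq_norm_add (hI.history_le k)
    (Measurable.add (me i) (mb.const_smul I.γ)).stronglyMeasurable u2
    ((hI.memLp_noise k i).const_smul I.γ) h0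
  have h3 : ∫ w, ‖(I.γ • I.noise fi k i) w‖ ^ 2 ∂P ≤ I.γ ^ 2 * Dti i := by
    simp only [Pi.smul_apply, norm_smul, mul_pow, Real.norm_eq_abs, sq_abs]
    rw [integral_const_mul]
    exact mul_le_mul_of_nonneg_left (hI.integral_sq_noise_le k i) (sq_nonneg _)
  have h4 : (1 - δ) * ∫ w, ‖I.e k i w + I.γ • I.gbar fi k i w‖ ^ 2 ∂P
      ≤ (1 - δ / 2) * ∫ w, ‖I.e k i w‖ ^ 2 ∂P
        + 2 / δ * I.γ ^ 2 * ∫ w, ‖I.gbar fi k i w‖ ^ 2 ∂P := by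
    have i1 := (integrable_sq_norm (he i)).const_mul (1 - δ / 2)
    have i2 := (integrable_sq_norm hb).const_mul (2 / δ * I.γ ^ 2)
    rw [← integral_const_mul, ← integral_const_mul, ← integral_const_mul, ← integral_add i1 i2]
    refine integral_mono ((integrable_sq_norm u2).const_mul _) (i1.add i2) fun w => ?_
    have := contraction_young hδ0 hδ1 (I.e k i w) (I.γ • I.gbar fi k i w)
    rw [norm_smul, mul_pow, Real.norm_eq_abs, sq_abs, ← mul_assoc] at this
    exact this
  have h5 : 0 ≤ ∫ w, ‖(I.γ • I.noise fi k i) w‖ ^ 2 ∂P := integral_nonneg fun w => sq_nonneg _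
  have h6 : (1 - δ) * ∫ w, ‖I.e k i w + I.γ • I.g k i w‖ ^ 2 ∂P
      = (1 - δ) * ∫ w, ‖I.e k i w + I.γ • I.gbar fi k i w‖ ^ 2 ∂P
        + (1 - δ) * ∫ w, ‖(I.γ • I.noise fi k i) w‖ ^ 2 ∂P := by
    rw [e1, ← mul_add]
    exact congrArg _ h2
  have h7 : (1 - δ) * ∫ w, ‖(I.γ • I.noise fi k i) w‖ ^ 2 ∂P
      ≤ ∫ w, ‖(I.γ • I.noise fi k i) w‖ ^ 2 ∂P := by nlinarith
  have h8 : ∫ w, ‖I.e (k + 1) i w‖ ^ 2 ∂P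
      ≤ (1 - δ) * ∫ w, ‖I.e k i w + I.γ • I.g k i w‖ ^ 2 ∂P := h1
  linarith

theorem Sampling.avg_integral_sq_norm_e_succ_le (hn : 0 < n) (hL : 0 < L)
    (hf : f = fun x => avg (fun i => fi i x)) (hcv : ∀ i, ConvexOn ℝ Set.univ (fi i))
    (hq : IsQuasiStronglyConvex f xs μ) (hI : Sampling P νC νQ fi Dti I)
    (hs : ∀ i, IsLSmooth (fi i) L)
    (hC : IsCompressor νC I.C δ) (hQ : IsQuantizer νQ I.Q ω) (k : ℕ) :
    avg (fun i => ∫ w, ‖I.e (k + 1) i w‖ ^ 2 ∂P)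
      ≤ (1 - δ / 2) * avg (fun i => ∫ w, ‖I.e k i w‖ ^ 2 ∂P)
        + 2 / δ * I.γ ^ 2 * (4 * L * ∫ w, (f (I.x k w) - f xs) ∂P
          + 2 * ∫ w, I.sigmaSq fi xs k w ∂P) + I.γ ^ 2 * avg Dti := by
  have hδ0 := hC.delta_pos
  have hfs : IsLSmooth f L := hf ▸ IsLSmooth.avg hn hs
  have h1 := avg_le_avg fun i => hI.integral_sq_norm_e_succ_le hs hC hQ k i
  rw [avg_add, avg_add, avg_const_mul, avg_const_mul, avg_const_mul] at h1
  have ig : ∀ i, Integrable (fun w => ‖I.gbar fi k i w‖ ^ 2) P := fun i =>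
    integrable_sq_norm (hI.memLp_gbar hs hC hQ k i)
  have i1 := (integrable_gap hL hfs hq (hI.memLp_state hs hC hQ k).1).const_mul (4 * L)
  have i2 := (hI.integrable_sigmaSq hs hC hQ xs k).const_mul 2
  have h2 : avg (fun i => ∫ w, ‖I.gbar fi k i w‖ ^ 2 ∂P)
      ≤ 4 * L * ∫ w, (f (I.x k w) - f xs) ∂P + 2 * ∫ w, I.sigmaSq fi xs k w ∂P := by
    rw [← integral_avg ig, ← integral_const_mul, ← integral_const_mul, ← integral_add i1 i2]
    refine integral_mono (integrable_avg ig) (i1.add i2) fun w => ?_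
    exact avg_sq_norm_shifted_gradient_le hn hL hf hs hcv hq (I.x k w) fun i => I.h k i w
  have h3 := mul_le_mul_of_nonneg_left h2 (by positivity : 0 ≤ 2 / δ * I.γ ^ 2)
  linarith

end ErrorBound

/-! ### Telescoping and Jensen's inequality. -/

section Averaging

variable {d : ℕ} {Ω : Type*} {f : E d → ℝ} {η : ℝ}

theorem weighted_telescope {r b : ℕ → ℝ} (hη : η < 1)
    (hrec : ∀ k, r (k + 1) ≤ (1 - η) * r k + b k) (K : ℕ) :
    weight η K * r (K + 1) ≤ r 0 + ∑ k ∈ Finset.range (K + 1), weight η k * b k := by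
  induction K with
  | zero =>
    have h1 := mul_le_mul_of_nonneg_left (hrec 0) (weight_pos hη 0).le
    have e := weight_zero_mul hη
    have e2 : weight η 0 * ((1 - η) * r 0 + b 0) = r 0 + weight η 0 * b 0 := by
      linear_combination r 0 * e
    simpa using h1.trans_eq e2
  | succ K ih =>
    have h1 := mul_le_mul_of_nonneg_left (hrec (K + 1)) (weight_pos hη (K + 1)).le
    have e := weight_succ_mul hη K
    have e2 : weight η (K + 1) * ((1 - η) * r (K + 1) + b (K + 1))
        = weight η K * r (K + 1) + weight η (K + 1) * b (K + 1) := by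
      linear_combination r (K + 1) * e
    rw [Finset.sum_range_succ]
    linarith

theorem gap_wavg_le (hη : η < 1) (hfc : ConvexOn ℝ Set.univ f) (x : ℕ → Ω → E d) (xs : E d)
    (K : ℕ) (w : Ω) :
    f (wavg η x K w) - f xs
      ≤ (weightSum η K)⁻¹ * ∑ k ∈ Finset.range (K + 1), weight η k * (f (x k w) - f xs) := by
  have hW := weightSum_pos hη K
  have h1 : ∑ k ∈ Finset.range (K + 1), (weightSum η K)⁻¹ * weight η k = 1 := by
    rw [← Finset.mul_sum]
    exact inv_mul_cancel₀ hW.ne'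
  have h2 := hfc.map_sum_le (t := Finset.range (K + 1))
    (w := fun k => (weightSum η K)⁻¹ * weight η k) (p := fun k => x k w)
    (fun k _ => mul_nonneg (inv_pos.2 hW).le (weight_pos hη k).le) h1 (fun _ _ => Set.mem_univ _)
  have e1 : wavg η x K w
      = ∑ k ∈ Finset.range (K + 1), ((weightSum η K)⁻¹ * weight η k) • x k w := by
    rw [wavg, Finset.smul_sum]
    exact Finset.sum_congr rfl fun k _ => (mul_smul _ _ _).symm
  have e2 : (weightSum η K)⁻¹ * ∑ k ∈ Finset.range (K + 1), weight η k * (f (x k w) - f xs)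
      = ∑ k ∈ Finset.range (K + 1), ((weightSum η K)⁻¹ * weight η k) • f (x k w) - f xs := by
    rw [Finset.mul_sum]
    calc ∑ k ∈ Finset.range (K + 1), (weightSum η K)⁻¹ * (weight η k * (f (x k w) - f xs))
        = ∑ k ∈ Finset.range (K + 1), (((weightSum η K)⁻¹ * weight η k) • f (x k w)
          - (weightSum η K)⁻¹ * weight η k * f xs) :=
          Finset.sum_congr rfl fun k _ => by rw [smul_eq_mul]; ring
      _ = _ := by rw [Finset.sum_sub_distrib, ← Finset.sum_mul, h1, one_mul]
  rw [e1, e2]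
  linarith

variable [MeasurableSpace Ω] {P : Measure Ω}

theorem integral_gap_nonneg {xs : E d} {μ : ℝ} (hq : IsQuasiStronglyConvex f xs μ)
    (x : Ω → E d) :
    0 ≤ ∫ w, (f (x w) - f xs) ∂P :=
  integral_nonneg fun w => sub_nonneg.2 (hq.1 (x w))

theorem memLp_wavg {x : ℕ → Ω → E d} (hx : ∀ k, MemLp (x k) 2 P) (K : ℕ) :
    MemLp (wavg η x K) 2 P :=
  (memLp_finsetSum _ fun k _ => (hx k).const_smul (weight η k)).const_smul (weightSum η K)⁻¹

end Averaging

/-! ### Accumulated errors and the descent of the perturbed iterate. -/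

section Convergence

variable {n d : ℕ} {Ω SC SQ : Type*} [m0 : MeasurableSpace Ω] [MeasurableSpace SC]
  [MeasurableSpace SQ] {P : Measure Ω} [IsProbabilityMeasure P]
  {νC : Measure SC} [IsProbabilityMeasure νC] {νQ : Measure SQ} [IsProbabilityMeasure νQ]
  {fi : Fin n → E d → ℝ} {f : E d → ℝ} {xs : E d} {L μ δ ω η : ℝ} {I : Input n d Ω SC SQ}
  {Dti : Fin n → ℝ}

theorem Sampling.error_sum_le [Nonempty (Fin d)] (hn : 0 < n) (hL : 0 < L)
    (hf : f = fun x => avg (fun i => fi i x)) (hcv : ∀ i, ConvexOn ℝ Set.univ (fi i))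
    (hq : IsQuasiStronglyConvex f xs μ) (hI : Sampling P νC νQ fi Dti I)
    (hs : ∀ i, IsLSmooth (fi i) L)
    (hC : IsCompressor νC I.C δ) (hQ : IsQuantizer νQ I.Q ω) (hγ0 : 0 < I.γ) (hα0 : 0 < I.α)
    (hα : I.α * (ω + 1) ≤ 1) (hγ : I.γ ≤ maxStep L δ I.α) (hη0 : 0 ≤ η)
    (hημ : η ≤ I.γ * μ / 2) (hηα : η ≤ I.α / 4) (K : ℕ) :
    3 * L * ∑ k ∈ Finset.range (K + 1), weight η k * ∫ w, ‖avg (fun i => I.e k i w)‖ ^ 2 ∂P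
      ≤ 1 / 4 * ∑ k ∈ Finset.range (K + 1), weight η k * ∫ w, (f (I.x k w) - f xs) ∂P
        + 96 * L * I.γ ^ 2 / (δ ^ 2 * I.α * (1 - η)) * ∫ w, I.sigmaSq fi xs 0 w ∂P
        + I.γ * (6 * L * I.γ / δ * (4 * I.α * (ω + 1) / δ + 1) * avg Dti) * weightSum η K := by
  have hfs : IsLSmooth f L := hf ▸ IsLSmooth.avg hn hs
  have hfc : ConvexOn ℝ Set.univ f := hf ▸ convexOn_avg hcv
  have hδ0 := hC.delta_pos
  have hδ1 := hC.delta_le_one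
  have hω := hQ.omega_nonneg
  have hα1 : I.α ≤ 1 := by nlinarith
  have hη1 : η < 1 := by linarith
  have hD : 0 ≤ avg Dti := avg_nonneg hI.variance_nonneg
  have hγ2 := sq_le_of_le_maxStep hL hα0 hα1 hγ0 hγ
  have hηδ : η ≤ δ / 64 := rate_le hδ0 hγ0 (le_smoothness hL hfs hfc hq) hγ2 hημ
  set Δ : ℕ → ℝ := fun k => ∫ w, (f (I.x k w) - f xs) ∂P with hΔ
  set s : ℕ → ℝ := fun k => ∫ w, I.sigmaSq fi xs k w ∂P with hsdef
  set S : ℕ → ℝ := fun k => avg (fun i => ∫ w, ‖I.e k i w‖ ^ 2 ∂P) with hS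
  have Δ0 : ∀ k, 0 ≤ Δ k := fun k => integral_gap_nonneg hq (I.x k)
  have s0 : ∀ k, 0 ≤ s k := fun k => integral_nonneg (I.sigmaSq_nonneg fi xs k)
  have S0 : S 0 = 0 := by simp [hS, Input.e_zero, avg]
  -- Here `c` is the stationary noise level of the shifts: `α c` equals `D₂`.
  obtain ⟨a, a0, sa, ha⟩ := exists_majorant (η := η) (q := 1 - I.α)
    (c := I.α * (ω + 1) * avg Dti) (s := s) (b := fun k => 2 * L * I.α * Δ k) hη1 (by linarith)
    (by positivity) (fun k => mul_nonneg (by positivity) (Δ0 k)) (s0 0) (fun k => by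
      have := hI.integral_sigmaSq_succ_le hn hL hf hcv hq hs hC hQ hα0 hα k
      simp only [hsdef, hΔ]
      linarith)
  -- The errors are driven by the majorant `a`; the stationary level of the shifts joins the noise
  -- in the new `c`, and `3Lc = γD₃`.
  obtain ⟨t, t0, St, ht⟩ := exists_majorant (η := η) (q := 1 - δ / 2)
    (c := 2 / δ * I.γ ^ 2 * (4 * (I.α * (ω + 1)) / δ + 1) * avg Dti) (s := S)
    (b := fun k => 2 * I.γ ^ 2 / δ * (4 * L * Δ k + 2 * a k)) hη1 (by linarith)
    (by positivity)
    (fun k => mul_nonneg (by positivity)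
      (add_nonneg (mul_nonneg (by positivity) (Δ0 k)) (mul_nonneg zero_le_two (a0 k))))
    S0.ge (fun k => by
      have h1 := hI.avg_integral_sq_norm_e_succ_le hn hL hf hcv hq hs hC hQ k
      have h2 : 2 / δ * I.γ ^ 2 * (4 * L * Δ k + 2 * s k)
          ≤ 2 / δ * I.γ ^ 2 * (4 * L * Δ k + 2 * (a k + I.α * (ω + 1) * avg Dti)) :=
        mul_le_mul_of_nonneg_left (by linarith [sa k]) (by positivity)
      have e : (1 - δ / 2) * S k + 2 * I.γ ^ 2 / δ * (4 * L * Δ k + 2 * a k)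
          + (1 - (1 - δ / 2)) * (2 / δ * I.γ ^ 2 * (4 * (I.α * (ω + 1)) / δ + 1) * avg Dti)
          = (1 - δ / 2) * S k
            + 2 / δ * I.γ ^ 2 * (4 * L * Δ k + 2 * (a k + I.α * (ω + 1) * avg Dti))
            + I.γ ^ 2 * avg Dti := by field_simp; ring
      rw [e]
      simp only [hS, hΔ, hsdef] at h1 h2 ⊢
      linarith)
  set X := ∑ k ∈ Finset.range (K + 1), weight η k * Δ k with hX
  set A := ∑ k ∈ Finset.range (K + 1), weight η k * a k with hA
  set T := ∑ k ∈ Finset.range (K + 1), weight η k * t k with hT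
  have w0 : ∀ k, 0 ≤ weight η k := fun k => (weight_pos hη1 k).le
  have X0 : 0 ≤ X := Finset.sum_nonneg fun k _ => mul_nonneg (w0 k) (Δ0 k)
  have A0 : 0 ≤ A := Finset.sum_nonneg fun k _ => mul_nonneg (w0 k) (a0 k)
  have T0 : 0 ≤ T := Finset.sum_nonneg fun k _ => mul_nonneg (w0 k) (t0 k)
  have hA' : 3 / 4 * I.α * A ≤ s 0 + 2 * L * I.α * X := by
    have h1 := ha K
    have e : ∑ k ∈ Finset.range (K + 1), weight η k * (2 * L * I.α * Δ k)
        = 2 * L * I.α * X := by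
      rw [hX, Finset.mul_sum]; exact Finset.sum_congr rfl fun k _ => by ring
    rw [e] at h1
    have : 3 / 4 * I.α * A ≤ (1 - η - (1 - I.α)) * A :=
      mul_le_mul_of_nonneg_right (by linarith) A0
    linarith
  have hT' : 31 / 64 * δ * T ≤ 2 * I.γ ^ 2 / δ * (4 * L * X + 2 * A) := by
    have h1 := ht K
    have e : ∑ k ∈ Finset.range (K + 1),
        weight η k * (2 * I.γ ^ 2 / δ * (4 * L * Δ k + 2 * a k))
        = 2 * I.γ ^ 2 / δ * (4 * L * X + 2 * A) := by
      rw [hX, hA, Finset.mul_sum, Finset.mul_sum, ← Finset.sum_add_distrib, Finset.mul_sum]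
      exact Finset.sum_congr rfl fun k _ => by ring
    rw [e, S0] at h1
    -- From `η ≤ δ/64`: `δ/2 - δ/64 = 31δ/64`.
    have : 31 / 64 * δ * T ≤ (1 - η - (1 - δ / 2)) * T :=
      mul_le_mul_of_nonneg_right (by linarith) T0
    linarith
  have key := error_sum_arith hL hδ0 hα0 hγ0 hγ2 hη0 hη1 X0 (s0 0) hT' hA'
  have he : ∀ k, ∫ w, ‖avg (fun i => I.e k i w)‖ ^ 2 ∂P
      ≤ t k + 2 / δ * I.γ ^ 2 * (4 * (I.α * (ω + 1)) / δ + 1) * avg Dti := by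
    intro k
    have h2 := (hI.memLp_state hs hC hQ k).2.1
    refine le_trans ?_ (St k)
    simp only [hS]
    rw [← integral_avg fun i => integrable_sq_norm (h2 i)]
    exact integral_mono (integrable_sq_norm (memLp_avg h2))
      (integrable_avg fun i => integrable_sq_norm (h2 i)) fun w => sq_norm_avg_le hn _
  have hsum : ∑ k ∈ Finset.range (K + 1), weight η k * ∫ w, ‖avg (fun i => I.e k i w)‖ ^ 2 ∂P
      ≤ T + weightSum η K
        * (2 / δ * I.γ ^ 2 * (4 * (I.α * (ω + 1)) / δ + 1) * avg Dti) := by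
    rw [hT, weightSum, Finset.sum_mul, ← Finset.sum_add_distrib]
    refine Finset.sum_le_sum fun k _ => ?_
    rw [← mul_add]
    exact mul_le_mul_of_nonneg_left (he k) (w0 k)
  have h3 := mul_le_mul_of_nonneg_left hsum (by positivity : 0 ≤ 3 * L)
  have e : 3 * L * (T + weightSum η K
        * (2 / δ * I.γ ^ 2 * (4 * (I.α * (ω + 1)) / δ + 1) * avg Dti))
      = 3 * L * T + I.γ * (6 * L * I.γ / δ * (4 * I.α * (ω + 1) / δ + 1) * avg Dti)
        * weightSum η K := by ring
  linarith

theorem Sampling.errorBound (hn : 0 < n) (hL : 0 < L)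
    (hf : f = fun x => avg (fun i => fi i x)) (hcv : ∀ i, ConvexOn ℝ Set.univ (fi i))
    (hq : IsQuasiStronglyConvex f xs μ) (hI : Sampling P νC νQ fi Dti I)
    (hs : ∀ i, IsLSmooth (fi i) L)
    (hC : IsCompressor νC I.C δ) (hQ : IsQuantizer νQ I.Q ω) (hγ0 : 0 < I.γ) (hα0 : 0 < I.α)
    (hα : I.α * (ω + 1) ≤ 1) (hγ : I.γ ≤ maxStep L δ I.α) (hη0 : 0 ≤ η)
    (hημ : η ≤ I.γ * μ / 2) (hηα : η ≤ I.α / 4) :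
    ErrorBound P f xs I.x I.e (I.sigmaSq fi xs) (fun _ _ => 0) L I.γ η
      (96 * L * I.γ ^ 2 / (δ ^ 2 * I.α * (1 - η))) 0
      (6 * L * I.γ / δ * (4 * I.α * (ω + 1) / δ + 1) * avg Dti) := by
  have hfs : IsLSmooth f L := hf ▸ IsLSmooth.avg hn hs
  have hδ0 := hC.delta_pos
  have hω := hQ.omega_nonneg
  have hα1 : I.α ≤ 1 := by nlinarith
  have hη1 : 0 < 1 - η := by linarith
  have hD : 0 ≤ avg Dti := avg_nonneg hI.variance_nonneg
  have hF : 0 ≤ 96 * L * I.γ ^ 2 / (δ ^ 2 * I.α * (1 - η)) := by positivity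
  have hD3 : 0 ≤ 6 * L * I.γ / δ * (4 * I.α * (ω + 1) / δ + 1) * avg Dti := by positivity
  refine ⟨⟨hF, le_rfl, hD3⟩, fun k => (hI.memLp_state hs hC hQ k).2.1,
    fun k => integrable_gap hL hfs hq (hI.memLp_state hs hC hQ k).1, fun K => ?_⟩
  rw [zero_mul, add_zero]
  -- In dimension zero `μ ≤ L` may fail, but the errors vanish.
  rcases isEmpty_or_nonempty (Fin d) with hd | hd
  · have e0 : ∀ k, ∫ w, ‖avg (fun i => I.e k i w)‖ ^ 2 ∂P = 0 := fun k => by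
      have : ∀ w, avg (fun i => I.e k i w) = 0 := fun w => Subsingleton.elim _ _
      simp [this]
    simp only [e0, mul_zero, Finset.sum_const_zero]
    have h1 : 0 ≤ ∑ k ∈ Finset.range (K + 1), weight η k * ∫ w, (f (I.x k w) - f xs) ∂P :=
      Finset.sum_nonneg fun k _ => mul_nonneg (weight_pos (by linarith) k).le
        (integral_gap_nonneg hq (I.x k))
    have h2 := mul_nonneg hF (integral_nonneg (μ := P) (I.sigmaSq_nonneg fi xs 0))
    have h3 := mul_nonneg (mul_nonneg hγ0.le hD3) (weightSum_pos (η := η) (by linarith) K).le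
    linarith
  · exact hI.error_sum_le hn hL hf hcv hq hs hC hQ hγ0 hα0 hα hγ hη0 hημ hηα K

/-- One gradient step from the perturbed point `x - e`, with the gradient taken at `x`. -/
theorem perturbed_step_le (hL : 0 < L) (hfs : IsLSmooth f L) (hfc : ConvexOn ℝ Set.univ f)
    (hq : IsQuasiStronglyConvex f xs μ) (hμ : 0 ≤ μ) {γ : ℝ} (hγ0 : 0 < γ)
    (hγ : 4 * L * γ ≤ 1) (x e : E d) :
    ‖x - e - xs - γ • gradient f x‖ ^ 2 ≤ (1 - γ * μ / 2) * ‖x - e - xs‖ ^ 2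
      - γ / 2 * (f x - f xs) + 3 * L * γ * ‖e‖ ^ 2 := by
  set G := gradient f x with hG
  set Δ := f x - f xs with hΔ
  have hΔ0 : 0 ≤ Δ := sub_nonneg.2 (hq.1 x)
  have h1 := norm_sub_sq_real (x - e - xs) (γ • G)
  rw [norm_smul, real_inner_smul_right, mul_pow, Real.norm_eq_abs, sq_abs] at h1
  have e1 : x - e - xs = (x - xs) - e := by abel
  have h2 : inner ℝ (x - e - xs) G = inner ℝ (x - xs) G - inner ℝ e G := by
    rw [e1, inner_sub_left]
  have h3 : Δ + μ / 2 * ‖x - xs‖ ^ 2 ≤ inner ℝ (x - xs) G := by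
    have := hq.2 x
    rw [← neg_sub x xs, inner_neg_right, real_inner_comm] at this
    linarith
  have h4 : ‖G‖ ^ 2 ≤ 2 * L * Δ := sq_norm_gradient_le hL hfs hfc hq x
  -- Young's inequality with parameter `2L`, chosen so that `‖G‖²/(2L) ≤ Δ`. Of the gain `2γΔ` this
  -- uses `γΔ` and `γ²‖G‖²` uses `γΔ/2`.
  have h5 : 2 * inner ℝ e G ≤ 2 * L * ‖e‖ ^ 2 + Δ := by
    have h6 : 0 ≤ ‖(2 * L) • e - G‖ ^ 2 := sq_nonneg _
    rw [norm_sub_sq_real, norm_smul, real_inner_smul_left, Real.norm_of_nonneg (by positivity),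
      mul_pow] at h6
    have h7 : 2 * L * (2 * inner ℝ e G) ≤ 2 * L * (2 * L * ‖e‖ ^ 2 + Δ) := by linarith
    exact le_of_mul_le_mul_left h7 (by positivity)
  -- This moves the strong convexity term from `x` to the perturbed point, halving its constant. The
  -- cost `γμ‖e‖² ≤ γL‖e‖²` raises the penalty from `2Lγ` to `3Lγ`.
  have h8 : ‖x - e - xs‖ ^ 2 ≤ 2 * ‖x - xs‖ ^ 2 + 2 * ‖e‖ ^ 2 := by
    have := sq_norm_add_le_two (x - xs) (-e)
    rwa [norm_neg, ← sub_eq_add_neg, ← e1] at this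
  have h9 := mul_sq_norm_le hL hfs hfc hq e
  have g1 := mul_le_mul_of_nonneg_left h3 (by positivity : 0 ≤ 2 * γ)
  have g2 := mul_le_mul_of_nonneg_left h4 (by positivity : 0 ≤ γ ^ 2)
  have g3 := mul_le_mul_of_nonneg_left h5 hγ0.le
  have g4 := mul_le_mul_of_nonneg_left h8 (by positivity : 0 ≤ γ * μ / 2)
  have g5 := mul_le_mul_of_nonneg_left h9 hγ0.le
  have g6 : γ * Δ * (4 * L * γ) ≤ γ * Δ * 1 := mul_le_mul_of_nonneg_left hγ (by positivity)
  rw [h1, h2]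
  linarith

theorem Sampling.integral_perturbed_succ_le (hn : 0 < n) (hL : 0 < L) (hμ : 0 ≤ μ)
    (hf : f = fun x => avg (fun i => fi i x)) (hcv : ∀ i, ConvexOn ℝ Set.univ (fi i))
    (hq : IsQuasiStronglyConvex f xs μ) (hI : Sampling P νC νQ fi Dti I)
    (hs : ∀ i, IsLSmooth (fi i) L)
    (hC : IsCompressor νC I.C δ) (hQ : IsQuantizer νQ I.Q ω) (hγ0 : 0 < I.γ)
    (hγ : 4 * L * I.γ ≤ 1) (k : ℕ) :
    ∫ w, ‖I.x (k + 1) w - avg (fun i => I.e (k + 1) i w) - xs‖ ^ 2 ∂P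
      ≤ (1 - I.γ * μ / 2) * ∫ w, ‖I.x k w - avg (fun i => I.e k i w) - xs‖ ^ 2 ∂P
        - I.γ / 2 * ∫ w, (f (I.x k w) - f xs) ∂P
        + 3 * L * I.γ * ∫ w, ‖avg (fun i => I.e k i w)‖ ^ 2 ∂P
        + I.γ ^ 2 * (avg Dti / n) := by
  have hfs : IsLSmooth f L := hf ▸ IsLSmooth.avg hn hs
  have hfc : ConvexOn ℝ Set.univ f := hf ▸ convexOn_avg hcv
  obtain ⟨hx, he, hh⟩ := hI.memLp_state hs hC hQ k
  obtain ⟨mx, me, mh⟩ := I.measurable_state hC.measurable hQ.measurable k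
  let N : Ω → E d := fun w => avg (fun i => I.noise fi k i w)
  have hN : MemLp N 2 P := hI.memLp_avg_noise k
  have e1 : (fun w => ‖I.x (k + 1) w - avg (fun i => I.e (k + 1) i w) - xs‖ ^ 2) = fun w =>
      ‖(I.x k w - avg (fun i => I.e k i w) - xs - I.γ • gradient f (I.x k w))
        + (-I.γ • N) w‖ ^ 2 := by
    funext w
    rw [I.perturbed_succ, I.avg_g_eq hn hf hs, Pi.smul_apply, smul_add, neg_smul]
    congr 2
    abel
  have hae : MemLp (fun w => avg (fun i => I.e k i w)) 2 P := memLp_avg he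
  have hy2 : MemLp (fun w => I.x k w - avg (fun i => I.e k i w) - xs) 2 P :=
    (hx.sub hae).sub (memLp_const xs)
  have hu2 : MemLp (fun w => I.x k w - avg (fun i => I.e k i w) - xs
      - I.γ • gradient f (I.x k w)) 2 P :=
    hy2.sub ((memLp_gradient_comp hfs hx).const_smul I.γ)
  have mgr : Measurable[I.history k] fun w => gradient f (I.x k w) :=
    hfs.continuous_gradient.measurable.comp mx
  have mu : Measurable[I.history k] fun w => I.x k w - avg (fun i => I.e k i w) - xs
      - I.γ • gradient f (I.x k w) :=
    ((mx.sub (measurable_avg me)).sub measurable_const).sub (mgr.const_smul I.γ)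
  have h0 : P[-I.γ • N | I.history k] =ᵐ[P] 0 := by
    filter_upwards [condExp_smul (-I.γ) N (I.history k) (μ := P),
      hI.condExp_avg_noise hs hC hQ k] with w a b
    rw [a, Pi.smul_apply]
    exact (congrArg (-I.γ • ·) b).trans (smul_zero _)
  have h1 := integral_sq_norm_add (hI.history_le k) mu.stronglyMeasurable hu2
    (hN.const_smul (-I.γ)) h0
  have h2 : ∫ w, ‖(-I.γ • N) w‖ ^ 2 ∂P ≤ I.γ ^ 2 * (avg Dti / n) := by
    have h3 := integral_le_of_condExp_le (hI.history_le k) (integrable_const (avg Dti / n))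
      (hI.condExp_sq_norm_avg_noise_le hs hC hQ k)
    simp only [Pi.smul_apply, norm_smul, mul_pow, Real.norm_eq_abs, sq_abs, neg_sq]
    rw [integral_const_mul]
    refine mul_le_mul_of_nonneg_left ?_ (sq_nonneg _)
    simpa using h3
  have i1 := (integrable_sq_norm hy2).const_mul (1 - I.γ * μ / 2)
  have i2 := (integrable_gap hL hfs hq hx).const_mul (I.γ / 2)
  have i12 : Integrable (fun w => (1 - I.γ * μ / 2)
      * ‖I.x k w - avg (fun i => I.e k i w) - xs‖ ^ 2 - I.γ / 2 * (f (I.x k w) - f xs)) P :=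
    i1.sub i2
  have i3 := (integrable_sq_norm hae).const_mul (3 * L * I.γ)
  have h3 : ∫ w, ‖I.x k w - avg (fun i => I.e k i w) - xs - I.γ • gradient f (I.x k w)‖ ^ 2 ∂P
      ≤ (1 - I.γ * μ / 2) * ∫ w, ‖I.x k w - avg (fun i => I.e k i w) - xs‖ ^ 2 ∂P
        - I.γ / 2 * ∫ w, (f (I.x k w) - f xs) ∂P
        + 3 * L * I.γ * ∫ w, ‖avg (fun i => I.e k i w)‖ ^ 2 ∂P := by
    rw [← integral_const_mul, ← integral_const_mul, ← integral_const_mul, ← integral_sub i1 i2,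
      ← integral_add i12 i3]
    exact integral_mono (integrable_sq_norm hu2) (i12.add i3) fun w =>
      perturbed_step_le hL hfs hfc hq hμ hγ0 hγ (I.x k w) (avg (fun i => I.e k i w))
  rw [e1]
  exact h1.trans_le (add_le_add h3 h2)

/-- The convergence estimate in terms of the total weight `W_K`. -/
theorem Sampling.integral_gap_wavg_le (hn : 0 < n) (hL : 0 < L) (hμ : 0 ≤ μ)
    (hf : f = fun x => avg (fun i => fi i x)) (hcv : ∀ i, ConvexOn ℝ Set.univ (fi i))
    (hq : IsQuasiStronglyConvex f xs μ) (hI : Sampling P νC νQ fi Dti I)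
    (hs : ∀ i, IsLSmooth (fi i) L)
    (hC : IsCompressor νC I.C δ) (hQ : IsQuantizer νQ I.Q ω) (hγ0 : 0 < I.γ)
    (hγ : 4 * L * I.γ ≤ 1) (hη : η < 1) (hημ : η ≤ I.γ * μ / 2) {F1 D3 : ℝ}
    (hE : ErrorBound P f xs I.x I.e (I.sigmaSq fi xs) (fun _ _ => 0) L I.γ η F1 0 D3) (K : ℕ) :
    ∫ w, (f (wavg η I.x K w) - f xs) ∂P
      ≤ 4 * (‖I.x0 - xs‖ ^ 2
          + I.γ * F1 * avg (fun i => ‖I.h0 i - gradient (fi i) xs‖ ^ 2)) / I.γ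
            * (weightSum η K)⁻¹
        + 4 * I.γ * (avg Dti / n + D3) := by
  have hfs : IsLSmooth f L := hf ▸ IsLSmooth.avg hn hs
  have hfc : ConvexOn ℝ Set.univ f := hf ▸ convexOn_avg hcv
  have hx := fun k => (hI.memLp_state hs hC hQ k).1
  set r : ℕ → ℝ := fun k => ∫ w, ‖I.x k w - avg (fun i => I.e k i w) - xs‖ ^ 2 ∂P with hr
  set Δ : ℕ → ℝ := fun k => ∫ w, (f (I.x k w) - f xs) ∂P with hΔ
  set ε : ℕ → ℝ := fun k => ∫ w, ‖avg (fun i => I.e k i w)‖ ^ 2 ∂P with hε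
  have r0 : ∀ k, 0 ≤ r k := fun k => integral_nonneg fun w => sq_nonneg _
  have hrec : ∀ k, r (k + 1) ≤ (1 - η) * r k
      + (-(I.γ / 2 * Δ k) + 3 * L * I.γ * ε k + I.γ ^ 2 * (avg Dti / n)) := by
    intro k
    have h1 := hI.integral_perturbed_succ_le hn hL hμ hf hcv hq hs hC hQ hγ0 hγ k
    have h2 : (1 - I.γ * μ / 2) * r k ≤ (1 - η) * r k :=
      mul_le_mul_of_nonneg_right (by linarith) (r0 k)
    simp only [hr, hΔ, hε] at h1 h2 ⊢
    linarith
  have h1 := weighted_telescope hη hrec K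
  have h2 : 0 ≤ weight η K * r (K + 1) := mul_nonneg (weight_pos hη K).le (r0 _)
  have hr0 : r 0 = ‖I.x0 - xs‖ ^ 2 := by simp [hr, Input.e_zero, Input.x_zero, avg]
  have e : ∑ k ∈ Finset.range (K + 1), weight η k
        * (-(I.γ / 2 * Δ k) + 3 * L * I.γ * ε k + I.γ ^ 2 * (avg Dti / n))
      = -(I.γ / 2 * ∑ k ∈ Finset.range (K + 1), weight η k * Δ k)
        + I.γ * (3 * L * ∑ k ∈ Finset.range (K + 1), weight η k * ε k)
        + I.γ ^ 2 * (avg Dti / n) * weightSum η K := by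
    rw [weightSum, Finset.mul_sum, Finset.mul_sum, Finset.mul_sum, Finset.mul_sum, ← Finset.sum_neg_distrib, ← Finset.sum_add_distrib,
      ← Finset.sum_add_distrib]
    exact Finset.sum_congr rfl fun k _ => by ring
  rw [e, hr0] at h1
  have h3 := mul_le_mul_of_nonneg_left (hE.bound K) hγ0.le
  have hσ : ∫ w, I.sigmaSq fi xs 0 w ∂P
      = avg (fun i => ‖I.h0 i - gradient (fi i) xs‖ ^ 2) := by
    simp [Input.sigmaSq, Input.h_zero]
  rw [hσ, zero_mul, add_zero] at h3
  set X := ∑ k ∈ Finset.range (K + 1), weight η k * Δ k with hX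
  set R := ‖I.x0 - xs‖ ^ 2 + I.γ * F1 * avg (fun i => ‖I.h0 i - gradient (fi i) xs‖ ^ 2) with hR
  have hW := weightSum_pos hη K
  -- Of the gain `γ/2`, the accumulated errors consume `γ/4`; the remaining `γ/4` is the source of
  -- the factor `4/γ`.
  have h4 : I.γ / 4 * X ≤ R + I.γ ^ 2 * (avg Dti / n + D3) * weightSum η K := by
    simp only [hX, hΔ, hε, hR] at h1 h2 h3 ⊢
    linarith
  have h5 : ∫ w, (f (wavg η I.x K w) - f xs) ∂P ≤ (weightSum η K)⁻¹ * X := by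
    have hi : ∀ k ∈ Finset.range (K + 1),
        Integrable (fun w => weight η k * (f (I.x k w) - f xs)) P :=
      fun k _ => (integrable_gap hL hfs hq (hx k)).const_mul _
    have e : X = ∫ w, ∑ k ∈ Finset.range (K + 1), weight η k * (f (I.x k w) - f xs) ∂P := by
      rw [integral_finsetSum _ hi, hX]
      exact Finset.sum_congr rfl fun k _ => (integral_const_mul _ _).symm
    rw [e, ← integral_const_mul]
    exact integral_mono (integrable_gap hL hfs hq (memLp_wavg hx K))
      ((integrable_finsetSum _ hi).const_mul _) fun w => gap_wavg_le hη hfc I.x xs K w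
  refine h5.trans ?_
  have h6 := mul_le_mul_of_nonneg_left h4
    (by positivity : 0 ≤ 4 / I.γ * (weightSum η K)⁻¹)
  have e1 : 4 / I.γ * (weightSum η K)⁻¹ * (I.γ / 4 * X) = (weightSum η K)⁻¹ * X := by
    field_simp
  have e2 : 4 / I.γ * (weightSum η K)⁻¹
        * (R + I.γ ^ 2 * (avg Dti / n + D3) * weightSum η K)
      = 4 * R / I.γ * (weightSum η K)⁻¹ + 4 * I.γ * (avg Dti / n + D3) := by
    field_simp
  rw [e1, e2] at h6
  exact h6

end Convergence

/-! ### Explicit rates and iteration complexity. -/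

section Rates

theorem inv_weightSum_le {η : ℝ} (hη0 : 0 ≤ η) (hη : η < 1) (K : ℕ) :
    (weightSum η K)⁻¹ ≤ (1 - η) ^ K := by
  have h1 : weight η K ≤ weightSum η K :=
    Finset.single_le_sum (f := weight η) (fun k _ => (weight_pos hη k).le) (by simp)
  calc (weightSum η K)⁻¹ ≤ (weight η K)⁻¹ := inv_anti₀ (weight_pos hη K) h1
    _ = (1 - η) ^ (K + 1) := by rw [weight, inv_inv]
    _ ≤ (1 - η) ^ K := pow_le_pow_of_le_one (by linarith) (by linarith) K.le_succ

theorem weightSum_zero (K : ℕ) : weightSum 0 K = K + 1 := by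
  simp [weightSum, weight]

theorem le_of_linear_rate {η c B ε : ℝ} {K : ℕ} (hη0 : 0 < η) (hη : η < 1) (hB : 0 ≤ B)
    (hε : 0 < ε) (hc : 1 ≤ η * c) (hK : c * Real.log (B / ε) ≤ K) : (1 - η) ^ K * B ≤ ε := by
  have h0 : 0 ≤ 1 - η := by linarith
  -- The first case needs no condition on `K` and includes `B = 0`, where `Real.log 0 = 0`.
  rcases le_or_gt B ε with h | h
  · exact (mul_le_of_le_one_left hB (pow_le_one₀ h0 (by linarith))).trans h
  · have hB' : 0 < B := hε.trans h
    have hlog : 0 ≤ Real.log (B / ε) := Real.log_nonneg ((one_le_div hε).2 h.le)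
    have h1 : Real.log (B / ε) ≤ K * η := by nlinarith
    have h2 : (1 - η) ^ K ≤ ε / B := by
      calc (1 - η) ^ K ≤ Real.exp (-η) ^ K := pow_le_pow_left₀ h0 (Real.one_sub_le_exp_neg η) K
        _ = Real.exp (-(K * η)) := by rw [← Real.exp_nat_mul]; ring_nf
        _ ≤ Real.exp (-Real.log (B / ε)) := Real.exp_le_exp.2 (neg_le_neg h1)
        _ = ε / B := by rw [Real.exp_neg, Real.exp_log (by positivity), inv_div]
    exact (le_div_iff₀ hB').1 h2

theorem log_div_le_two_mul {B ε : ℝ} (hB : 0 ≤ B) (hε : 0 < ε) (h : ε ≤ 1 / (B + 1)) :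
    Real.log (B / ε) ≤ 2 * Real.log (1 / ε) := by
  rw [le_div_iff₀ (by positivity)] at h
  have h1 : ε ≤ 1 := by nlinarith
  have h2 : 0 ≤ Real.log (1 / ε) := Real.log_nonneg ((one_le_div hε).2 h1)
  rcases hB.eq_or_lt with rfl | hB'
  · rw [zero_div, Real.log_zero]
    positivity
  · have e : 2 * Real.log (1 / ε) = Real.log ((1 / ε) ^ 2) := by
      rw [Real.log_pow]; norm_num
    rw [e]
    -- The condition on `ε` gives `Bε ≤ 1`, that is, `B/ε ≤ 1/ε²`.
    refine Real.log_le_log (by positivity) ?_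
    rw [div_pow, one_pow, div_le_div_iff₀ hε (by positivity)]
    nlinarith

variable {L μ δ α ω : ℝ}

theorem maxStep_ge (hL : 0 < L) (hδ0 : 0 < δ) (hδ1 : δ ≤ 1) (hα : α ≤ 1 / 2) :
    δ / (50 * L) ≤ maxStep L δ α := by
  have h3 : 0 < 6 * (3 - α) := by linarith
  refine le_min ?_ ?_
  · rw [div_le_div_iff₀ (by positivity) (by positivity)]
    nlinarith
  · have hs : 0 < √(6 * (3 - α)) := Real.sqrt_pos.2 h3
    -- After squaring, `1152 - 384α ≤ 2500 - 2500α`, which holds for `α ≤ 1/2`.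
    have h4 : 8 * √(6 * (3 - α)) ≤ 50 * √(1 - α) := by
      refine abs_le_of_sq_le_sq' ?_ (by positivity) |>.2
      rw [mul_pow, mul_pow, Real.sq_sqrt h3.le, Real.sq_sqrt (by linarith)]
      linarith
    rw [div_le_div_iff₀ (by positivity) (by positivity)]
    have := mul_le_mul_of_nonneg_left h4 (by positivity : 0 ≤ δ * L)
    linarith

/-- Each entry of the minimum is treated separately: `γμ/2 ≥ δ/(100κ)` pairs with `100κ/δ`, and `α ≥
1/(ω + 2)` pairs with `ω + κ/δ ≥ ω + 1`. -/
theorem one_le_rate_mul (hL : 0 < L) (hμ : 0 < μ) (hμL : μ ≤ L) (hδ0 : 0 < δ) (hδ1 : δ ≤ 1)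
    (hω : 0 ≤ ω) (hα : α = min (1 / (ω + 1)) (1 / 2)) :
    1 ≤ min (maxStep L δ α * μ / 2) (α / 4) * (100 * (ω + L / μ / δ)) := by
  have hκ : 1 ≤ L / μ / δ := by
    rw [le_div_iff₀ hδ0, le_div_iff₀ hμ]
    nlinarith
  have hα2 : α ≤ 1 / 2 := hα ▸ min_le_right _ _
  have hαl : 1 / (ω + 2) ≤ α := by
    rw [hα]
    refine le_min ?_ ?_ <;> exact one_div_le_one_div_of_le (by positivity) (by linarith)
  have hc : 0 < 100 * (ω + L / μ / δ) := by positivity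
  rw [← div_le_iff₀ hc]
  refine le_min ?_ ?_
  · rw [div_le_iff₀ hc]
    have h1 := maxStep_ge hL hδ0 hδ1 hα2
    have h2 : δ / (50 * L) * μ / 2 * (100 * (L / μ / δ)) = 1 := by field_simp; norm_num
    rw [← h2]
    have h3 : 0 < maxStep L δ α := lt_of_lt_of_le (by positivity) h1
    gcongr
    linarith
  · rw [div_le_iff₀ hc]
    rw [div_le_iff₀ (by positivity)] at hαl
    have hα0 : 0 < α := by
      by_contra hneg
      nlinarith
    nlinarith

end Rates

end ECDiana

/-! ### The main theorem. -/

open ECDiana in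
theorem mainTheorem4 {n d : ℕ} (hn : 0 < n)
    {Ω SC SQ : Type*} [MeasurableSpace Ω] [MeasurableSpace SC] [MeasurableSpace SQ]
    (P : Measure Ω) [IsProbabilityMeasure P]
    (νC : Measure SC) [IsProbabilityMeasure νC] (νQ : Measure SQ) [IsProbabilityMeasure νQ]
    (fi : Fin n → E d → ℝ) (f : E d → ℝ) (hf : f = fun x => avg (fun i => fi i x))
    (xs : E d) (L μ δ ω : ℝ) (hL : 0 < L) (hμ : 0 ≤ μ)
    (hconv : ∀ i, ConvexOn ℝ Set.univ (fi i)) (hsmooth : ∀ i, IsLSmooth (fi i) L)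
    (hqsc : IsQuasiStronglyConvex f xs μ)
    (I : Input n d Ω SC SQ) (hC : IsCompressor νC I.C δ) (hQ : IsQuantizer νQ I.Q ω)
    (Dti : Fin n → ℝ) (hI : Sampling P νC νQ fi Dti I)
    (hγ0 : 0 < I.γ) (hα0 : 0 < I.α) (hα : I.α ≤ 1 / (ω + 1))
    (hγ : I.γ ≤ maxStep L δ I.α)
    (Dt η F1 D1p D3 σ0sq Δ0 : ℝ)
    (hDt : Dt = avg Dti)
    (hη : η = min (I.γ * μ / 2) (I.α / 4))
    (hF1 : F1 = 96 * L * I.γ ^ 2 / (δ ^ 2 * I.α * (1 - η)))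
    (hD1p : D1p = Dt / n)
    (hD3 : D3 = 6 * L * I.γ / δ * (4 * I.α * (ω + 1) / δ + 1) * Dt)
    (hσ0sq : σ0sq = avg (fun i => ‖I.h0 i - gradient (fi i) xs‖ ^ 2))
    (hΔ0 : Δ0 = 4 * (‖I.x0 - xs‖ ^ 2 + I.γ * F1 * σ0sq) / I.γ) :
    -- the parametric assumption holds with the stated constants
    KeyAssumption P I.history f xs I.x I.g (I.sigmaSq fi xs) (fun _ _ => 0)
        (dianaParams n L I.α ω Dt) ∧
    (dianaParams n L I.α ω Dt).M1 = 0 ∧ (dianaParams n L I.α ω Dt).M2 = 0 ∧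
    (dianaParams n L I.α ω Dt).eta I.γ μ = η ∧
    ErrorBound P f xs I.x I.e (I.sigmaSq fi xs) (fun _ _ => 0) L I.γ η F1 0 D3 ∧
    -- convergence to a neighbourhood
    (∀ K, Integrable (fun w => f (wavg η I.x K w) - f xs) P) ∧
    (0 < μ → ∀ K : ℕ,
      ∫ w, (f (wavg η I.x K w) - f xs) ∂P ≤ (1 - η) ^ K * Δ0 + 4 * I.γ * (D1p + D3)) ∧
    (μ = 0 → ∀ K : ℕ, 0 < K →
      ∫ w, (f (wavg η I.x K w) - f xs) ∂P
        ≤ 4 * (‖I.x0 - xs‖ ^ 2 + I.γ * F1 * σ0sq) / (I.γ * K) + 4 * I.γ * (D1p + D3)) ∧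
    -- full gradients: no neighbourhood
    (Dt = 0 →
      (∀ k i, I.ghat k i =ᵐ[P] fun w => gradient (fi i) (I.x k w)) ∧ D1p = 0 ∧ D3 = 0) ∧
    -- full gradients: linear rate to the exact solution
    (Dt = 0 → 0 < μ → I.α = min (1 / (ω + 1)) (1 / 2) → I.γ = maxStep L δ I.α →
      (∀ ε : ℝ, 0 < ε → ∀ K : ℕ,
        100 * (ω + L / μ / δ) * Real.log (Δ0 / ε) ≤ K →
          ∫ w, (f (wavg η I.x K w) - f xs) ∂P ≤ ε) ∧
      (∃ ε0 : ℝ, 0 < ε0 ∧ ∀ ε : ℝ, 0 < ε → ε ≤ ε0 → ∀ K : ℕ,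
        200 * (ω + L / μ / δ) * Real.log (1 / ε) ≤ K →
          ∫ w, (f (wavg η I.x K w) - f xs) ∂P ≤ ε)) := by
  subst hDt hF1 hD1p hD3 hσ0sq
  have hω := hQ.omega_nonneg
  have hδ0 := hC.delta_pos
  have hδ1 := hC.delta_le_one
  have hα' : I.α * (ω + 1) ≤ 1 := (le_div_iff₀ (by positivity)).1 hα
  have hα1 : I.α ≤ 1 := by nlinarith
  have hη0 : 0 ≤ η := hη ▸ le_min (by positivity) (by positivity)
  have hημ : η ≤ I.γ * μ / 2 := hη ▸ min_le_left _ _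
  have hηα : η ≤ I.α / 4 := hη ▸ min_le_right _ _
  have hη1 : η < 1 := by linarith
  have hfs : IsLSmooth f L := hf ▸ IsLSmooth.avg hn hsmooth
  have hfc : ConvexOn ℝ Set.univ f := hf ▸ convexOn_avg hconv
  have hE := hI.errorBound hn hL hf hconv hqsc hsmooth hC hQ hγ0 hα0 hα' hγ hη0 hημ hηα
  have hconvg := hI.integral_gap_wavg_le hn hL hμ hf hconv hqsc hsmooth hC hQ hγ0
    (mul_le_of_le_maxStep hL hγ) hη1 hημ hE
  have hR : 0 ≤ 4 * (‖I.x0 - xs‖ ^ 2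
      + I.γ * (96 * L * I.γ ^ 2 / (δ ^ 2 * I.α * (1 - η)))
        * avg (fun i => ‖I.h0 i - gradient (fi i) xs‖ ^ 2)) := by
    have h1 := hE.const_nonneg.1
    have h2 : 0 ≤ avg (fun i => ‖I.h0 i - gradient (fi i) xs‖ ^ 2) :=
      avg_nonneg fun i => sq_nonneg _
    positivity
  have hΔ0' : 0 ≤ Δ0 := hΔ0 ▸ div_nonneg hR hγ0.le
  have hlin : ∀ K : ℕ, ∫ w, (f (wavg η I.x K w) - f xs) ∂P ≤ (1 - η) ^ K * Δ0
      + 4 * I.γ * (avg Dti / n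
        + 6 * L * I.γ / δ * (4 * I.α * (ω + 1) / δ + 1) * avg Dti) := by
    intro K
    refine (hconvg K).trans (add_le_add ?_ le_rfl)
    rw [← hΔ0, mul_comm]
    exact mul_le_mul_of_nonneg_right (inv_weightSum_le hη0 hη1 K) hΔ0'
  have hrate : avg Dti = 0 → 0 < μ → I.α = min (1 / (ω + 1)) (1 / 2) → I.γ = maxStep L δ I.α →
      ∀ ε : ℝ, 0 < ε → ∀ K : ℕ, 100 * (ω + L / μ / δ) * Real.log (Δ0 / ε) ≤ K →
        ∫ w, (f (wavg η I.x K w) - f xs) ∂P ≤ ε := by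
    intro hD hμ0 hαeq hγeq ε hε K hK
    -- In dimension zero the gap is identically zero, so `μ ≤ L` is needed only otherwise.
    rcases isEmpty_or_nonempty (Fin d) with hd | hd
    · have e : ∀ w, f (wavg η I.x K w) - f xs = 0 := fun w => by
        rw [Subsingleton.elim (wavg η I.x K w) xs, sub_self]
      simp only [e, integral_zero]
      exact hε.le
    · have h1 := one_le_rate_mul hL hμ0 (le_smoothness hL hfs hfc hqsc) hδ0 hδ1 hω hαeq
      rw [← hγeq, ← hη] at h1
      have hηpos : 0 < η := by
        rw [hη]; exact lt_min (by positivity) (by positivity)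
      have h2 := hlin K
      rw [hD, zero_div, mul_zero, add_zero, mul_zero, add_zero] at h2
      exact h2.trans (le_of_linear_rate hηpos hη1 hΔ0' hε h1 hK)
  refine ⟨hI.keyAssumption hn hL hf hconv hqsc hsmooth hC hQ hα0 hα', ?_, ?_, ?_, hE, ?_,
    fun _ => hlin, ?_, ?_, ?_⟩
  · simp [Params.M1, dianaParams]
  · simp [Params.M2, dianaParams]
  · simp only [Params.eta, dianaParams]
    rw [min_eq_left (by linarith : I.α / 4 ≤ 1 / 4), hη]
  · exact fun K => integrable_gap hL hfs hqsc
      (memLp_wavg (fun k => (hI.memLp_state hsmooth hC hQ k).1) K)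
  · intro hμ0 K hK
    refine (hconvg K).trans (add_le_add ?_ le_rfl)
    have hη' : η = 0 := le_antisymm (by rw [hμ0] at hημ; linarith) hη0
    have hK' : (0 : ℝ) < K := by exact_mod_cast hK
    -- For `μ = 0` the rate `η` is zero and all weights are `1`; the denominator `K + 1` is then
    -- weakened to `K`.
    have hW : weightSum η K = K + 1 := by rw [hη', weightSum_zero]
    rw [hW, ← div_eq_mul_inv, div_div]
    exact div_le_div_of_nonneg_left hR (by positivity)
      (mul_le_mul_of_nonneg_left (by linarith) hγ0.le)
  · intro hD
    refine ⟨fun k i => ?_, by rw [hD, zero_div], by rw [hD, mul_zero]⟩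
    -- The variance bounds are nonnegative, so a zero mean forces each of them to vanish.
    have hsum : ∑ i, Dti i = 0 := by
      rw [avg_def_real] at hD
      have : (n : ℝ)⁻¹ ≠ 0 := by positivity
      exact (mul_eq_zero.1 hD).resolve_left this
    exact hI.ghat_eq_of_variance_eq_zero ((Finset.sum_eq_zero_iff_of_nonneg
      fun i _ => hI.variance_nonneg i).1 hsum i (Finset.mem_univ i)) k
  · intro hD hμ0 hαeq hγeq
    refine ⟨hrate hD hμ0 hαeq hγeq, 1 / (Δ0 + 1), by positivity, fun ε hε hε0 K hK => ?_⟩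
    refine hrate hD hμ0 hαeq hγeq ε hε K (le_trans ?_ hK)
    have := mul_le_mul_of_nonneg_left (log_div_le_two_mul hΔ0' hε hε0)
      (by positivity : 0 ≤ 100 * (ω + L / μ / δ))
    linarith
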